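/- Let $G_0$ be an $N\times N$ complex Ginibre matrix, i.e. with independent standard complex normal entries ($\mathbb E|G_{0,jk}|^2=1$), let $\alpha\in\mathbb C$ be fixed, let $\mathbf r=\mathbf r_N\in\mathbb C^N$ be any unit vectors ($\mathbf r^*\mathbf r=1$), and put $a=\sqrt N\,\alpha$ and $A=a\,\mathbf r\otimes\mathbf r^*$. For $N\ge 1$ the mean eigenvalue density $p_N(z)=\mathbb E\sum_{k=1}^N\delta^{(2)}(z-z_k)$ of $G_0+A$, where $z_1,\dots,z_N$ are the eigenvalues of $G_0+A$ counted with multiplicity, exists as a unique continuous function on $\mathbb C$ (with respect to Lebesgue measure, of total mass $N$). For fixed $w\in\mathbb C$ put $$\Delta=|\alpha|^2-(\alpha\overline w+\overline\alpha w),\qquad \mathcal F(w)=|w-\alpha|^2+\ln\left|1-\frac{|w-\alpha|^2}{|w|^2}\right|,$$ $$B(w)=\frac{|\Delta|}{|w|^2}-\frac{|\alpha|^2\,(1-|\Delta|^{-1})}{(|w|^2-1)\,|w|^2}.$$ 1. If $|w|<1$, then $\lim_{N\to\infty}p_N(\sqrt N w)=\frac1\pi$, for every $\alpha$. 2. If $|w|>1$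 and $\Delta<-1$, then $\lim_{N\to\infty}e^{N\mathcal F(w)}\,p_N(\sqrt N w)=\frac1\pi B(w)$; in particular, if $B(w)\neq 0$, $$p_N(\sqrt N w)\sim\frac1\pi\,e^{-N\mathcal F(w)}B(w)\qquad(N\to\infty).$$ 3. On the region $|w|>1$, $\Delta<-1$ one has $\mathcal F(w)\ge 0$, with equality if and only if $w=\alpha$. The point $w=\alpha$ lies in this region if and only if $|\alpha|>1$ (the outlier at $w=\alpha$). -/

import Mathlib

open MeasureTheory ProbabilityTheory Filter Topology Asymptotics
open scoped Matrix NNReal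

/-- The standard complex normal law `N_C(0,1)`: the law of `x + i y` with `x`, `y` independent
real centred Gaussians of variance `1/2`. -/
noncomputable def stdComplexNormal : Measure ℂ :=
  ((gaussianReal 0 (1 / 2 : ℝ≥0)).prod (gaussianReal 0 (1 / 2 : ℝ≥0))).map
    (fun q : ℝ × ℝ => (q.1 : ℂ) + (q.2 : ℂ) * Complex.I)

/-- The complex Ginibre ensemble: the law of an `N × N` array of independent `N_C(0,1)` entries. -/
noncomputable def ginibreLaw (N : ℕ) : Measure (Fin N → Fin N → ℂ) :=
  Measure.pi fun _ => Measure.pi fun _ => stdComplexNormal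

/-- The linear statistic `∑ₐ f (zₐ)` over the eigenvalues `zₐ` of `X`, counted with algebraic
multiplicity, i.e. the empirical density `∑ₐ δ(z - zₐ)` tested against `f`. -/
noncomputable def eigenvalueSum {N : ℕ} (X : Matrix (Fin N) (Fin N) ℂ) (f : ℂ → ℝ) : ℝ :=
  (X.charpoly.roots.map f).sum

/-- `p` is the (continuous) mean eigenvalue density of `G₀ + A`, `G₀` complex Ginibre, with respect
to Lebesgue measure on `ℂ`: the expectation of the empirical density `∑ₐ δ(z - zₐ)`, without a
factor `1/N`, is `p` in the sense of distributions. Continuity fixes the pointwise values. -/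
def IsMeanEigenvalueDensity {N : ℕ} (A : Matrix (Fin N) (Fin N) ℂ) (p : ℂ → ℝ) : Prop :=
  Continuous p ∧
    ∀ f : ℂ → ℝ, Continuous f → HasCompactSupport f →
      Integrable (fun G => eigenvalueSum (Matrix.of G + A) f) (ginibreLaw N) ∧
        ∫ G, eigenvalueSum (Matrix.of G + A) f ∂(ginibreLaw N) = ∫ z, f z * p z

/-- The normal rank-one matrix `a r ⊗ r*`. -/
def rankOneNormal {N : ℕ} (a : ℂ) (r : Fin N → ℂ) : Matrix (Fin N) (Fin N) ℂ :=
  a • Matrix.vecMulVec r (star r)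

/-- `Δ = |α|² - (α w̄ + ᾱ w)`, a real number. -/
noncomputable def outlierDelta (α w : ℂ) : ℝ :=
  ‖α‖ ^ 2 - (α * star w + star α * w).re

/-- The rate function `F(w) = |w - α|² + ln |1 - |w - α|² / |w|²|`. -/
noncomputable def outlierRate (α w : ℂ) : ℝ :=
  ‖w - α‖ ^ 2 + Real.log |1 - ‖w - α‖ ^ 2 / ‖w‖ ^ 2|

/-- The prefactor `|Δ| / |w|² - |α|² (1 - |Δ|⁻¹) / ((|w|² - 1) |w|²)`. -/
noncomputable def outlierPrefactor (α w : ℂ) : ℝ :=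
  |outlierDelta α w| / ‖w‖ ^ 2 -
    ‖α‖ ^ 2 * (1 - |outlierDelta α w|⁻¹) / ((‖w‖ ^ 2 - 1) * ‖w‖ ^ 2)

open scoped ENNReal ComplexConjugate

/-! ### The complex Gaussian law -/

/-! Unitary invariance of the Ginibre law moves the perturbation into one corner entry: linear
statistics of `G + a r r*` have the law of those of `G + a e₀ e₀*`. Split this matrix into corner
`x`, row `b`, column `v` and block `C`. For frozen `b`, `v`, `C` the eigenvalues are generically the
solutions of `R(z) = x`, where `R(z) = z - b (z - C)⁻¹ v` is a Schur complement. Integrating over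
the Gaussian `x` is therefore an area formula for the holomorphic map `R`, with weight `|R'|²`
(`lintegral_sum_roots_borderedMatrix`). The substitution `v = (z - C) y`, which makes the
eigenvector `(1, y)` a variable, has Jacobian `|det (z - C)|²` and turns `|R'|²` into the polynomial
weight `|det (z - C + y b)|²`.

The average of the resulting kernel over `C` and `b` depends only on `s = |y|`, again by unitary
invariance. For `y = s e₀` the exponential factor splits over the entries. They stay independent,
the off-diagonal ones centred, so the second moment of the determinant is a permanent
(`integral_det_mul_conj_det`). The unequal variances cancel along every permutation. What remains is
a count of permutations weighted by their fixed points, and this produces truncated exponential sums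
in `|z|²`. In polar coordinates with `x = 1 / (1 + s²)` the density for `N = m + 2` becomes a
one-dimensional integral, `meanDensity`.

The moments `J k = ∫ (1 - x)^k exp (l x)` over the unit interval satisfy `l J (k + 1) = (k + 1) J k
- 1`, which reduces the density to three terms. Put `U = |w|²` and `δ = -Δ`; then `δ ≤ U`, because
`|w - α|² = U + Δ`. If `U < 1`, the first term is a Poisson probability tending to `1`, the second
is a vanishing Poisson weight times a bounded factor, and the third is `O(1/N)`. If `U > 1` and `δ >
1`, the closed form of `J k` at `l = N δ` carries `exp (N δ)`, hence the rate `F`, and the first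
term becomes negligible. The truncated exponential, divided by the next term of its series, tends to
the geometric sum `1 / (U - 1)`, which gives the negative part of `B`. Finally `F ≥ 0` because `log
(U / δ) ≤ U / δ - 1 ≤ U - δ` for `1 < δ ≤ U`. -/

theorem lintegral_stdComplexNormal {f : ℂ → ℝ≥0∞} (hf : Measurable f) :
    ∫⁻ z, f z ∂stdComplexNormal
      = ∫⁻ z, ENNReal.ofReal (Real.pi⁻¹ * Real.exp (-‖z‖ ^ 2)) * f z := by
  have hm : Measurable fun q : ℝ × ℝ => (q.1 : ℂ) + (q.2 : ℂ) * Complex.I := by fun_prop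
  have hv : (1 / 2 : ℝ≥0) ≠ 0 := by norm_num
  rw [stdComplexNormal, lintegral_map hf hm, gaussianReal_of_var_ne_zero _ hv,
    prod_withDensity (measurable_gaussianPDF _ _) (measurable_gaussianPDF _ _)]
  have hmg : Measurable fun q : ℝ × ℝ => gaussianPDF 0 (1 / 2) q.1 * gaussianPDF 0 (1 / 2) q.2 :=
    ((measurable_gaussianPDF _ _).comp measurable_fst).mul
      ((measurable_gaussianPDF _ _).comp measurable_snd)
  rw [lintegral_withDensity_eq_lintegral_mul (volume.prod volume) hmg
      (g := fun q : ℝ × ℝ => f ((q.1 : ℂ) + (q.2 : ℂ) * Complex.I)) (hf.comp hm),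
    ← Complex.volume_preserving_equiv_real_prod.symm.lintegral_comp (by fun_prop)]
  refine lintegral_congr fun q => ?_
  have hq : Complex.measurableEquivRealProd.symm q = (q.1 : ℂ) + (q.2 : ℂ) * Complex.I := by
    apply Complex.ext <;> simp [Complex.measurableEquivRealProd]
  simp only [Pi.mul_apply, hq]
  congr 1
  rw [gaussianPDF, gaussianPDF, ← ENNReal.ofReal_mul (gaussianPDFReal_nonneg _ _ _)]
  congr 1
  rw [Complex.sq_norm, Complex.normSq_add_mul_I]
  simp only [gaussianPDFReal, sub_zero]
  have h2 : (2 : ℝ) * Real.pi * ((1 / 2 : ℝ≥0) : ℝ) = Real.pi := by push_cast; ring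
  rw [h2, mul_mul_mul_comm, ← Real.exp_add, ← mul_inv, Real.mul_self_sqrt Real.pi_pos.le]
  congr 2
  push_cast
  ring

theorem stdComplexNormal_eq_withDensity :
    stdComplexNormal
      = volume.withDensity fun z : ℂ => ENNReal.ofReal (Real.pi⁻¹ * Real.exp (-‖z‖ ^ 2)) := by
  ext s hs
  rw [withDensity_apply _ hs, ← lintegral_indicator_one hs,
    lintegral_stdComplexNormal (measurable_one.indicator hs), ← lintegral_indicator hs]
  refine lintegral_congr fun z => ?_
  by_cases hz : z ∈ s <;> simp [hz]

instance : IsProbabilityMeasure stdComplexNormal := by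
  unfold stdComplexNormal
  exact Measure.isProbabilityMeasure_map (by fun_prop)

theorem MeasureTheory.Measure.pi_withDensity {ι : Type*} [Fintype ι] {α : ι → Type*}
    [∀ i, MeasurableSpace (α i)] (μ : ∀ i, Measure (α i)) [∀ i, SigmaFinite (μ i)]
    (f : ∀ i, α i → ℝ) (hf : ∀ i, Integrable (f i) (μ i)) (h0 : ∀ i x, 0 ≤ f i x) :
    Measure.pi (fun i => (μ i).withDensity fun x => ENNReal.ofReal (f i x))
      = (Measure.pi μ).withDensity fun x => ENNReal.ofReal (∏ i, f i (x i)) := by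
  have : ∀ i, IsFiniteMeasure ((μ i).withDensity fun x => ENNReal.ofReal (f i x)) :=
    fun i => isFiniteMeasure_withDensity_ofReal (hf i).2
  refine Measure.pi_eq fun s hs => ?_
  have hint : ∀ i, Integrable (f i) ((μ i).restrict (s i)) := fun i => (hf i).restrict
  rw [withDensity_apply _ (MeasurableSet.univ_pi hs), Measure.restrict_pi_pi,
    ← ofReal_integral_eq_lintegral_ofReal (Integrable.fintype_prod_dep hint)
      (Eventually.of_forall fun x => Finset.prod_nonneg fun i _ => h0 i _),
    integral_fintype_prod_eq_prod, ENNReal.ofReal_prod_of_nonneg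
      fun i _ => integral_nonneg (h0 i)]
  refine Finset.prod_congr rfl fun i _ => ?_
  rw [withDensity_apply _ (hs i), ofReal_integral_eq_lintegral_ofReal (hint i)
    (Eventually.of_forall (h0 i))]

theorem integrable_exp_neg_mul_norm_sq {t : ℝ} (ht : 0 < t) :
    Integrable fun z : ℂ => Real.exp (-t * ‖z‖ ^ 2) := by
  have := GaussianFourier.integrable_cexp_neg_mul_sq_norm_add (V := ℂ) (b := (t : ℂ))
    (by simpa using ht) 0 0
  refine this.re.congr (Eventually.of_forall fun z => ?_)
  simp only [zero_mul, add_zero]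
  rw [show (-(t : ℂ) * (‖z‖ : ℂ) ^ 2) = ((-t * ‖z‖ ^ 2 : ℝ) : ℂ) by push_cast; ring,
    ← Complex.ofReal_exp]
  rfl

/-- The law of a vector with independent standard complex normal entries. -/
noncomputable def complexGaussian (ι : Type*) [Fintype ι] : Measure (ι → ℂ) :=
  Measure.pi fun _ => stdComplexNormal

instance (ι : Type*) [Fintype ι] : IsProbabilityMeasure (complexGaussian ι) := by
  unfold complexGaussian; infer_instance

instance (N : ℕ) : IsProbabilityMeasure (ginibreLaw N) := by
  unfold ginibreLaw; infer_instance

theorem complexGaussian_eq_withDensity (ι : Type*) [Fintype ι] :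
    complexGaussian ι = volume.withDensity fun y : ι → ℂ =>
      ENNReal.ofReal ((Real.pi⁻¹) ^ Fintype.card ι * Real.exp (-∑ i, ‖y i‖ ^ 2)) := by
  have hint : Integrable fun z : ℂ => Real.pi⁻¹ * Real.exp (-‖z‖ ^ 2) := by
    simpa using (integrable_exp_neg_mul_norm_sq one_pos).const_mul Real.pi⁻¹
  rw [complexGaussian, stdComplexNormal_eq_withDensity,
    Measure.pi_withDensity _ (fun _ z => Real.pi⁻¹ * Real.exp (-‖z‖ ^ 2)) (fun _ => hint)
      fun _ z => by positivity]
  rw [volume_pi]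
  congr 1
  ext y
  rw [Finset.prod_mul_distrib, ← Real.exp_sum, Finset.sum_neg_distrib, Finset.prod_const,
    Finset.card_univ]

theorem lintegral_complexGaussian {ι : Type*} [Fintype ι] {f : (ι → ℂ) → ℝ≥0∞}
    (hf : Measurable f) :
    ∫⁻ y, f y ∂complexGaussian ι = ∫⁻ y, ENNReal.ofReal
      ((Real.pi⁻¹) ^ Fintype.card ι * Real.exp (-∑ i, ‖y i‖ ^ 2)) * f y := by
  rw [complexGaussian_eq_withDensity,
    lintegral_withDensity_eq_lintegral_mul _ (by fun_prop) hf]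
  rfl

theorem complexGaussian_absolutelyContinuous (ι : Type*) [Fintype ι] :
    complexGaussian ι ≪ volume := by
  rw [complexGaussian_eq_withDensity]
  exact withDensity_absolutelyContinuous _ _

/-! ### Linear changes of variables and unitary invariance -/

/-- The real determinant of a complex-linear map is the norm from `ℂ` to `ℝ` of its complex
determinant. -/
theorem abs_det_restrictScalars_mulVecLin {n : Type*} [Fintype n] [DecidableEq n]
    (M : Matrix n n ℂ) : LinearMap.det ((Matrix.mulVecLin M).restrictScalars ℝ) = ‖M.det‖ ^ 2 := by
  rw [LinearMap.det_restrictScalars, Algebra.norm_complex_apply, Complex.normSq_eq_norm_sq,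
    ← Matrix.toLin'_apply', LinearMap.det_toLin']

/-- Serves twice: for unitary invariance of the Gaussian law, and for the change from the column `v`
to the eigenvector `y`. -/
theorem lintegral_comp_mulVec {n : Type*} [Fintype n] [DecidableEq n]
    (M : Matrix n n ℂ) (hM : M.det ≠ 0) {f : (n → ℂ) → ℝ≥0∞} (hf : Measurable f) :
    ∫⁻ x, f x = ENNReal.ofReal (‖M.det‖ ^ 2) * ∫⁻ y, f (M *ᵥ y) := by
  have hd : LinearMap.det ((Matrix.mulVecLin M).restrictScalars ℝ) ≠ 0 := by
    rw [abs_det_restrictScalars_mulVecLin]; positivity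
  have hmap := Measure.map_linearMap_addHaar_eq_smul_addHaar (volume : Measure (n → ℂ)) hd
  have hmeas : Measurable fun y : n → ℂ => M *ᵥ y := by fun_prop
  have h1 : ∫⁻ y, f (M *ᵥ y)
      = ∫⁻ x, f x ∂(Measure.map ((Matrix.mulVecLin M).restrictScalars ℝ) volume) := by
    rw [lintegral_map hf (by exact hmeas)]; rfl
  have hpos : 0 < ‖M.det‖ ^ 2 := by positivity
  rw [h1, hmap, lintegral_smul_measure, abs_det_restrictScalars_mulVecLin,
    abs_of_pos (inv_pos.2 hpos), smul_eq_mul, ← mul_assoc, ← ENNReal.ofReal_mul hpos.le,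
    mul_inv_cancel₀ hpos.ne', ENNReal.ofReal_one, one_mul]

theorem sum_norm_sq_eq_dotProduct {n : Type*} [Fintype n] (y : n → ℂ) :
    ((∑ i, ‖y i‖ ^ 2 : ℝ) : ℂ) = star y ⬝ᵥ y := by
  simp [dotProduct, Complex.conj_mul']

theorem sum_norm_sq_mulVec_of_unitary {n : Type*} [Fintype n] [DecidableEq n]
    {U : Matrix n n ℂ} (hU : star U * U = 1) (y : n → ℂ) :
    ∑ i, ‖(U *ᵥ y) i‖ ^ 2 = ∑ i, ‖y i‖ ^ 2 := by
  have : ((∑ i, ‖(U *ᵥ y) i‖ ^ 2 : ℝ) : ℂ) = ((∑ i, ‖y i‖ ^ 2 : ℝ) : ℂ) := by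
    rw [sum_norm_sq_eq_dotProduct, sum_norm_sq_eq_dotProduct, Matrix.star_mulVec,
      ← Matrix.dotProduct_mulVec, Matrix.mulVec_mulVec, ← Matrix.star_eq_conjTranspose, hU,
      Matrix.one_mulVec]
  exact_mod_cast this

theorem norm_det_of_unitary {n : Type*} [Fintype n] [DecidableEq n]
    {U : Matrix n n ℂ} (hU : star U * U = 1) : ‖U.det‖ = 1 := by
  have h := congrArg Matrix.det hU
  rw [Matrix.det_mul, Matrix.det_one, Matrix.star_eq_conjTranspose, Matrix.det_conjTranspose] at h
  have h2 := congrArg norm h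
  rw [norm_mul, norm_star, norm_one] at h2
  nlinarith [norm_nonneg U.det]

/-- The Gaussian density depends only on the Euclidean norm, and a unitary map has Jacobian `1`. -/
theorem measurePreserving_mulVec {n : Type*} [Fintype n] [DecidableEq n]
    {U : Matrix n n ℂ} (hU : star U * U = 1) :
    MeasurePreserving (fun y : n → ℂ => U *ᵥ y) (complexGaussian n) (complexGaussian n) := by
  have hmeas : Measurable fun y : n → ℂ => U *ᵥ y := by fun_prop
  refine ⟨hmeas, Measure.ext_of_lintegral _ fun f hf => ?_⟩
  have hdet : U.det ≠ 0 := by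
    intro h; have := norm_det_of_unitary hU; simp [h] at this
  rw [lintegral_map hf hmeas, lintegral_complexGaussian hf,
    lintegral_complexGaussian (f := fun y => f (U *ᵥ y)) (by fun_prop),
    lintegral_comp_mulVec U hdet (f := fun y => ENNReal.ofReal
      ((Real.pi⁻¹) ^ Fintype.card n * Real.exp (-∑ i, ‖y i‖ ^ 2)) * f y) (by fun_prop),
    norm_det_of_unitary hU]
  simp [sum_norm_sq_mulVec_of_unitary hU]

theorem measurePreserving_vecMul {n : Type*} [Fintype n] [DecidableEq n]
    {U : Matrix n n ℂ} (hU : U * star U = 1) :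
    MeasurePreserving (fun y : n → ℂ => y ᵥ* U) (complexGaussian n) (complexGaussian n) := by
  have h : star Uᵀ * Uᵀ = 1 := by
    have := congrArg Matrix.transpose hU
    rw [Matrix.transpose_mul, Matrix.transpose_one] at this
    exact this
  simpa [Matrix.mulVec_transpose] using measurePreserving_mulVec h

theorem measurePreserving_transpose (n : ℕ) :
    MeasurePreserving (fun (G : Fin n → Fin n → ℂ) i j => G j i) (ginibreLaw n) (ginibreLaw n) := by
  have hc : MeasurePreserving (MeasurableEquiv.curry (Fin n) (Fin n) ℂ)
      (Measure.pi fun _ => stdComplexNormal) (ginibreLaw n) := by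
    refine ⟨MeasurableEquiv.measurable _, ?_⟩
    have := Measure.infinitePi_map_curry (fun (_ : Fin n) (_ : Fin n) => stdComplexNormal)
    simp only [Measure.infinitePi_eq_pi] at this
    exact this
  have hs := measurePreserving_piCongrLeft (fun _ : Fin n × Fin n => stdComplexNormal)
    (Equiv.prodComm (Fin n) (Fin n))
  convert (hc.comp hs).comp hc.symm using 1
  ext G i j
  have := MeasurableEquiv.piCongrLeft_apply_apply (β := fun _ : Fin n × Fin n => ℂ)
    (Equiv.prodComm (Fin n) (Fin n)) ((MeasurableEquiv.curry (Fin n) (Fin n) ℂ).symm G) (j, i)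
  exact this.symm

/-- Right multiplication acts on each row separately, and the rows are independent Gaussian vectors.
Left multiplication is right multiplication conjugated by transposition. -/
theorem measurePreserving_conj {n : ℕ} {U : Matrix (Fin n) (Fin n) ℂ} (hU : star U * U = 1) :
    MeasurePreserving (fun (G : Fin n → Fin n → ℂ) i j => (U * Matrix.of G * star U) i j)
      (ginibreLaw n) (ginibreLaw n) := by
  have hrow : ∀ V : Matrix (Fin n) (Fin n) ℂ, V * star V = 1 →
      MeasurePreserving (fun (G : Fin n → Fin n → ℂ) i => G i ᵥ* V)
        (ginibreLaw n) (ginibreLaw n) := fun V hV =>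
    measurePreserving_pi _ _ fun _ => measurePreserving_vecMul hV
  have hV : Uᵀ * star Uᵀ = 1 := by
    have := congrArg Matrix.transpose hU
    rw [Matrix.transpose_mul, Matrix.transpose_one] at this
    exact this
  have h1 := hrow (star U) (by rw [star_star]; exact hU)
  have h2 := (measurePreserving_transpose n).comp
    ((hrow Uᵀ hV).comp (measurePreserving_transpose n))
  convert h1.comp h2 using 1
  ext G i j
  simp only [Matrix.mul_apply, Matrix.vecMul, dotProduct, Function.comp_apply, Matrix.of_apply,
    Matrix.transpose_apply]
  refine Finset.sum_congr rfl fun k _ => ?_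
  congr 1
  exact Finset.sum_congr rfl fun l _ => mul_comm _ _

/-! ### Continuity of linear statistics of the roots -/

theorem Polynomial.exists_prod_X_sub_C_eq {N : ℕ} {p : Polynomial ℂ} (hp : p.Monic)
    (hd : p.natDegree = N) : ∃ z : Fin N → ℂ, p = ∏ i, (Polynomial.X - Polynomial.C (z i)) := by
  have hs : p.Splits := IsAlgClosed.splits p
  have hc : p.roots.card = N := by rw [← hd, hs.natDegree_eq_card_roots]
  obtain ⟨l, hl⟩ : ∃ l : List ℂ, (l : Multiset ℂ) = p.roots := Quotient.exists_rep _
  have hlen : l.length = N := by rw [← hc, ← hl, Multiset.coe_card]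
  subst hlen
  refine ⟨l.get, ?_⟩
  conv_lhs => rw [hs.eq_prod_roots_of_monic hp, ← hl]
  rw [Multiset.map_coe, Multiset.prod_coe]
  have := List.prod_ofFn (f := fun i => Polynomial.X - Polynomial.C (l.get i))
  rw [← this]
  congr 1
  conv_lhs => rw [← List.ofFn_get l]
  rw [List.map_ofFn]
  rfl

theorem Polynomial.sum_map_roots_prod_X_sub_C {N : ℕ} (z : Fin N → ℂ) {M : Type*}
    [AddCommMonoid M] (f : ℂ → M) :
    ((∏ i, (Polynomial.X - Polynomial.C (z i))).roots.map f).sum = ∑ i, f (z i) := by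
  have : (∏ i, (Polynomial.X - Polynomial.C (z i)))
      = ((Finset.univ.val.map z).map fun a => Polynomial.X - Polynomial.C a).prod := by
    rw [Multiset.map_map]; rfl
  rw [this, Polynomial.roots_multiset_prod_X_sub_C, Multiset.map_map]
  rfl

/-- Compare both sides of the eigenvector equation at a coordinate of maximal modulus. The bound
confines eigenvalues to a compact set when the matrix varies in a bounded one. -/
theorem Matrix.norm_le_of_mem_roots_charpoly {N : ℕ} (X : Matrix (Fin N) (Fin N) ℂ) {z : ℂ}
    (hz : X.charpoly.IsRoot z) : ‖z‖ ≤ ∑ i, ∑ j, ‖X i j‖ := by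
  have hdet : (Matrix.scalar (Fin N) z - X).det = 0 := by
    rw [← Matrix.eval_charpoly]; exact hz
  obtain ⟨v, hv0, hv⟩ := Matrix.exists_mulVec_eq_zero_iff.2 hdet
  have hXv : X *ᵥ v = z • v := by
    rw [Matrix.sub_mulVec, sub_eq_zero] at hv
    rw [← hv]; ext i; simp [Matrix.scalar_apply, Matrix.mulVec_diagonal]
  have hN : Nonempty (Fin N) := by
    by_contra h
    rw [not_nonempty_iff] at h
    exact hv0 (Subsingleton.elim _ _)
  obtain ⟨i, -, hi⟩ := Finset.exists_max_image Finset.univ (fun i => ‖v i‖) Finset.univ_nonempty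
  have hpos : 0 < ‖v i‖ := by
    rw [norm_pos_iff]
    intro h
    apply hv0
    ext j
    have := hi j (Finset.mem_univ _)
    rw [h, norm_zero] at this
    simpa using this
  have h1 : ‖z‖ * ‖v i‖ ≤ (∑ j, ‖X i j‖) * ‖v i‖ := by
    rw [← norm_mul, show z * v i = ∑ j, X i j * v j from (congrFun hXv i).symm, Finset.sum_mul]
    refine (norm_sum_le _ _).trans (Finset.sum_le_sum fun j _ => ?_)
    rw [norm_mul]
    exact mul_le_mul_of_nonneg_left (hi j (Finset.mem_univ _)) (norm_nonneg _)
  refine (le_of_mul_le_mul_right h1 hpos).trans ?_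
  exact Finset.single_le_sum (f := fun i => ∑ j, ‖X i j‖)
    (fun i _ => Finset.sum_nonneg fun j _ => norm_nonneg _) (Finset.mem_univ i)

theorem Matrix.continuous_eval_charpoly {N : ℕ} (w : ℂ) :
    Continuous fun X : Matrix (Fin N) (Fin N) ℂ => X.charpoly.eval w := by
  simp_rw [Matrix.eval_charpoly]
  fun_prop

/-- An arbitrary, possibly discontinuous, enumeration of the eigenvalues suffices. Along a
convergent sequence of matrices the enumerations are bounded; a subsequential limit factors the
limiting characteristic polynomial, and the sum is symmetric. Continuity supplies the measurability
of linear statistics. -/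
theorem continuous_eigenvalueSum {N : ℕ} {f : ℂ → ℝ} (hf : Continuous f) :
    Continuous fun X : Matrix (Fin N) (Fin N) ℂ => eigenvalueSum X f := by
  have hex : ∀ X : Matrix (Fin N) (Fin N) ℂ, ∃ z : Fin N → ℂ,
      X.charpoly = ∏ i, (Polynomial.X - Polynomial.C (z i)) := fun X =>
    Polynomial.exists_prod_X_sub_C_eq X.charpoly_monic (by simp [Matrix.charpoly_natDegree_eq_dim])
  choose z hz using hex
  have hsum : ∀ X : Matrix (Fin N) (Fin N) ℂ, eigenvalueSum X f = ∑ i, f (z X i) := fun X => by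
    rw [eigenvalueSum, hz, Polynomial.sum_map_roots_prod_X_sub_C]
  have hbound : ∀ X i, ‖z X i‖ ≤ ∑ i, ∑ j, ‖X i j‖ := fun X i => by
    apply Matrix.norm_le_of_mem_roots_charpoly
    rw [hz, Polynomial.IsRoot, Polynomial.eval_prod]
    exact Finset.prod_eq_zero (Finset.mem_univ i) (by simp)
  refine continuous_iff_continuousAt.2 fun X => ?_
  have : FirstCountableTopology (Matrix (Fin N) (Fin N) ℂ) :=
    inferInstanceAs (FirstCountableTopology (Fin N → Fin N → ℂ))
  refine tendsto_of_seq_tendsto fun u hu => ?_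
  refine tendsto_of_subseq_tendsto fun ns hns => ?_
  have hu' := hu.comp hns
  have hc : Continuous fun Y : Matrix (Fin N) (Fin N) ℂ => ∑ i, ∑ j, ‖Y i j‖ := by fun_prop
  obtain ⟨B, hB⟩ := ((hc.tendsto X).comp hu').bddAbove_range
  have hmem : ∀ n, z (u (ns n)) ∈ Metric.closedBall (0 : Fin N → ℂ) (max B 0) := fun n => by
    rw [mem_closedBall_zero_iff, pi_norm_le_iff_of_nonneg (le_max_right _ _)]
    exact fun i => (hbound _ i).trans ((hB ⟨n, rfl⟩).trans (le_max_left _ _))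
  obtain ⟨y, -, φ, hφ, hy⟩ := (isCompact_closedBall _ _).tendsto_subseq hmem
  refine ⟨φ, ?_⟩
  -- The subsequential limit `y` enumerates the roots of the limit polynomial, since both products
  -- converge at every point `w`.
  have hpoly : X.charpoly = ∏ i, (Polynomial.X - Polynomial.C (y i)) := by
    refine Polynomial.funext fun w => ?_
    have h1 := ((Matrix.continuous_eval_charpoly w).tendsto X).comp (hu'.comp hφ.tendsto_atTop)
    refine tendsto_nhds_unique h1 ?_
    have h2 : Continuous fun y : Fin N → ℂ => ∏ i, (w - y i) := by fun_prop
    have h3 := (h2.tendsto y).comp hy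
    simp only [Polynomial.eval_prod, Polynomial.eval_sub, Polynomial.eval_X, Polynomial.eval_C]
    refine h3.congr fun n => ?_
    simp only [Function.comp_apply, hz, Polynomial.eval_prod, Polynomial.eval_sub,
      Polynomial.eval_X, Polynomial.eval_C]
  have hX : eigenvalueSum X f = ∑ i, f (y i) := by
    rw [eigenvalueSum, hpoly, Polynomial.sum_map_roots_prod_X_sub_C]
  have h4 : Continuous fun y : Fin N → ℂ => ∑ i, f (y i) := by fun_prop
  change Tendsto _ _ (𝓝 (eigenvalueSum X f))
  rw [hX]
  refine ((h4.tendsto y).comp hy).congr fun n => ?_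
  simp only [Function.comp_apply, hsum]

/-! ### The area formula for holomorphic functions -/

theorem abs_det_smulRight_one (c : ℂ) :
    |((ContinuousLinearMap.toSpanSingleton ℂ c).restrictScalars ℝ).det| = ‖c‖ ^ 2 := by
  have : (((ContinuousLinearMap.toSpanSingleton ℂ c).restrictScalars ℝ : ℂ →L[ℝ] ℂ) : ℂ →ₗ[ℝ] ℂ)
      = LinearMap.mulLeft ℝ c := by
    (ext; simp [mul_comm])
  rw [ContinuousLinearMap.det, this]
  have h2 : LinearMap.det (LinearMap.mulLeft ℝ c) = Algebra.norm ℝ c := rfl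
  rw [h2, Algebra.norm_complex_apply, Complex.normSq_eq_norm_sq, abs_of_nonneg (by positivity)]

/-- The function `g` is `h ∘ R⁻¹` on the image, extended by zero. It is measurable because an
injective differentiable map is a measurable embedding on a measurable set. -/
theorem lintegral_image_of_injOn {R R' : ℂ → ℂ} {s : Set ℂ} (hs : MeasurableSet s)
    (hR : ∀ z ∈ s, HasDerivAt R (R' z) z) (hinj : Set.InjOn R s) {h : ℂ → ℝ≥0∞}
    (hh : Measurable h) :
    ∃ g : ℂ → ℝ≥0∞, Measurable g ∧ (∀ z ∈ s, g (R z) = h z) ∧ (∀ x ∉ R '' s, g x = 0) ∧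
      ∫⁻ x, g x = ∫⁻ z in s, ENNReal.ofReal (‖R' z‖ ^ 2) * h z := by
  have hf' : ∀ z ∈ s, HasFDerivWithinAt R
      ((ContinuousLinearMap.toSpanSingleton ℂ (R' z)).restrictScalars ℝ) s z := fun z hz =>
    ((hR z hz).hasFDerivAt.restrictScalars ℝ).hasFDerivWithinAt
  have hemb := measurableEmbedding_of_fderivWithin hs hf' hinj
  have himg := measurable_image_of_fderivWithin hs hf' hinj
  obtain ⟨g₀, hg₀, hgR⟩ := hemb.exists_measurable_extend (hh.comp measurable_subtype_coe)
    (fun _ => ⟨0⟩)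
  have hval : ∀ z ∈ s, g₀ (R z) = h z := fun z hz => congrFun hgR ⟨z, hz⟩
  refine ⟨(R '' s).indicator g₀, hg₀.indicator himg, fun z hz => ?_, fun x hx => ?_, ?_⟩
  · rw [Set.indicator_of_mem (Set.mem_image_of_mem _ hz), hval z hz]
  · rw [Set.indicator_of_notMem hx]
  · rw [lintegral_indicator himg, lintegral_image_eq_lintegral_abs_det_fderiv_mul _ hs hf' hinj]
    refine setLIntegral_congr_fun hs fun z hz => ?_
    simp only [abs_det_smulRight_one, hval z hz]

/-- The inverse function theorem gives local injectivity, and the Lindelöf property makes the cover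
countable. -/
theorem exists_countable_injOn_cover {R R' : ℂ → ℂ} {V : Set ℂ}
    (hR : ∀ z ∈ V, HasStrictDerivAt R (R' z) z) (hne : ∀ z ∈ V, R' z ≠ 0) :
    ∃ t : ℕ → Set ℂ, (∀ n, IsOpen (t n)) ∧ (∀ n, Set.InjOn R (t n)) ∧ V ⊆ ⋃ n, t n := by
  have hloc : ∀ z ∈ V, ∃ s : Set ℂ, z ∈ s ∧ IsOpen s ∧ Set.InjOn R s := fun z hz => by
    have hstrict := (hR z hz).hasStrictFDerivAt_equiv (hne z hz)
    exact ⟨(hstrict.toOpenPartialHomeomorph R).source, hstrict.mem_toOpenPartialHomeomorph_source,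
      (hstrict.toOpenPartialHomeomorph R).open_source,
      (hstrict.toOpenPartialHomeomorph R).injOn⟩
  choose! s hzs hso hsi using hloc
  obtain ⟨T, hTV, hTc, hcov⟩ := TopologicalSpace.countable_cover_nhdsWithin
    (fun z hz => mem_nhdsWithin_of_mem_nhds ((hso z hz).mem_nhds (hzs z hz)))
  rcases T.eq_empty_or_nonempty with rfl | hne'
  · refine ⟨fun _ => ∅, fun _ => isOpen_empty, fun _ => by simp, ?_⟩
    simpa using hcov
  · obtain ⟨e, rfl⟩ := hTc.exists_eq_range hne'
    refine ⟨fun n => s (e n), fun n => hso _ (hTV ⟨n, rfl⟩), fun n => hsi _ (hTV ⟨n, rfl⟩), ?_⟩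
    simpa using hcov

/-- The area formula with multiplicities for a holomorphic function. -/
theorem lintegral_tsum_fiber_eq {R R' : ℂ → ℂ} {U : Set ℂ} (hU : IsOpen U)
    (hR : ∀ z ∈ U, HasDerivAt R (R' z) z) (hR' : ContinuousOn R' U) {h : ℂ → ℝ≥0∞}
    (hh : Measurable h) :
    ∫⁻ x, ∑' z : {z // z ∈ U ∧ R' z ≠ 0 ∧ R z = x}, h z
      = ∫⁻ z in U, ENNReal.ofReal (‖R' z‖ ^ 2) * h z := by
  set V : Set ℂ := {z | z ∈ U ∧ R' z ≠ 0} with hV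
  have hVo : IsOpen V := hR'.isOpen_inter_preimage hU isOpen_compl_singleton
  -- Holomorphy upgrades the derivative to a strict one, as the inverse function theorem requires.
  have hstrict : ∀ z ∈ V, HasStrictDerivAt R (R' z) z := fun z hz => by
    have hd : DifferentiableOn ℂ R U := fun w hw => (hR w hw).differentiableAt.differentiableWithinAt
    have := (hd.analyticAt (hU.mem_nhds hz.1)).hasStrictDerivAt
    rwa [(hR z hz.1).deriv] at this
  obtain ⟨t, hto, hti, htV⟩ := exists_countable_injOn_cover hstrict fun z hz => hz.2
  -- Disjoint pieces on which `R` is injective: each fibre meets a piece in at most one point, so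
  -- the fibre sum is a sum over pieces.
  set d : ℕ → Set ℂ := fun n => disjointed t n ∩ V with hd
  have hdm : ∀ n, MeasurableSet (d n) := fun n =>
    (MeasurableSet.disjointed (fun n => (hto n).measurableSet) n).inter hVo.measurableSet
  have hdisj : Pairwise (Function.onFun Disjoint d) := fun i j hij =>
    (disjoint_disjointed t hij).mono Set.inter_subset_left Set.inter_subset_left
  have hdU : (⋃ n, d n) = V := by
    rw [hd, ← Set.iUnion_inter, iUnion_disjointed, Set.inter_eq_right]
    exact htV
  have hdV : ∀ n, d n ⊆ V := fun n => Set.inter_subset_right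
  have hdinj : ∀ n, Set.InjOn R (d n) := fun n =>
    (hti n).mono (Set.inter_subset_left.trans (disjointed_subset t n))
  have hg := fun n => lintegral_image_of_injOn (hdm n) (fun z hz => hR z (hdV n hz).1)
    (hdinj n) hh
  choose g hgm hgR hg0 hgi using hg
  have hfib : ∀ x, ∑' z : {z // z ∈ U ∧ R' z ≠ 0 ∧ R z = x}, h z = ∑' n, g n x := fun x => by
    have hset : {z | z ∈ U ∧ R' z ≠ 0 ∧ R z = x} = ⋃ n, (d n ∩ R ⁻¹' {x}) := by
      rw [← Set.iUnion_inter, hdU]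
      ext z; simp only [hV, Set.mem_ofPred_eq, Set.mem_inter_iff, Set.mem_preimage, Set.mem_singleton_iff, and_assoc]
    have hset' : (∑' z : {z // z ∈ U ∧ R' z ≠ 0 ∧ R z = x}, h z)
        = ∑' z : (⋃ n, (d n ∩ R ⁻¹' {x}) : Set ℂ), h z := by
      rw [← hset]; rfl
    rw [hset', ENNReal.tsum_biUnion]
    · refine tsum_congr fun n => ?_
      by_cases hx : x ∈ R '' d n
      · obtain ⟨z, hz, rfl⟩ := hx
        have : d n ∩ R ⁻¹' {R z} = {z} := by
          ext w
          constructor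
          · rintro ⟨hw, hwz⟩; exact hdinj n hw hz hwz
          · rintro rfl; exact ⟨hz, rfl⟩
        rw [this, tsum_singleton, hgR n z hz]
      · have : d n ∩ R ⁻¹' {x} = ∅ := by
          ext w
          simp only [Set.mem_inter_iff, Set.mem_preimage, Set.mem_singleton_iff,
            Set.mem_empty_iff_false, iff_false, not_and]
          exact fun hw hwx => hx ⟨w, hw, hwx⟩
        rw [this, hg0 n x hx]
        simp
    · exact fun i _ j _ hij => (hdisj hij).mono Set.inter_subset_left Set.inter_subset_left
  simp_rw [hfib]
  rw [lintegral_tsum fun n => (hgm n).aemeasurable]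
  simp_rw [hgi]
  rw [← lintegral_iUnion hdm hdisj, hdU, ← lintegral_indicator hVo.measurableSet,
    ← lintegral_indicator hU.measurableSet]
  -- Critical points, absent from the fibre sums, carry weight `‖R' z‖ ^ 2 = 0` on the right.
  refine lintegral_congr fun z => ?_
  by_cases hz : z ∈ U
  · by_cases hz' : R' z = 0
    · rw [Set.indicator_of_notMem (fun h => h.2 hz'), Set.indicator_of_mem hz, hz']
      simp
    · rw [Set.indicator_of_mem hz, Set.indicator_of_mem (show z ∈ V from ⟨hz, hz'⟩)]
  · rw [Set.indicator_of_notMem hz, Set.indicator_of_notMem (fun h => hz h.1)]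

/-- Sard's theorem: the set of critical values is null. -/
theorem ae_forall_fiber_deriv_ne_zero {R R' : ℂ → ℂ} {U : Set ℂ}
    (hR : ∀ z ∈ U, HasDerivAt R (R' z) z) : ∀ᵐ x : ℂ, ∀ z ∈ U, R z = x → R' z ≠ 0 := by
  have h0 : volume (R '' {z | z ∈ U ∧ R' z = 0}) = 0 := by
    refine addHaar_image_eq_zero_of_det_fderivWithin_eq_zero volume (f' := fun z =>
      (ContinuousLinearMap.toSpanSingleton ℂ (R' z)).restrictScalars ℝ)
      (fun z hz => ((hR z hz.1).hasFDerivAt.restrictScalars ℝ).hasFDerivWithinAt) fun z hz => ?_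
    have := abs_det_smulRight_one (R' z)
    rw [hz.2] at this ⊢
    simpa using this
  filter_upwards [compl_mem_ae_iff.2 h0] with x hx z hz hzx h
  exact hx ⟨z, ⟨hz, h⟩, hzx⟩

/-! ### Bordered matrices -/

/-- The matrix with corner `x`, first row `b`, first column `v` and remaining block `C`. -/
def borderedMatrix {n : ℕ} (x : ℂ) (b v : Fin n → ℂ) (C : Matrix (Fin n) (Fin n) ℂ) :
    Matrix (Fin (n + 1)) (Fin (n + 1)) ℂ :=
  Matrix.of (Fin.cons (Fin.cons x b) fun i => Fin.cons (v i) (C i))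

section borderedMatrix

variable {n : ℕ} (x : ℂ) (b v : Fin n → ℂ) (C : Matrix (Fin n) (Fin n) ℂ)

@[simp] theorem borderedMatrix_zero_zero : borderedMatrix x b v C 0 0 = x := rfl
@[simp] theorem borderedMatrix_zero_succ (j : Fin n) : borderedMatrix x b v C 0 j.succ = b j := rfl
@[simp] theorem borderedMatrix_succ_zero (i : Fin n) : borderedMatrix x b v C i.succ 0 = v i := rfl
@[simp] theorem borderedMatrix_succ_succ (i j : Fin n) :
    borderedMatrix x b v C i.succ j.succ = C i j := rfl

@[simp] theorem submatrix_borderedMatrix :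
    (borderedMatrix x b v C).submatrix Fin.succ Fin.succ = C := rfl

theorem det_borderedMatrix_zero_left : (borderedMatrix x b 0 C).det = x * C.det := by
  rw [Matrix.det_succ_column_zero, Fin.sum_univ_succ]
  simp [Fin.succAbove_zero]

theorem det_borderedMatrix_zero_right : (borderedMatrix x 0 v C).det = x * C.det := by
  rw [Matrix.det_succ_row_zero, Fin.sum_univ_succ]
  simp [Fin.succAbove_zero]

/-- Schur complement, read off from a block triangular factorization. -/
theorem det_borderedMatrix_of_det_ne_zero (M : Matrix (Fin n) (Fin n) ℂ) (hM : M.det ≠ 0) :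
    (borderedMatrix x b v M).det = M.det * (x - b ⬝ᵥ (M⁻¹ *ᵥ v)) := by
  have hu : IsUnit M.det := isUnit_iff_ne_zero.2 hM
  have h : borderedMatrix x b v M = borderedMatrix 1 (b ᵥ* M⁻¹) 0 (1 : Matrix (Fin n) (Fin n) ℂ)
      * borderedMatrix (x - b ⬝ᵥ (M⁻¹ *ᵥ v)) 0 v M := by
    ext i j
    rw [Matrix.mul_apply, Fin.sum_univ_succ]
    refine Fin.cases ?_ (fun i => ?_) i <;> refine Fin.cases ?_ (fun j => ?_) j
    · have : ∑ k, (b ᵥ* M⁻¹) k * v k = b ⬝ᵥ (M⁻¹ *ᵥ v) := by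
        rw [Matrix.dotProduct_mulVec]; rfl
      simp [this]
    · have : ∑ k, (b ᵥ* M⁻¹) k * M k j = b j := by
        change ((b ᵥ* M⁻¹) ᵥ* M) j = b j
        rw [Matrix.vecMul_vecMul, Matrix.nonsing_inv_mul _ hu, Matrix.vecMul_one]
      simp [this]
    · simp [Matrix.one_apply]
    · simp [Matrix.one_apply]
  rw [h, Matrix.det_mul, det_borderedMatrix_zero_left, det_borderedMatrix_zero_right]
  rw [Matrix.det_one]
  ring

theorem continuous_borderedMatrix :
    Continuous fun q : ℂ × (Fin n → ℂ) × (Fin n → ℂ) × Matrix (Fin n) (Fin n) ℂ =>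
      borderedMatrix q.1 q.2.1 q.2.2.1 q.2.2.2 := by
  refine continuous_matrix fun i j => ?_
  refine Fin.cases ?_ (fun i => ?_) i <;> refine Fin.cases ?_ (fun j => ?_) j <;>
    simp only [borderedMatrix_zero_zero, borderedMatrix_zero_succ, borderedMatrix_succ_zero,
      borderedMatrix_succ_succ] <;> fun_prop

/-- Both sides are continuous in `M`, and `M + ε` is invertible for all small `ε ≠ 0`, so the Schur
complement formula passes to the limit. Singular `M` matter here, because the formula is applied at
eigenvalues of the block. -/
theorem det_borderedMatrix (M : Matrix (Fin n) (Fin n) ℂ) :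
    (borderedMatrix x b v M).det = x * M.det - b ⬝ᵥ (M.adjugate *ᵥ v) := by
  have hev : ∀ᶠ ε in 𝓝[≠] (0 : ℂ), (Matrix.scalar (Fin n) ε - (-M)).det ≠ 0 := by
    have hfin : ((-M).charpoly.roots.toFinset : Set ℂ).Finite := Finset.finite_toSet _
    have h1 : ∀ᶠ ε in 𝓝[≠] (0 : ℂ), ε ∉ ((-M).charpoly.roots.toFinset : Set ℂ) := by
      have := hfin.isClosed.isOpen_compl
      have hf2 : (((-M).charpoly.roots.toFinset : Set ℂ) \ {0}).Finite := hfin.sdiff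
      have h3 := hf2.isClosed.isOpen_compl.mem_nhds (show (0 : ℂ) ∈ _ by simp)
      filter_upwards [nhdsWithin_le_nhds h3, self_mem_nhdsWithin] with ε h4 h5 h6
      exact h4 ⟨h6, h5⟩
    filter_upwards [h1] with ε h h0
    apply h
    simp only [Finset.mem_coe, Multiset.mem_toFinset]
    rw [Polynomial.mem_roots (-M).charpoly_monic.ne_zero, Polynomial.IsRoot, Matrix.eval_charpoly]
    exact h0
  have hcM : Continuous fun ε : ℂ => Matrix.scalar (Fin n) ε - (-M) := by
    refine Continuous.sub ?_ continuous_const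
    exact continuous_matrix fun i j => by
      simp only [Matrix.scalar_apply, Matrix.diagonal_apply]
      split_ifs <;> fun_prop
  have hc1 : Continuous fun ε : ℂ => (borderedMatrix x b v (Matrix.scalar (Fin n) ε - (-M))).det :=
    (continuous_borderedMatrix.comp (continuous_const.prodMk (continuous_const.prodMk
      (continuous_const.prodMk hcM)))).matrix_det
  have hc2 : Continuous fun ε : ℂ => x * (Matrix.scalar (Fin n) ε - (-M)).det
      - b ⬝ᵥ ((Matrix.scalar (Fin n) ε - (-M)).adjugate *ᵥ v) :=
    (continuous_const.mul hcM.matrix_det).sub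
      (continuous_const.dotProduct (hcM.matrix_adjugate.matrix_mulVec continuous_const))
  have h0 : Matrix.scalar (Fin n) (0 : ℂ) - (-M) = M := by simp
  have h1 := (hc1.tendsto 0).mono_left (nhdsWithin_le_nhds (s := {0}ᶜ))
  have h2 := (hc2.tendsto 0).mono_left (nhdsWithin_le_nhds (s := {0}ᶜ))
  rw [h0] at h1 h2
  refine tendsto_nhds_unique h1 (h2.congr' ?_)
  filter_upwards [hev] with ε hε
  rw [det_borderedMatrix_of_det_ne_zero _ _ _ _ hε, Matrix.inv_def, Matrix.smul_mulVec,
    dotProduct_smul, Ring.inverse_eq_inv', smul_eq_mul, mul_sub, mul_inv_cancel_left₀ hε]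
  ring

theorem scalar_sub_borderedMatrix (z : ℂ) :
    Matrix.scalar (Fin (n + 1)) z - borderedMatrix x b v C
      = borderedMatrix (z - x) (-b) (-v) (Matrix.scalar (Fin n) z - C) := by
  ext i j
  rw [Matrix.sub_apply]
  refine Fin.cases ?_ (fun i => ?_) i <;> refine Fin.cases ?_ (fun j => ?_) j
  · simp
  · simp [Matrix.scalar_apply, (Fin.succ_ne_zero _).symm]
  · simp [Matrix.scalar_apply]
  · simp [Matrix.scalar_apply, Matrix.diagonal_apply]

theorem eval_charpoly_borderedMatrix (z : ℂ) :
    (borderedMatrix x b v C).charpoly.eval z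
      = (z - x) * (Matrix.scalar (Fin n) z - C).det
        - b ⬝ᵥ ((Matrix.scalar (Fin n) z - C).adjugate *ᵥ v) := by
  rw [Matrix.eval_charpoly, scalar_sub_borderedMatrix, det_borderedMatrix]
  simp [Matrix.mulVec_neg]

theorem adjugate_scalar_sub_borderedMatrix (z : ℂ) :
    (Matrix.scalar (Fin (n + 1)) z - borderedMatrix x b v C).adjugate 0 0
      = (Matrix.scalar (Fin n) z - C).det := by
  rw [scalar_sub_borderedMatrix, Matrix.adjugate_fin_succ_eq_det_submatrix]
  simp [Fin.succAbove_zero]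

end borderedMatrix

/-- Splitting a Ginibre matrix into corner, first row, first column and remaining block. -/
theorem lintegral_ginibreLaw_succ {n : ℕ} {F : Matrix (Fin (n + 1)) (Fin (n + 1)) ℂ → ℝ≥0∞}
    (hF : Measurable fun G : Fin (n + 1) → Fin (n + 1) → ℂ => F (Matrix.of G)) :
    ∫⁻ G, F (Matrix.of G) ∂ginibreLaw (n + 1) = ∫⁻ C, ∫⁻ v, ∫⁻ b, ∫⁻ x, F (borderedMatrix x b v (Matrix.of C))
      ∂stdComplexNormal ∂complexGaussian (Fin n) ∂complexGaussian (Fin n) ∂ginibreLaw n := by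
  have hrow : MeasurePreserving (MeasurableEquiv.piFinSuccAbove (fun _ : Fin (n + 1) => ℂ) 0)
      (complexGaussian (Fin (n + 1))) (stdComplexNormal.prod (complexGaussian (Fin n))) :=
    measurePreserving_piFinSuccAbove (fun _ => stdComplexNormal) 0
  have h1 : MeasurePreserving
      (MeasurableEquiv.piFinSuccAbove (fun _ : Fin (n + 1) => Fin (n + 1) → ℂ) 0)
      (ginibreLaw (n + 1)) ((complexGaussian (Fin (n + 1))).prod
        (Measure.pi fun _ : Fin n => complexGaussian (Fin (n + 1)))) :=
    measurePreserving_piFinSuccAbove (fun _ => complexGaussian (Fin (n + 1))) 0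
  have h2 : MeasurePreserving (fun (M : Fin n → Fin (n + 1) → ℂ) i =>
      MeasurableEquiv.piFinSuccAbove (fun _ : Fin (n + 1) => ℂ) 0 (M i))
      (Measure.pi fun _ : Fin n => complexGaussian (Fin (n + 1)))
      (Measure.pi fun _ : Fin n => stdComplexNormal.prod (complexGaussian (Fin n))) :=
    measurePreserving_pi _ _ fun _ => hrow
  have h3 := measurePreserving_arrowProdEquivProdArrow ℂ (Fin n → ℂ) (Fin n)
    (fun _ => stdComplexNormal) (fun _ => complexGaussian (Fin n))
  have h4 := (hrow.prod (h3.comp h2)).comp h1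
  have hB : Measurable fun q : (ℂ × (Fin n → ℂ)) × ((Fin n → ℂ) × (Fin n → Fin n → ℂ)) =>
      F (borderedMatrix q.1.1 q.1.2 q.2.1 (Matrix.of q.2.2)) := by
    refine hF.comp (f := fun (q : (ℂ × (Fin n → ℂ)) × ((Fin n → ℂ) × (Fin n → Fin n → ℂ))) i j =>
      borderedMatrix q.1.1 q.1.2 q.2.1 (Matrix.of q.2.2) i j) (Continuous.measurable ?_)
    refine continuous_pi fun i => continuous_pi fun j => ?_
    exact (continuous_borderedMatrix.comp (by fun_prop : Continuous
      fun q : (ℂ × (Fin n → ℂ)) × ((Fin n → ℂ) × (Fin n → Fin n → ℂ)) =>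
        (q.1.1, q.1.2, q.2.1, (Matrix.of q.2.2 : Matrix _ _ ℂ)))).matrix_elem i j
  have h5 := h4.lintegral_comp hB
  have h6 : ∀ G : Fin (n + 1) → Fin (n + 1) → ℂ, Matrix.of G = borderedMatrix (G 0 0) (fun j => G 0 j.succ)
      (fun i => G i.succ 0) (Matrix.of fun i j => G i.succ j.succ) := fun G => by
    ext i j
    refine Fin.cases ?_ (fun i => ?_) i <;> refine Fin.cases ?_ (fun j => ?_) j <;> rfl
  have h7 : ∫⁻ G, F (Matrix.of G) ∂ginibreLaw (n + 1) = ∫⁻ q, F (borderedMatrix q.1.1 q.1.2 q.2.1 (Matrix.of q.2.2))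
      ∂((stdComplexNormal.prod (complexGaussian (Fin n))).prod
        ((complexGaussian (Fin n)).prod (ginibreLaw n))) := by
    refine Eq.trans (lintegral_congr fun G => ?_) h5
    conv_lhs => rw [h6 G]
    rfl
  rw [h7, lintegral_prod_symm' _ hB, lintegral_prod_symm' _ hB.lintegral_prod_left']
  refine lintegral_congr fun C => lintegral_congr fun v => ?_
  exact lintegral_prod_symm' _ (hB.comp (by fun_prop :
    Measurable fun p : ℂ × (Fin n → ℂ) => (p, (v, C))))

/-! ### Genericity -/

theorem continuous_scalar_sub {n : ℕ} {T : Type*} [TopologicalSpace T] {z : T → ℂ}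
    {C : T → Matrix (Fin n) (Fin n) ℂ} (hz : Continuous z) (hC : Continuous C) :
    Continuous fun t => Matrix.scalar (Fin n) (z t) - C t := by
  refine Continuous.sub (continuous_matrix fun i j => ?_) hC
  simp only [Matrix.scalar_apply, Matrix.diagonal_apply]
  split_ifs <;> fun_prop

theorem finite_setOf_det_scalar_sub_eq_zero {n : ℕ} (C : Matrix (Fin n) (Fin n) ℂ) :
    {z : ℂ | (Matrix.scalar (Fin n) z - C).det = 0}.Finite := by
  refine (C.charpoly.roots.toFinset.finite_toSet).subset fun z hz => ?_
  rw [Finset.mem_coe, Multiset.mem_toFinset, Polynomial.mem_roots C.charpoly_monic.ne_zero,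
    Polynomial.IsRoot, Matrix.eval_charpoly]
  exact hz

/-- A projection of a closed set need not be closed, but in a σ-compact space it is a countable
union of compact sets. -/
theorem measurableSet_derogatory (n : ℕ) : MeasurableSet {G : Fin n → Fin n → ℂ |
    ∃ z : ℂ, (Matrix.scalar (Fin n) z - Matrix.of G).det = 0 ∧
      (Matrix.scalar (Fin n) z - Matrix.of G).adjugate = 0} := by
  have hc : Continuous fun q : ℂ × (Fin n → Fin n → ℂ) =>
      Matrix.scalar (Fin n) q.1 - Matrix.of q.2 :=
    continuous_scalar_sub continuous_fst (by fun_prop)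
  have hcl : IsClosed {q : ℂ × (Fin n → Fin n → ℂ) |
      (Matrix.scalar (Fin n) q.1 - Matrix.of q.2).det = 0 ∧
        (Matrix.scalar (Fin n) q.1 - Matrix.of q.2).adjugate = 0} :=
    (isClosed_singleton.preimage hc.matrix_det).inter
      (isClosed_singleton.preimage hc.matrix_adjugate)
  obtain ⟨K, hK, hKeq⟩ := (isSigmaCompact_univ.of_isClosed_subset hcl
    (Set.subset_univ _)).image continuous_snd
  have : {G : Fin n → Fin n → ℂ | ∃ z : ℂ, (Matrix.scalar (Fin n) z - Matrix.of G).det = 0 ∧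
      (Matrix.scalar (Fin n) z - Matrix.of G).adjugate = 0} = ⋃ i, K i := by
    rw [hKeq]; ext G; simp
  rw [this]
  exact MeasurableSet.iUnion fun i => (hK i).isClosed.measurableSet

/-- The exceptional set is a proper real subspace, which does not contain `star u`; such a subspace
is Lebesgue null. -/
theorem complexGaussian_ae_dotProduct_ne_zero {n : ℕ} {u : Fin n → ℂ} (hu : u ≠ 0) :
    ∀ᵐ b ∂complexGaussian (Fin n), b ⬝ᵥ u ≠ 0 := by
  refine (complexGaussian_absolutelyContinuous (Fin n)).ae_le ?_
  let φ : (Fin n → ℂ) →ₗ[ℝ] ℂ :=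
    { toFun := fun b => b ⬝ᵥ u
      map_add' := fun b c => add_dotProduct _ _ _
      map_smul' := fun c b => smul_dotProduct _ _ _ }
  have hne : LinearMap.ker φ ≠ ⊤ := fun h => by
    have h1 : star u ∈ LinearMap.ker φ := h ▸ Submodule.mem_top
    have h2 : ((∑ i, ‖u i‖ ^ 2 : ℝ) : ℂ) = 0 := (sum_norm_sq_eq_dotProduct u).trans h1
    have h3 := (Finset.sum_eq_zero_iff_of_nonneg fun i _ => sq_nonneg ‖u i‖).1
      (Complex.ofReal_eq_zero.1 h2)
    exact hu (funext fun i => by simpa using h3 i (Finset.mem_univ i))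
  have := Measure.addHaar_submodule (volume : Measure (Fin n → ℂ)) _ hne
  filter_upwards [compl_mem_ae_iff.2 this] with b hb
  exact hb

theorem complexGaussian_ae_mulVec_ne_zero {n : ℕ} {M : Matrix (Fin n) (Fin n) ℂ} (hM : M ≠ 0) :
    ∀ᵐ v ∂complexGaussian (Fin n), M *ᵥ v ≠ 0 := by
  obtain ⟨i, hi⟩ : ∃ i, M i ≠ 0 := by
    by_contra! h
    exact hM (by ext i j; exact congrFun (h i) j)
  filter_upwards [complexGaussian_ae_dotProduct_ne_zero hi] with v hv h
  apply hv
  rw [dotProduct_comm]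
  exact congrFun h i

/-- On this event no eigenvalue of the block `C` is an eigenvalue of the bordered matrix, whatever
the corner. Only the finitely many eigenvalues of `C` have to be avoided. -/
theorem ae_forall_dotProduct_adjugate_ne_zero {n : ℕ} {C : Matrix (Fin n) (Fin n) ℂ}
    (hC : ∀ z : ℂ, (Matrix.scalar (Fin n) z - C).det = 0 →
      (Matrix.scalar (Fin n) z - C).adjugate ≠ 0) :
    ∀ᵐ v ∂complexGaussian (Fin n), ∀ᵐ b ∂complexGaussian (Fin n), ∀ z : ℂ,
      (Matrix.scalar (Fin n) z - C).det = 0 →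
        b ⬝ᵥ ((Matrix.scalar (Fin n) z - C).adjugate *ᵥ v) ≠ 0 := by
  have hcount := (finite_setOf_det_scalar_sub_eq_zero C).countable
  have h1 : ∀ᵐ v ∂complexGaussian (Fin n), ∀ z ∈ {z : ℂ | (Matrix.scalar (Fin n) z - C).det = 0},
      (Matrix.scalar (Fin n) z - C).adjugate *ᵥ v ≠ 0 :=
    (ae_ball_iff hcount).2 fun z hz => complexGaussian_ae_mulVec_ne_zero (hC z hz)
  filter_upwards [h1] with v hv
  exact (ae_ball_iff hcount).2 fun z hz => complexGaussian_ae_dotProduct_ne_zero (hv z hz)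

/-- Induction on the size by bordering. If the adjugate vanishes at an eigenvalue `z`, then so does
its corner entry, which is `det (z - C)`. The bordered determinant formula then gives `b ⬝ᵥ (adj (z
- C) *ᵥ v) = 0`, an event excluded almost surely by the induction hypothesis. -/
theorem ginibreLaw_ae_adjugate_ne_zero (n : ℕ) : ∀ᵐ G ∂ginibreLaw n, ∀ z : ℂ,
    (Matrix.scalar (Fin n) z - Matrix.of G).det = 0 →
      (Matrix.scalar (Fin n) z - Matrix.of G).adjugate ≠ 0 := by
  induction n with
  | zero => exact Eventually.of_forall fun G z h => by simp at h
  | succ n ih =>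
    set B : Set (Fin (n + 1) → Fin (n + 1) → ℂ) := {G | ∃ z : ℂ,
      (Matrix.scalar (Fin (n + 1)) z - Matrix.of G).det = 0 ∧
        (Matrix.scalar (Fin (n + 1)) z - Matrix.of G).adjugate = 0} with hB
    have hBm : MeasurableSet B := measurableSet_derogatory (n + 1)
    have h0 : ginibreLaw (n + 1) B = 0 := by
      rw [← lintegral_indicator_one hBm]
      have := lintegral_ginibreLaw_succ (n := n)
        (F := fun X => B.indicator (1 : (Fin (n + 1) → Fin (n + 1) → ℂ) → ℝ≥0∞) (Matrix.of.symm X))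
        (measurable_one.indicator hBm)
      refine this.trans ?_
      have hz : ∀ᵐ C ∂ginibreLaw n, ∀ᵐ v ∂complexGaussian (Fin n),
          ∀ᵐ b ∂complexGaussian (Fin n), ∀ x : ℂ,
            B.indicator (1 : (Fin (n + 1) → Fin (n + 1) → ℂ) → ℝ≥0∞) (Matrix.of.symm (borderedMatrix x b v (Matrix.of C))) = 0 := by
        filter_upwards [ih] with C hC
        filter_upwards [ae_forall_dotProduct_adjugate_ne_zero hC] with v hv
        filter_upwards [hv] with b hb x
        rw [Set.indicator_of_notMem]
        rintro ⟨z, h1, h2⟩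
        rw [Equiv.apply_symm_apply] at h1 h2
        have h3 := adjugate_scalar_sub_borderedMatrix x b v (Matrix.of C) z
        rw [h2] at h3
        have h4 := eval_charpoly_borderedMatrix x b v (Matrix.of C) z
        rw [Matrix.eval_charpoly, h1, ← h3] at h4
        apply hb z h3.symm
        simpa using h4
      have e : (∫⁻ C, ∫⁻ v, ∫⁻ b, ∫⁻ x, B.indicator (1 : (Fin (n + 1) → Fin (n + 1) → ℂ) → ℝ≥0∞)
          (Matrix.of.symm (borderedMatrix x b v (Matrix.of C)))
          ∂stdComplexNormal ∂complexGaussian (Fin n) ∂complexGaussian (Fin n) ∂ginibreLaw n)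
          = ∫⁻ _, 0 ∂ginibreLaw n := by
        refine lintegral_congr_ae (hz.mono fun C hC => ?_)
        refine (lintegral_congr_ae (hC.mono fun v hv => ?_)).trans lintegral_zero
        refine (lintegral_congr_ae (hv.mono fun b hb => ?_)).trans lintegral_zero
        exact (lintegral_congr hb).trans lintegral_zero
      rw [e, lintegral_zero]
    filter_upwards [compl_mem_ae_iff.2 h0] with G hG z h1 h2
    exact hG ⟨z, h1, h2⟩

/-! ### The eigenvalues as a function of the corner entry -/

section resolvent

variable {n : ℕ} (b v : Fin n → ℂ) (C : Matrix (Fin n) (Fin n) ℂ)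

/-- The corner entry for which `z` is an eigenvalue of the bordered matrix. -/
noncomputable def cornerOfEigenvalue (z : ℂ) : ℂ :=
  z - b ⬝ᵥ ((Matrix.scalar (Fin n) z - C)⁻¹ *ᵥ v)

/-- The derivative of `cornerOfEigenvalue`. -/
noncomputable def cornerOfEigenvalueDeriv (z : ℂ) : ℂ :=
  1 + b ⬝ᵥ ((Matrix.scalar (Fin n) z - C)⁻¹ *ᵥ ((Matrix.scalar (Fin n) z - C)⁻¹ *ᵥ v))

theorem continuousAt_inv_scalar_sub {z : ℂ} (hz : (Matrix.scalar (Fin n) z - C).det ≠ 0) :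
    ContinuousAt (fun w : ℂ => (Matrix.scalar (Fin n) w - C)⁻¹) z := by
  have hc : Continuous fun w : ℂ => Matrix.scalar (Fin n) w - C :=
    continuous_scalar_sub continuous_id continuous_const
  simp only [Matrix.inv_def, Ring.inverse_eq_inv']
  exact (hc.matrix_det.continuousAt.inv₀ hz).smul hc.matrix_adjugate.continuousAt

theorem isOpen_setOf_det_scalar_sub_ne_zero :
    IsOpen {z : ℂ | (Matrix.scalar (Fin n) z - C).det ≠ 0} :=
  (finite_setOf_det_scalar_sub_eq_zero C).isClosed.isOpen_compl

/-- The resolvent identity computes the difference quotient exactly; continuity of the resolvent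
gives its limit. -/
theorem hasDerivAt_cornerOfEigenvalue {z : ℂ} (hz : (Matrix.scalar (Fin n) z - C).det ≠ 0) :
    HasDerivAt (cornerOfEigenvalue b v C) (cornerOfEigenvalueDeriv b v C z) z := by
  rw [hasDerivAt_iff_tendsto_slope]
  have hcont : ContinuousAt (fun w : ℂ => 1 + b ⬝ᵥ ((Matrix.scalar (Fin n) w - C)⁻¹ *ᵥ
      ((Matrix.scalar (Fin n) z - C)⁻¹ *ᵥ v))) z := by
    have h1 : Continuous fun M : Matrix (Fin n) (Fin n) ℂ =>
        1 + b ⬝ᵥ (M *ᵥ ((Matrix.scalar (Fin n) z - C)⁻¹ *ᵥ v)) := by fun_prop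
    exact h1.continuousAt.comp (continuousAt_inv_scalar_sub C hz)
  refine (hcont.tendsto.mono_left nhdsWithin_le_nhds).congr' ?_
  filter_upwards [nhdsWithin_le_nhds ((isOpen_setOf_det_scalar_sub_ne_zero C).mem_nhds hz),
    self_mem_nhdsWithin] with w hw hwz
  have hwz' : w - z ≠ 0 := sub_ne_zero.2 hwz
  have huw : IsUnit (Matrix.scalar (Fin n) w - C).det := isUnit_iff_ne_zero.2 hw
  have huz : IsUnit (Matrix.scalar (Fin n) z - C).det := isUnit_iff_ne_zero.2 hz
  have hres : (Matrix.scalar (Fin n) z - C)⁻¹ - (Matrix.scalar (Fin n) w - C)⁻¹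
      = (w - z) • ((Matrix.scalar (Fin n) w - C)⁻¹ * (Matrix.scalar (Fin n) z - C)⁻¹) := by
    have hd : (Matrix.scalar (Fin n) w - C) - (Matrix.scalar (Fin n) z - C)
        = (w - z) • (1 : Matrix (Fin n) (Fin n) ℂ) := by
      rw [sub_sub_sub_cancel_right, ← map_sub, Matrix.scalar_apply, Matrix.smul_one_eq_diagonal]
    calc _ = (Matrix.scalar (Fin n) w - C)⁻¹ * ((Matrix.scalar (Fin n) w - C)
          - (Matrix.scalar (Fin n) z - C)) * (Matrix.scalar (Fin n) z - C)⁻¹ := by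
          rw [mul_sub, sub_mul, Matrix.nonsing_inv_mul _ huw, mul_assoc,
            Matrix.mul_nonsing_inv _ huz, one_mul, mul_one]
      _ = _ := by rw [hd, mul_smul_comm, smul_mul_assoc, mul_one]
  have hdiff : cornerOfEigenvalue b v C w - cornerOfEigenvalue b v C z
      = (w - z) * (1 + b ⬝ᵥ ((Matrix.scalar (Fin n) w - C)⁻¹ *ᵥ
      ((Matrix.scalar (Fin n) z - C)⁻¹ *ᵥ v))) := by
    have := congrArg (fun M => b ⬝ᵥ (M *ᵥ v)) hres
    simp only [Matrix.sub_mulVec, dotProduct_sub, Matrix.smul_mulVec, dotProduct_smul,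
      ← Matrix.mulVec_mulVec, smul_eq_mul] at this
    rw [cornerOfEigenvalue, cornerOfEigenvalue, mul_add, ← this]
    ring
  rw [slope_def_field, hdiff, mul_div_cancel_left₀ _ hwz']

theorem measurable_inv_scalar_sub_mulVec {T : Type*} [MeasurableSpace T] {z : T → ℂ}
    {C : T → Fin n → Fin n → ℂ} {v : T → Fin n → ℂ} (hz : Measurable z) (hC : Measurable C)
    (hv : Measurable v) :
    Measurable fun t => (Matrix.scalar (Fin n) (z t) - Matrix.of (C t))⁻¹ *ᵥ v t := by
  have hc : Continuous fun q : ℂ × (Fin n → Fin n → ℂ) × (Fin n → ℂ) =>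
      Matrix.scalar (Fin n) q.1 - Matrix.of q.2.1 :=
    continuous_scalar_sub continuous_fst (by fun_prop)
  have h1 : Measurable fun q : ℂ × (Fin n → Fin n → ℂ) × (Fin n → ℂ) =>
      (Matrix.scalar (Fin n) q.1 - Matrix.of q.2.1).det⁻¹ := hc.matrix_det.measurable.inv
  have h2 : Measurable fun q : ℂ × (Fin n → Fin n → ℂ) × (Fin n → ℂ) =>
      (Matrix.scalar (Fin n) q.1 - Matrix.of q.2.1).adjugate *ᵥ q.2.2 :=
    (hc.matrix_adjugate.matrix_mulVec (by fun_prop)).measurable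
  have h3 := (h1.smul h2).comp (hz.prodMk (hC.prodMk hv))
  have h4 : (fun t => (Matrix.scalar (Fin n) (z t) - Matrix.of (C t))⁻¹ *ᵥ v t)
      = fun t => (Matrix.scalar (Fin n) (z t) - Matrix.of (C t)).det⁻¹ •
        ((Matrix.scalar (Fin n) (z t) - Matrix.of (C t)).adjugate *ᵥ v t) := by
    funext t
    rw [Matrix.inv_def, Ring.inverse_eq_inv', Matrix.smul_mulVec]
  rw [h4]
  exact h3

theorem measurable_cornerOfEigenvalue : Measurable (cornerOfEigenvalue b v C) := by
  have := measurable_inv_scalar_sub_mulVec (n := n) (T := ℂ) (z := id) (C := fun _ => C)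
    (v := fun _ => v) measurable_id measurable_const measurable_const
  exact measurable_id.sub ((by fun_prop : Measurable fun y : Fin n → ℂ => b ⬝ᵥ y).comp this)

theorem isRoot_charpoly_borderedMatrix_iff {z : ℂ} (hz : (Matrix.scalar (Fin n) z - C).det ≠ 0)
    (x : ℂ) : (borderedMatrix x b v C).charpoly.IsRoot z ↔ cornerOfEigenvalue b v C z = x := by
  have h : (borderedMatrix x b v C).charpoly.eval z
      = (Matrix.scalar (Fin n) z - C).det * (cornerOfEigenvalue b v C z - x) := by
    rw [Matrix.eval_charpoly, scalar_sub_borderedMatrix,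
      det_borderedMatrix_of_det_ne_zero _ _ _ _ hz, cornerOfEigenvalue, Matrix.mulVec_neg,
      neg_dotProduct_neg]
    ring
  rw [Polynomial.IsRoot, h, mul_eq_zero, or_iff_right hz, sub_eq_zero]

/-- Near `z` the characteristic polynomial is that of `C` times `cornerOfEigenvalue - x`, and the
second factor vanishes at `z`. Hence regular values of the corner give simple eigenvalues, so that
the multiset of roots is a fibre. -/
theorem derivative_charpoly_borderedMatrix_ne_zero {z : ℂ}
    (hz : (Matrix.scalar (Fin n) z - C).det ≠ 0) {x : ℂ} (hx : cornerOfEigenvalue b v C z = x)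
    (hd : cornerOfEigenvalueDeriv b v C z ≠ 0) :
    (borderedMatrix x b v C).charpoly.derivative.eval z ≠ 0 := by
  have h1 := (borderedMatrix x b v C).charpoly.hasDerivAt z
  have h2 : HasDerivAt (fun w => C.charpoly.eval w * (cornerOfEigenvalue b v C w - x))
      (C.charpoly.derivative.eval z * (cornerOfEigenvalue b v C z - x)
        + C.charpoly.eval z * cornerOfEigenvalueDeriv b v C z) z :=
    (C.charpoly.hasDerivAt z).mul ((hasDerivAt_cornerOfEigenvalue b v C hz).sub_const x)
  have h3 : (fun w => (borderedMatrix x b v C).charpoly.eval w) =ᶠ[𝓝 z]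
      fun w => C.charpoly.eval w * (cornerOfEigenvalue b v C w - x) := by
    filter_upwards [(isOpen_setOf_det_scalar_sub_ne_zero C).mem_nhds hz] with w hw
    rw [Matrix.eval_charpoly, Matrix.eval_charpoly, scalar_sub_borderedMatrix,
      det_borderedMatrix_of_det_ne_zero _ _ _ _ hw, cornerOfEigenvalue, Matrix.mulVec_neg,
      neg_dotProduct_neg]
    ring
  rw [h1.unique (h2.congr_of_eventuallyEq h3), hx, sub_self, mul_zero, zero_add,
    Matrix.eval_charpoly]
  exact mul_ne_zero hz hd

/-- The area formula for the eigenvalues of a bordered matrix as functions of its corner. -/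
theorem lintegral_sum_roots_borderedMatrix
    (hgen : ∀ z : ℂ, (Matrix.scalar (Fin n) z - C).det = 0 →
      b ⬝ᵥ ((Matrix.scalar (Fin n) z - C).adjugate *ᵥ v) ≠ 0)
    {h k : ℂ → ℝ≥0∞} (hh : Measurable h) (hk : Measurable k) :
    ∫⁻ x, k x * ((borderedMatrix x b v C).charpoly.roots.map h).sum
      = ∫⁻ z, ENNReal.ofReal (‖cornerOfEigenvalueDeriv b v C z‖ ^ 2)
          * (k (cornerOfEigenvalue b v C z) * h z) := by
  set U : Set ℂ := {z : ℂ | (Matrix.scalar (Fin n) z - C).det ≠ 0} with hU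
  have hUo : IsOpen U := isOpen_setOf_det_scalar_sub_ne_zero C
  have hR : ∀ z ∈ U, HasDerivAt (cornerOfEigenvalue b v C) (cornerOfEigenvalueDeriv b v C z) z :=
    fun z hz => hasDerivAt_cornerOfEigenvalue b v C hz
  have hR' : ContinuousOn (cornerOfEigenvalueDeriv b v C) U := fun z hz => by
    have h1 : Continuous fun M : Matrix (Fin n) (Fin n) ℂ => 1 + b ⬝ᵥ (M *ᵥ (M *ᵥ v)) := by
      fun_prop
    exact (h1.continuousAt.comp (continuousAt_inv_scalar_sub C hz)).continuousWithinAt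
  -- The area formula is applied off the eigenvalues of `C`, a finite and therefore null set.
  have hUae : (U : Set ℂ) =ᵐ[volume] Set.univ := by
    rw [ae_eq_univ]
    have : Uᶜ = {z : ℂ | (Matrix.scalar (Fin n) z - C).det = 0} := by
      ext z; simp [hU]
    rw [this]
    exact (finite_setOf_det_scalar_sub_eq_zero C).measure_zero _
  have harea := lintegral_tsum_fiber_eq hUo hR hR'
    (h := fun z => k (cornerOfEigenvalue b v C z) * h z)
    ((hk.comp (measurable_cornerOfEigenvalue b v C)).mul hh)
  rw [setLIntegral_congr hUae, setLIntegral_univ] at harea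
  rw [← harea]
  refine lintegral_congr_ae ?_
  filter_upwards [ae_forall_fiber_deriv_ne_zero hR] with x hx
  have hne : (borderedMatrix x b v C).charpoly ≠ 0 := (Matrix.charpoly_monic _).ne_zero
  have hroot : ∀ z, (borderedMatrix x b v C).charpoly.IsRoot z →
      z ∈ U ∧ cornerOfEigenvalueDeriv b v C z ≠ 0 ∧ cornerOfEigenvalue b v C z = x := by
    intro z hz
    have hzU : z ∈ U := fun h0 => by
      apply hgen z h0
      have := eval_charpoly_borderedMatrix x b v C z
      rw [show _ = (0 : ℂ) from hz, h0] at this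
      simpa using this
    have := (isRoot_charpoly_borderedMatrix_iff b v C hzU x).1 hz
    exact ⟨hzU, hx z hzU this, this⟩
  have hnodup : (borderedMatrix x b v C).charpoly.roots.Nodup := by
    rw [Multiset.nodup_iff_count_le_one]
    intro z
    rw [Polynomial.count_roots]
    by_contra! hlt
    obtain ⟨h2, h1⟩ := (Polynomial.one_lt_rootMultiplicity_iff_isRoot hne).1 hlt
    obtain ⟨hzU, hd, hzx⟩ := hroot z h2
    exact derivative_charpoly_borderedMatrix_ne_zero b v C hzU hzx hd h1
  have hset : {z | z ∈ U ∧ cornerOfEigenvalueDeriv b v C z ≠ 0 ∧ cornerOfEigenvalue b v C z = x}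
      = ((borderedMatrix x b v C).charpoly.roots.toFinset : Set ℂ) := by
    ext z
    rw [Finset.mem_coe, Multiset.mem_toFinset, Polynomial.mem_roots hne]
    exact ⟨fun hz => (isRoot_charpoly_borderedMatrix_iff b v C hz.1 x).2 hz.2.2, hroot z⟩
  have hsum : ∑' z : {z | z ∈ U ∧ cornerOfEigenvalueDeriv b v C z ≠ 0 ∧
      cornerOfEigenvalue b v C z = x}, k (cornerOfEigenvalue b v C z) * h z
      = k x * ∑ z ∈ (borderedMatrix x b v C).charpoly.roots.toFinset, h z := by
    have h1 : ∑' z : {z | z ∈ U ∧ cornerOfEigenvalueDeriv b v C z ≠ 0 ∧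
        cornerOfEigenvalue b v C z = x}, k (cornerOfEigenvalue b v C z) * h z
        = ∑' z : {z | z ∈ U ∧ cornerOfEigenvalueDeriv b v C z ≠ 0 ∧
        cornerOfEigenvalue b v C z = x}, k x * h z :=
      tsum_congr fun z => by rw [z.2.2.2]
    rw [h1, hset, Finset.mul_sum]
    exact Finset.tsum_subtype _ fun z => k x * h z
  refine Eq.trans ?_ hsum.symm
  rw [Finset.sum, Multiset.toFinset_val, hnodup.dedup]

end resolvent

/-! ### The mean eigenvalue density as an integral over eigenvectors -/

/-- The joint density of the eigenvalue `z`, the eigenvector `(1, y)` and the remaining Gaussian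
entries `C`, `b`. -/
noncomputable def eigenpairKernel {n : ℕ} (a z : ℂ) (y : Fin n → ℂ)
    (C : Matrix (Fin n) (Fin n) ℂ) (b : Fin n → ℂ) : ℝ :=
  Real.pi⁻¹ ^ (n + 1) * (Real.exp (-(∑ i, ‖((Matrix.scalar (Fin n) z - C) *ᵥ y) i‖ ^ 2)
    - ‖z - a - b ⬝ᵥ y‖ ^ 2) * ‖(Matrix.scalar (Fin n) z - C + Matrix.vecMulVec y b).det‖ ^ 2)

theorem eigenpairKernel_nonneg {n : ℕ} (a z : ℂ) (y : Fin n → ℂ)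
    (C : Matrix (Fin n) (Fin n) ℂ) (b : Fin n → ℂ) : 0 ≤ eigenpairKernel a z y C b := by
  have := Real.pi_pos
  unfold eigenpairKernel
  positivity

theorem continuous_eigenpairKernel {n : ℕ} (a : ℂ) :
    Continuous fun q : ℂ × (Fin n → ℂ) × (Fin n → Fin n → ℂ) × (Fin n → ℂ) =>
      eigenpairKernel a q.1 q.2.1 (Matrix.of q.2.2.1) q.2.2.2 := by
  unfold eigenpairKernel
  have hc : Continuous fun q : ℂ × (Fin n → ℂ) × (Fin n → Fin n → ℂ) × (Fin n → ℂ) =>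
      Matrix.scalar (Fin n) q.1 - Matrix.of q.2.2.1 :=
    continuous_scalar_sub continuous_fst (by fun_prop)
  have h1 : Continuous fun q : ℂ × (Fin n → ℂ) × (Fin n → Fin n → ℂ) × (Fin n → ℂ) =>
      (Matrix.scalar (Fin n) q.1 - Matrix.of q.2.2.1) *ᵥ q.2.1 :=
    hc.matrix_mulVec (by fun_prop)
  have h2 : Continuous fun q : ℂ × (Fin n → ℂ) × (Fin n → Fin n → ℂ) × (Fin n → ℂ) =>
      (Matrix.scalar (Fin n) q.1 - Matrix.of q.2.2.1 + Matrix.vecMulVec q.2.1 q.2.2.2).det :=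
    (hc.add (Continuous.matrix_vecMulVec (by fun_prop) (by fun_prop))).matrix_det
  have h3 : Continuous fun q : ℂ × (Fin n → ℂ) × (Fin n → Fin n → ℂ) × (Fin n → ℂ) =>
      q.2.2.2 ⬝ᵥ q.2.1 := Continuous.dotProduct (by fun_prop) (by fun_prop)
  refine continuous_const.mul ((Real.continuous_exp.comp ?_).mul (h2.norm.pow 2))
  refine Continuous.sub (Continuous.neg (continuous_finsetSum _ fun i _ => ?_)) ?_
  · exact ((continuous_apply i).comp h1).norm.pow 2
  · exact ((continuous_fst.sub continuous_const).sub h3).norm.pow 2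

/-- The same bordered determinant is evaluated by eliminating the corner and by eliminating the
block. -/
theorem det_add_vecMulVec {n : ℕ} (M : Matrix (Fin n) (Fin n) ℂ) (hM : M.det ≠ 0)
    (y b : Fin n → ℂ) :
    (M + Matrix.vecMulVec y b).det = M.det * (1 + b ⬝ᵥ (M⁻¹ *ᵥ y)) := by
  have h : borderedMatrix 1 (-b) y M = borderedMatrix 1 0 y 1
      * borderedMatrix 1 (-b) 0 (M + Matrix.vecMulVec y b) := by
    ext i j
    rw [Matrix.mul_apply, Fin.sum_univ_succ]
    refine Fin.cases ?_ (fun i => ?_) i <;> refine Fin.cases ?_ (fun j => ?_) j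
    · simp
    · simp
    · simp
    · simp [Matrix.one_apply, Matrix.vecMulVec_apply]
  have h2 := congrArg Matrix.det h
  rw [Matrix.det_mul, det_borderedMatrix_zero_left, det_borderedMatrix_zero_right, Matrix.det_one,
    det_borderedMatrix_of_det_ne_zero _ _ _ _ hM, neg_dotProduct, sub_neg_eq_add] at h2
  rw [h2]; ring

/-- Substitute `v = (z - C) y`. The Jacobian `‖det (z - C)‖ ^ 2` times `‖1 + b ⬝ᵥ ((z - C)⁻¹ *ᵥ y)‖
^ 2` is `‖det (z - C + y b)‖ ^ 2` by the rank-one determinant formula, so the resolvent disappears.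
-/
theorem lintegral_resolvent_eq_lintegral_eigenpairKernel {n : ℕ} (a z : ℂ)
    (C : Fin n → Fin n → ℂ) (b : Fin n → ℂ)
    (hC : (Matrix.scalar (Fin n) z - Matrix.of C).det ≠ 0) :
    ∫⁻ v, ENNReal.ofReal (‖cornerOfEigenvalueDeriv b v (Matrix.of C) z‖ ^ 2) * ENNReal.ofReal
        (Real.pi⁻¹ * Real.exp (-‖cornerOfEigenvalue b v (Matrix.of C) z - a‖ ^ 2))
        ∂complexGaussian (Fin n)
      = ∫⁻ y, ENNReal.ofReal (eigenpairKernel a z y (Matrix.of C) b) := by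
  set M := Matrix.scalar (Fin n) z - Matrix.of C with hMdef
  have hu : IsUnit M.det := isUnit_iff_ne_zero.2 hC
  have hm1 : Measurable fun v => cornerOfEigenvalue b v (Matrix.of C) z := by
    unfold cornerOfEigenvalue; fun_prop
  have hm2 : Measurable fun v => cornerOfEigenvalueDeriv b v (Matrix.of C) z := by
    unfold cornerOfEigenvalueDeriv; fun_prop
  have hpi := Real.pi_pos
  rw [lintegral_complexGaussian (by fun_prop), lintegral_comp_mulVec M hC (by fun_prop),
    ← lintegral_const_mul' _ _ ENNReal.ofReal_ne_top]
  refine lintegral_congr fun y => ?_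
  have h1 : M⁻¹ *ᵥ (M *ᵥ y) = y := by
    rw [Matrix.mulVec_mulVec, Matrix.nonsing_inv_mul _ hu, Matrix.one_mulVec]
  rw [cornerOfEigenvalue, cornerOfEigenvalueDeriv, ← hMdef, h1,
    ← ENNReal.ofReal_mul (by positivity), ← ENNReal.ofReal_mul (by positivity),
    ← ENNReal.ofReal_mul (by positivity), eigenpairKernel, ← hMdef, det_add_vecMulVec M hC,
    norm_mul, sub_eq_add_neg (-_ : ℝ), Real.exp_add, Fintype.card_fin, pow_succ,
    sub_right_comm z a]
  congr 1
  ring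

theorem eigenvalueSum_nonneg {N : ℕ} {f : ℂ → ℝ} (hf : ∀ z, 0 ≤ f z)
    (X : Matrix (Fin N) (Fin N) ℂ) : 0 ≤ eigenvalueSum X f :=
  Multiset.sum_nonneg fun x hx => by
    obtain ⟨z, -, rfl⟩ := Multiset.mem_map.1 hx
    exact hf z

theorem ofReal_eigenvalueSum {N : ℕ} {f : ℂ → ℝ} (hf : ∀ z, 0 ≤ f z)
    (X : Matrix (Fin N) (Fin N) ℂ) :
    ENNReal.ofReal (eigenvalueSum X f)
      = (X.charpoly.roots.map fun z => ENNReal.ofReal (f z)).sum := by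
  unfold eigenvalueSum
  induction X.charpoly.roots using Multiset.induction_on with
  | empty => simp
  | cons z s ih =>
    rw [Multiset.map_cons, Multiset.sum_cons, Multiset.map_cons, Multiset.sum_cons,
      ENNReal.ofReal_add (hf z) (Multiset.sum_nonneg fun x hx => by
        obtain ⟨z, -, rfl⟩ := Multiset.mem_map.1 hx
        exact hf z), ih]

/-- Each `C` has finitely many eigenvalues; Fubini exchanges the quantifiers. -/
theorem ae_ae_det_scalar_sub_ne_zero (n : ℕ) : ∀ᵐ z : ℂ, ∀ᵐ C ∂ginibreLaw n,
    (Matrix.scalar (Fin n) z - Matrix.of C).det ≠ 0 := by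
  have hc : Continuous fun q : ℂ × (Fin n → Fin n → ℂ) =>
      (Matrix.scalar (Fin n) q.1 - Matrix.of q.2).det :=
    (continuous_scalar_sub continuous_fst (by fun_prop)).matrix_det
  have hm : MeasurableSet {q : ℂ × (Fin n → Fin n → ℂ) |
      (Matrix.scalar (Fin n) q.1 - Matrix.of q.2).det ≠ 0} :=
    (isOpen_compl_singleton.preimage hc).measurableSet
  refine (Measure.ae_ae_comm (p := fun (z : ℂ) (C : Fin n → Fin n → ℂ) =>
    (Matrix.scalar (Fin n) z - Matrix.of C).det ≠ 0) hm).2 (Eventually.of_forall fun C => ?_)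
  have := (finite_setOf_det_scalar_sub_eq_zero (Matrix.of C)).measure_zero volume
  filter_upwards [compl_mem_ae_iff.2 this] with z hz
  exact hz

theorem lintegral_rotate_three {X Y Z : Type*} [MeasurableSpace X] [MeasurableSpace Y]
    [MeasurableSpace Z] (μ : Measure X) (ν : Measure Y) (ρ : Measure Z) [SFinite μ] [SFinite ν]
    [SFinite ρ] {F : X → Y → Z → ℝ≥0∞} (hF : Measurable fun q : X × Y × Z => F q.1 q.2.1 q.2.2) :
    ∫⁻ x, ∫⁻ y, ∫⁻ z, F x y z ∂ρ ∂ν ∂μ = ∫⁻ z, ∫⁻ x, ∫⁻ y, F x y z ∂ν ∂μ ∂ρ := by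
  have e : ∀ x, ∫⁻ y, ∫⁻ z, F x y z ∂ρ ∂ν = ∫⁻ z, ∫⁻ y, F x y z ∂ν ∂ρ := fun x =>
    lintegral_lintegral_swap (hF.comp (by fun_prop :
      Measurable fun p : Y × Z => (x, p.1, p.2))).aemeasurable
  simp_rw [e]
  exact lintegral_lintegral_swap (Measurable.lintegral_prod_right' (f := fun p : (X × Z) × Y =>
    F p.1.1 p.2 p.1.2) (hF.comp (by fun_prop :
      Measurable fun p : (X × Z) × Y => (p.1.1, p.2, p.1.2)))).aemeasurable

theorem lintegral_rotate_four {W X Y Z : Type*} [MeasurableSpace W] [MeasurableSpace X]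
    [MeasurableSpace Y] [MeasurableSpace Z] (θ : Measure W) (μ : Measure X) (ν : Measure Y)
    (ρ : Measure Z) [SFinite θ] [SFinite μ] [SFinite ν] [SFinite ρ] {F : W → X → Y → Z → ℝ≥0∞}
    (hF : Measurable fun q : W × X × Y × Z => F q.1 q.2.1 q.2.2.1 q.2.2.2) :
    ∫⁻ w, ∫⁻ x, ∫⁻ y, ∫⁻ z, F w x y z ∂ρ ∂ν ∂μ ∂θ
      = ∫⁻ z, ∫⁻ w, ∫⁻ y, ∫⁻ x, F w x y z ∂μ ∂ν ∂θ ∂ρ := by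
  have e1 : ∀ w, ∫⁻ x, ∫⁻ y, ∫⁻ z, F w x y z ∂ρ ∂ν ∂μ = ∫⁻ z, ∫⁻ x, ∫⁻ y, F w x y z ∂ν ∂μ ∂ρ :=
    fun w => lintegral_rotate_three μ ν ρ (hF.comp (by fun_prop :
      Measurable fun p : X × Y × Z => (w, p.1, p.2.1, p.2.2)))
  have e2 : ∀ w z, ∫⁻ x, ∫⁻ y, F w x y z ∂ν ∂μ = ∫⁻ y, ∫⁻ x, F w x y z ∂μ ∂ν := fun w z =>
    lintegral_lintegral_swap (hF.comp (by fun_prop :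
      Measurable fun p : X × Y => (w, p.1, p.2, z))).aemeasurable
  simp_rw [e1, e2]
  have hm1 : Measurable fun p : ((W × Z) × Y) × X => F p.1.1.1 p.2 p.1.2 p.1.1.2 :=
    hF.comp (by fun_prop : Measurable fun p : ((W × Z) × Y) × X =>
      (p.1.1.1, p.2, p.1.2, p.1.1.2))
  exact lintegral_lintegral_swap
    (hm1.lintegral_prod_right' (ν := μ)).lintegral_prod_right'.aemeasurable

theorem measurable_resolvent_weight {n : ℕ} {k : ℂ → ℝ≥0∞} (hkm : Measurable k) :
    Measurable fun q : (Fin n → Fin n → ℂ) × (Fin n → ℂ) × (Fin n → ℂ) × ℂ =>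
      ENNReal.ofReal (‖cornerOfEigenvalueDeriv q.2.2.1 q.2.1 (Matrix.of q.1) q.2.2.2‖ ^ 2)
        * k (cornerOfEigenvalue q.2.2.1 q.2.1 (Matrix.of q.1) q.2.2.2) := by
  have hd : Measurable fun q : (Fin n → ℂ) × (Fin n → ℂ) => q.1 ⬝ᵥ q.2 :=
    (Continuous.dotProduct continuous_fst continuous_snd).measurable
  have h1 : Measurable fun q : (Fin n → Fin n → ℂ) × (Fin n → ℂ) × (Fin n → ℂ) × ℂ =>
      (Matrix.scalar (Fin n) q.2.2.2 - Matrix.of q.1)⁻¹ *ᵥ q.2.1 :=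
    measurable_inv_scalar_sub_mulVec (by fun_prop) (by fun_prop) (by fun_prop)
  have h2 : Measurable fun q : (Fin n → Fin n → ℂ) × (Fin n → ℂ) × (Fin n → ℂ) × ℂ =>
      (Matrix.scalar (Fin n) q.2.2.2 - Matrix.of q.1)⁻¹ *ᵥ
        ((Matrix.scalar (Fin n) q.2.2.2 - Matrix.of q.1)⁻¹ *ᵥ q.2.1) :=
    measurable_inv_scalar_sub_mulVec (by fun_prop) (by fun_prop) h1
  have hb : Measurable fun q : (Fin n → Fin n → ℂ) × (Fin n → ℂ) × (Fin n → ℂ) × ℂ =>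
    q.2.2.1 := by fun_prop
  have h3 : Measurable fun q : (Fin n → Fin n → ℂ) × (Fin n → ℂ) × (Fin n → ℂ) × ℂ =>
      cornerOfEigenvalue q.2.2.1 q.2.1 (Matrix.of q.1) q.2.2.2 :=
    (by fun_prop : Measurable fun q : (Fin n → Fin n → ℂ) × (Fin n → ℂ) × (Fin n → ℂ) × ℂ =>
      q.2.2.2).sub (hd.comp (hb.prodMk h1))
  have h4 : Measurable fun q : (Fin n → Fin n → ℂ) × (Fin n → ℂ) × (Fin n → ℂ) × ℂ =>
      cornerOfEigenvalueDeriv q.2.2.1 q.2.1 (Matrix.of q.1) q.2.2.2 :=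
    measurable_const.add (hd.comp (hb.prodMk h2))
  exact (h4.norm.pow_const 2).ennreal_ofReal.mul (hkm.comp h3)

/-- The perturbed corner is `x + a`. Translation invariance of Lebesgue measure moves `a` into the
Gaussian weight, after which the area formula applies. -/
theorem lintegral_eigenvalueSum_borderedMatrix {n : ℕ} (a : ℂ) {f : ℂ → ℝ} (hf : Continuous f)
    (hf0 : ∀ z, 0 ≤ f z) {C : Matrix (Fin n) (Fin n) ℂ} {b v : Fin n → ℂ}
    (hb : ∀ z : ℂ, (Matrix.scalar (Fin n) z - C).det = 0 →
      b ⬝ᵥ ((Matrix.scalar (Fin n) z - C).adjugate *ᵥ v) ≠ 0) :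
    ∫⁻ x, ENNReal.ofReal (eigenvalueSum
        (borderedMatrix x b v C + borderedMatrix a 0 0 0) f) ∂stdComplexNormal
      = ∫⁻ z, ENNReal.ofReal (f z) * (ENNReal.ofReal (‖cornerOfEigenvalueDeriv b v C z‖ ^ 2)
        * ENNReal.ofReal (Real.pi⁻¹ * Real.exp (-‖cornerOfEigenvalue b v C z - a‖ ^ 2))) := by
  have hsum : ∀ x, borderedMatrix x b v C + borderedMatrix a 0 0 0
      = borderedMatrix (x + a) b v C := by
    intro x
    ext i j
    rw [Matrix.add_apply]
    refine Fin.cases ?_ (fun i => ?_) i <;> refine Fin.cases ?_ (fun j => ?_) j <;> simp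
  set k : ℂ → ℝ≥0∞ := fun x => ENNReal.ofReal (Real.pi⁻¹ * Real.exp (-‖x - a‖ ^ 2)) with hk
  have hkm : Measurable k := by fun_prop
  simp only [hsum]
  have hmx : Measurable fun x => ENNReal.ofReal (eigenvalueSum (borderedMatrix x b v C) f) :=
    ((continuous_eigenvalueSum hf).comp (continuous_borderedMatrix.comp (by fun_prop :
      Continuous fun x : ℂ => (x, b, v, C)))).measurable.ennreal_ofReal
  rw [lintegral_stdComplexNormal
    (f := fun x => ENNReal.ofReal (eigenvalueSum (borderedMatrix (x + a) b v C) f))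
    (hmx.comp (measurable_id.add_const a))]
  have hshift := lintegral_add_right_eq_self (μ := (volume : Measure ℂ))
    (fun x => k x * ENNReal.ofReal (eigenvalueSum (borderedMatrix x b v C) f)) a
  simp only [hk, add_sub_cancel_right] at hshift
  rw [hshift]
  have harea := lintegral_sum_roots_borderedMatrix b v C hb
    (h := fun z => ENNReal.ofReal (f z)) (by fun_prop) hkm
  simp only [ofReal_eigenvalueSum hf0]
  rw [harea]
  refine lintegral_congr fun z => ?_
  simp only [hk]
  ring

/-- Apply the area formula in the corner for generic `C`, `v`, `b`, bring the integral over `z`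
outside by Tonelli, and trade `v` for `y` for almost every `z`. -/
theorem lintegral_eigenvalueSum_eq {n : ℕ} (a : ℂ) {f : ℂ → ℝ} (hf : Continuous f)
    (hf0 : ∀ z, 0 ≤ f z) :
    ∫⁻ G, ENNReal.ofReal (eigenvalueSum (Matrix.of G + borderedMatrix a 0 0 0) f)
        ∂ginibreLaw (n + 1)
      = ∫⁻ z, ENNReal.ofReal (f z) * ∫⁻ y : Fin n → ℂ, ∫⁻ C, ∫⁻ b,
          ENNReal.ofReal (eigenpairKernel a z y (Matrix.of C) b)
          ∂complexGaussian (Fin n) ∂ginibreLaw n := by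
  set h : ℂ → ℝ≥0∞ := fun z => ENNReal.ofReal (f z) with hh
  have hhm : Measurable h := by fun_prop
  set k : ℂ → ℝ≥0∞ := fun x => ENNReal.ofReal (Real.pi⁻¹ * Real.exp (-‖x - a‖ ^ 2)) with hk
  have hkm : Measurable k := by fun_prop
  have hm0 : Measurable fun G : Fin (n + 1) → Fin (n + 1) → ℂ =>
      ENNReal.ofReal (eigenvalueSum (Matrix.of G + borderedMatrix a 0 0 0) f) := by
    have h1 : Continuous fun G : Fin (n + 1) → Fin (n + 1) → ℂ =>
        Matrix.of G + borderedMatrix a 0 0 0 := by fun_prop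
    exact ((continuous_eigenvalueSum hf).comp h1).measurable.ennreal_ofReal
  rw [lintegral_ginibreLaw_succ (F := fun X =>
    ENNReal.ofReal (eigenvalueSum (X + borderedMatrix a 0 0 0) f)) hm0]
  have hinner : ∫⁻ C, ∫⁻ v, ∫⁻ b, ∫⁻ x, ENNReal.ofReal (eigenvalueSum
        (borderedMatrix x b v (Matrix.of C) + borderedMatrix a 0 0 0) f) ∂stdComplexNormal
        ∂complexGaussian (Fin n) ∂complexGaussian (Fin n) ∂ginibreLaw n
      = ∫⁻ C, ∫⁻ v, ∫⁻ b, ∫⁻ z, h z *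
        (ENNReal.ofReal (‖cornerOfEigenvalueDeriv b v (Matrix.of C) z‖ ^ 2)
          * k (cornerOfEigenvalue b v (Matrix.of C) z)) ∂volume
        ∂complexGaussian (Fin n) ∂complexGaussian (Fin n) ∂ginibreLaw n := by
    refine lintegral_congr_ae ((ginibreLaw_ae_adjugate_ne_zero n).mono fun C hC => ?_)
    refine lintegral_congr_ae ((ae_forall_dotProduct_adjugate_ne_zero hC).mono fun v hv => ?_)
    exact lintegral_congr_ae (hv.mono fun b hb =>
      lintegral_eigenvalueSum_borderedMatrix a hf hf0 hb)
  rw [hinner, lintegral_rotate_four (ginibreLaw n) (complexGaussian (Fin n))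
    (complexGaussian (Fin n)) volume
    ((hhm.comp (by fun_prop)).mul (measurable_resolvent_weight hkm))]
  refine lintegral_congr_ae ((ae_ae_det_scalar_sub_ne_zero n).mono fun z hz => ?_)
  have hKm : Measurable fun q : (Fin n → Fin n → ℂ) × (Fin n → ℂ) × (Fin n → ℂ) =>
      ENNReal.ofReal (eigenpairKernel a z q.2.2 (Matrix.of q.1) q.2.1) :=
    ((continuous_eigenpairKernel a).comp (by fun_prop : Continuous
      fun q : (Fin n → Fin n → ℂ) × (Fin n → ℂ) × (Fin n → ℂ) =>
        (z, q.2.2, q.1, q.2.1))).measurable.ennreal_ofReal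
  have hpull : ∀ {T : Type} [MeasurableSpace T] (μ : Measure T) (g : T → ℝ≥0∞),
      ∫⁻ t, h z * g t ∂μ = h z * ∫⁻ t, g t ∂μ := fun μ g =>
    lintegral_const_mul' _ _ ENNReal.ofReal_ne_top
  simp only [hpull]
  congr 1
  rw [← lintegral_rotate_three (ginibreLaw n) (complexGaussian (Fin n)) volume hKm]
  exact lintegral_congr_ae (hz.mono fun C hC => lintegral_congr fun b =>
    lintegral_resolvent_eq_lintegral_eigenpairKernel a z C b hC)

/-! ### Second moments of determinants with independent entries -/

section rowMoments

variable {ι : Type*} [Fintype ι] [DecidableEq ι] {Ω : Type*} [MeasurableSpace Ω] {μ : Measure Ω}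
  [SigmaFinite μ] {e : ι → Ω → ℂ} {w : ι → Ω → ℂ}

/-- The factor of `e k * conj (e l) * ∏ j, w j` that depends on the `j`-th coordinate. -/
noncomputable def rowFactor (e w : ι → Ω → ℂ) (k l j : ι) (x : Ω) : ℂ :=
  (if j = k then e j x else 1) * (if j = l then conj (e j x) else 1) * w j x

theorem prod_rowFactor (k l : ι) (x : ι → Ω) :
    ∏ j, rowFactor e w k l j (x j) = e k (x k) * conj (e l (x l)) * ∏ j, w j (x j) := by
  simp only [rowFactor, Finset.prod_mul_distrib, Finset.prod_ite_eq', Finset.mem_univ, if_true]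

theorem integrable_rowFactor (h0 : ∀ k, Integrable (w k) μ)
    (h1 : ∀ k, Integrable (fun x => e k x * w k x) μ)
    (h1' : ∀ k, Integrable (fun x => conj (e k x) * w k x) μ)
    (h2 : ∀ k, Integrable (fun x => e k x * conj (e k x) * w k x) μ) (k l j : ι) :
    Integrable (rowFactor e w k l j) μ := by
  unfold rowFactor
  by_cases hk : j = k <;> by_cases hl : j = l
  · simpa only [if_pos hk, if_pos hl] using h2 j
  · simpa only [if_pos hk, if_neg hl, mul_one] using h1 j
  · simpa only [if_neg hk, if_pos hl, one_mul] using h1' j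
  · simpa only [if_neg hk, if_neg hl, one_mul] using h0 j

/-- At most one of `k ≠ l` equals the diagonal index `i`, so the product contains a centred
off-diagonal factor that is not paired with its conjugate. -/
theorem integral_prod_rowFactor_of_ne {i k l : ι} (hkl : k ≠ l)
    (hz : ∀ k, i ≠ k → ∫ x, e k x * w k x ∂μ = 0)
    (hz' : ∀ k, i ≠ k → ∫ x, conj (e k x) * w k x ∂μ = 0) :
    ∫ x : ι → Ω, ∏ j, rowFactor e w k l j (x j) ∂(Measure.pi fun _ => μ) = 0 := by
  rw [integral_fintype_prod_eq_prod]
  by_cases hik : i = k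
  · refine Finset.prod_eq_zero (Finset.mem_univ l) ?_
    have hil : i ≠ l := fun h => hkl (hik.symm.trans h)
    simpa only [rowFactor, if_neg hkl.symm, if_true, one_mul] using hz' l hil
  · refine Finset.prod_eq_zero (Finset.mem_univ k) ?_
    simpa only [rowFactor, if_neg hkl, if_true, mul_one] using hz k hik

theorem integral_prod_rowFactor_self {m V : ι → ℂ} (hm : ∀ k, ∫ x, w k x ∂μ = m k)
    (hV : ∀ k, ∫ x, e k x * conj (e k x) * w k x ∂μ = m k * V k) (k : ι) :
    ∫ x : ι → Ω, ∏ j, rowFactor e w k k j (x j) ∂(Measure.pi fun _ => μ)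
      = V k * ∏ j, m j := by
  rw [integral_fintype_prod_eq_prod]
  have : ∀ j, ∫ x, rowFactor e w k k j x ∂μ = (if j = k then V j else 1) * m j := by
    intro j
    by_cases h : j = k
    · subst h
      simp only [rowFactor, if_true]
      rw [hV, mul_comm]
    · simp only [rowFactor, if_neg h, one_mul]
      exact hm j
  simp_rw [this]
  simp only [Finset.prod_mul_distrib, Finset.prod_ite_eq', Finset.mem_univ, if_true]

end rowMoments

theorem det_mul_conj_det {ι : Type*} [Fintype ι] [DecidableEq ι] (M : Matrix ι ι ℂ) :
    M.det * conj M.det = ∑ σ : Equiv.Perm ι, ∑ τ : Equiv.Perm ι,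
      ((Equiv.Perm.sign σ : ℤ) * (Equiv.Perm.sign τ : ℤ) : ℂ)
        * ∏ i, (M i (σ i) * conj (M i (τ i))) := by
  rw [← Matrix.det_transpose, Matrix.det_apply', map_sum, Finset.sum_mul_sum]
  refine Finset.sum_congr rfl fun σ _ => Finset.sum_congr rfl fun τ _ => ?_
  simp only [map_mul, map_prod, Matrix.transpose_apply, Finset.prod_mul_distrib, map_intCast]
  ring

section detMoments

variable {ι : Type*} [Fintype ι] [DecidableEq ι] {Ω : Type*} [MeasurableSpace Ω] {μ : Measure Ω}
  [SigmaFinite μ] {e w : ι → ι → Ω → ℂ}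

theorem det_mul_conj_det_mul_weight (x : ι → ι → Ω) :
    (Matrix.of fun i k => e i k (x i k)).det * conj (Matrix.of fun i k => e i k (x i k)).det
        * ∏ i, ∏ k, w i k (x i k)
      = ∑ σ : Equiv.Perm ι, ∑ τ : Equiv.Perm ι,
        ((Equiv.Perm.sign σ : ℤ) * (Equiv.Perm.sign τ : ℤ) : ℂ)
          * ∏ i, ∏ j, rowFactor (e i) (w i) (σ i) (τ i) j (x i j) := by
  rw [det_mul_conj_det, Finset.sum_mul]
  refine Finset.sum_congr rfl fun σ _ => ?_
  rw [Finset.sum_mul]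
  refine Finset.sum_congr rfl fun τ _ => ?_
  rw [mul_assoc, ← Finset.prod_mul_distrib]
  simp only [prod_rowFactor, Matrix.of_apply]

theorem integrable_prod_prod_rowFactor (h0 : ∀ i k, Integrable (w i k) μ)
    (h1 : ∀ i k, Integrable (fun x => e i k x * w i k x) μ)
    (h1' : ∀ i k, Integrable (fun x => conj (e i k x) * w i k x) μ)
    (h2 : ∀ i k, Integrable (fun x => e i k x * conj (e i k x) * w i k x) μ)
    (σ τ : Equiv.Perm ι) :
    Integrable (fun x : ι → ι → Ω => ∏ i, ∏ j, rowFactor (e i) (w i) (σ i) (τ i) j (x i j))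
      (Measure.pi fun _ => Measure.pi fun _ => μ) :=
  Integrable.fintype_prod (f := fun i (x : ι → Ω) =>
    ∏ j, rowFactor (e i) (w i) (σ i) (τ i) j (x j)) fun i => Integrable.fintype_prod fun j =>
      integrable_rowFactor (h0 i) (h1 i) (h1' i) (h2 i) _ _ j

theorem integrable_det_mul_conj_det (h0 : ∀ i k, Integrable (w i k) μ)
    (h1 : ∀ i k, Integrable (fun x => e i k x * w i k x) μ)
    (h1' : ∀ i k, Integrable (fun x => conj (e i k x) * w i k x) μ)
    (h2 : ∀ i k, Integrable (fun x => e i k x * conj (e i k x) * w i k x) μ) :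
    Integrable (fun x : ι → ι → Ω => (Matrix.of fun i k => e i k (x i k)).det
        * conj (Matrix.of fun i k => e i k (x i k)).det * ∏ i, ∏ k, w i k (x i k))
      (Measure.pi fun _ => Measure.pi fun _ => μ) := by
  simp_rw [det_mul_conj_det_mul_weight]
  exact integrable_finsetSum _ fun σ _ => integrable_finsetSum _ fun τ _ =>
    (integrable_prod_prod_rowFactor h0 h1 h1' h2 σ τ).const_mul _

/-- The weighted second moment of the determinant of a matrix with independent entries, the
off-diagonal ones centred: a permanent of second moments. -/
theorem integral_det_mul_conj_det (h0 : ∀ i k, Integrable (w i k) μ)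
    (h1 : ∀ i k, Integrable (fun x => e i k x * w i k x) μ)
    (h1' : ∀ i k, Integrable (fun x => conj (e i k x) * w i k x) μ)
    (h2 : ∀ i k, Integrable (fun x => e i k x * conj (e i k x) * w i k x) μ)
    (hz : ∀ i k, i ≠ k → ∫ x, e i k x * w i k x ∂μ = 0)
    (hz' : ∀ i k, i ≠ k → ∫ x, conj (e i k x) * w i k x ∂μ = 0)
    {m V : ι → ι → ℂ} (hm : ∀ i k, ∫ x, w i k x ∂μ = m i k)
    (hV : ∀ i k, ∫ x, e i k x * conj (e i k x) * w i k x ∂μ = m i k * V i k) :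
    ∫ x : ι → ι → Ω, (Matrix.of fun i k => e i k (x i k)).det
        * conj (Matrix.of fun i k => e i k (x i k)).det * ∏ i, ∏ k, w i k (x i k)
        ∂(Measure.pi fun _ => Measure.pi fun _ => μ)
      = (∏ i, ∏ k, m i k) * ∑ σ : Equiv.Perm ι, ∏ i, V i (σ i) := by
  simp_rw [det_mul_conj_det_mul_weight]
  have hint := fun σ τ => (integrable_prod_prod_rowFactor h0 h1 h1' h2 σ τ).const_mul
    ((Equiv.Perm.sign σ : ℤ) * (Equiv.Perm.sign τ : ℤ) : ℂ)
  rw [integral_finsetSum _ fun σ _ => integrable_finsetSum _ fun τ _ => hint σ τ, Finset.mul_sum]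
  refine Finset.sum_congr rfl fun σ _ => ?_
  rw [integral_finsetSum _ fun τ _ => hint σ τ]
  have hval : ∀ τ : Equiv.Perm ι,
      ∫ x : ι → ι → Ω, ∏ i, ∏ j, rowFactor (e i) (w i) (σ i) (τ i) j (x i j)
        ∂(Measure.pi fun _ => Measure.pi fun _ => μ)
      = ∏ i, ∫ x : ι → Ω, ∏ j, rowFactor (e i) (w i) (σ i) (τ i) j (x j)
        ∂(Measure.pi fun _ => μ) := fun τ =>
    integral_fintype_prod_eq_prod (μ := fun _ : ι => Measure.pi fun _ : ι => μ)
      fun i (x : ι → Ω) => ∏ j, rowFactor (e i) (w i) (σ i) (τ i) j (x j)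
  -- Only `τ = σ` survives: if the two permutations differ at some row, that row contributes zero.
  rw [Finset.sum_eq_single σ]
  · rw [integral_const_mul, hval, Finset.prod_congr rfl fun i _ =>
      integral_prod_rowFactor_self (hm i) (hV i) (σ i), Finset.prod_mul_distrib]
    have : ((Equiv.Perm.sign σ : ℤ) * (Equiv.Perm.sign σ : ℤ) : ℂ) = 1 := by
      rw [← Int.cast_mul, ← Units.val_mul, Int.units_mul_self]; simp
    rw [this, one_mul, mul_comm]
  · intro τ _ hτ
    obtain ⟨i, hi⟩ : ∃ i, σ i ≠ τ i := by
      by_contra! h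
      exact hτ (Equiv.ext fun i => (h i).symm)
    rw [integral_const_mul, hval, Finset.prod_eq_zero (Finset.mem_univ i), mul_zero]
    exact integral_prod_rowFactor_of_ne hi (hz i) (hz' i)
  · exact fun h => absurd (Finset.mem_univ _) h

end detMoments

/-! ### Gaussian moments -/

theorem integral_stdComplexNormal (f : ℂ → ℂ) :
    ∫ z, f z ∂stdComplexNormal = ∫ z, ((Real.pi⁻¹ * Real.exp (-‖z‖ ^ 2) : ℝ) : ℂ) * f z := by
  rw [stdComplexNormal_eq_withDensity, integral_withDensity_eq_integral_toReal_smul (by fun_prop)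
    (Eventually.of_forall fun _ => ENNReal.ofReal_lt_top)]
  refine integral_congr_ae (Eventually.of_forall fun z => ?_)
  have : 0 ≤ Real.pi⁻¹ * Real.exp (-‖z‖ ^ 2) := by positivity
  simp only [ENNReal.toReal_ofReal this]
  rfl

theorem integral_norm_sq_stdComplexNormal : ∫ z, (z * conj z : ℂ) ∂stdComplexNormal = 1 := by
  rw [integral_stdComplexNormal]
  have h := Complex.integral_rpow_mul_exp_neg_rpow (p := 2) (q := 2) (by norm_num) (by norm_num)
  have h2 : ∫ z : ℂ, ‖z‖ ^ 2 * Real.exp (-‖z‖ ^ 2) = Real.pi := by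
    have e : ((2 : ℝ) + 2) / 2 = 2 := by norm_num
    rw [e, Real.Gamma_two] at h
    simpa using h
  have h3 : ∀ z : ℂ, ((Real.pi⁻¹ * Real.exp (-‖z‖ ^ 2) : ℝ) : ℂ) * (z * conj z)
      = ((Real.pi⁻¹ * (‖z‖ ^ 2 * Real.exp (-‖z‖ ^ 2)) : ℝ) : ℂ) := fun z => by
    rw [Complex.mul_conj, Complex.normSq_eq_norm_sq]; push_cast; ring
  simp_rw [h3]
  rw [integral_complex_ofReal, integral_const_mul, h2, inv_mul_cancel₀ Real.pi_ne_zero]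
  simp

theorem integrable_norm_sq_stdComplexNormal :
    Integrable (fun z : ℂ => z * conj z) stdComplexNormal :=
  Integrable.of_integral_ne_zero (by rw [integral_norm_sq_stdComplexNormal]; exact one_ne_zero)

theorem memLp_id_stdComplexNormal : MemLp (fun z : ℂ => z) 2 stdComplexNormal := by
  rw [memLp_two_iff_integrable_sq_norm (by fun_prop)]
  refine integrable_norm_sq_stdComplexNormal.norm.congr (Eventually.of_forall fun z => ?_)
  simp [sq]

theorem integral_id_stdComplexNormal : ∫ z, z ∂stdComplexNormal = 0 := by
  rw [integral_stdComplexNormal]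
  have h := integral_neg_eq_self (fun z : ℂ => ((Real.pi⁻¹ * Real.exp (-‖z‖ ^ 2) : ℝ) : ℂ) * z)
    volume
  simp only [norm_neg, mul_neg, integral_neg] at h
  exact self_eq_neg.1 h.symm

theorem integral_conj_stdComplexNormal : ∫ z, conj z ∂stdComplexNormal = 0 := by
  rw [integral_conj, integral_id_stdComplexNormal, map_zero]

/-- Completing the square in a Gaussian integral. -/
theorem integral_mul_exp_stdComplexNormal (p : ℂ) (s : ℝ) (F : ℂ → ℂ) :
    ∫ c, F c * (Real.exp (-‖p - s * c‖ ^ 2) : ℂ) ∂stdComplexNormal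
      = ((Real.exp (-‖p‖ ^ 2 / (1 + s ^ 2)) / (1 + s ^ 2) : ℝ) : ℂ) *
        ∫ g, F ((s / (1 + s ^ 2) : ℝ) * p + ((√(1 + s ^ 2))⁻¹ : ℝ) * g) ∂stdComplexNormal := by
  have hq : 0 < 1 + s ^ 2 := by positivity
  set q := 1 + s ^ 2 with hqdef
  set c₀ : ℂ := (s / q : ℝ) * p with hc₀
  rw [integral_stdComplexNormal, integral_stdComplexNormal]
  have hsq : √q ^ 2 = q := Real.sq_sqrt hq.le
  have hsq0 : √q ≠ 0 := (Real.sqrt_pos.2 hq).ne'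
  set H : ℂ → ℂ := fun c => ((Real.pi⁻¹ * Real.exp (-‖c‖ ^ 2) : ℝ) : ℂ) *
    (F c * (Real.exp (-‖p - s * c‖ ^ 2) : ℂ)) with hH
  have h1 : ∫ c, H c = ∫ c, H (c₀ + c) := (integral_add_left_eq_self H c₀).symm
  have h2 := Measure.integral_comp_smul volume (fun c => H (c₀ + c)) (√q)⁻¹
  rw [Complex.finrank_real_complex, inv_pow, hsq, inv_inv, abs_of_pos hq] at h2
  have h3 : ∫ c, H (c₀ + c) = ((q⁻¹ : ℝ) : ℂ) * ∫ g, H (c₀ + (√q)⁻¹ • g) := by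
    rw [h2, Complex.real_smul, ← mul_assoc, ← Complex.ofReal_mul, inv_mul_cancel₀ hq.ne']
    simp
  rw [h1, h3, ← integral_const_mul, ← integral_const_mul]
  refine integral_congr_ae (Eventually.of_forall fun g => ?_)
  simp only [hH, Complex.real_smul]
  set c := c₀ + ((√q)⁻¹ : ℝ) * g with hc
  -- Completing the square: `c₀` is the centre of the tilted Gaussian and `q⁻¹` its variance.
  have key : -‖c‖ ^ 2 + -‖p - s * c‖ ^ 2 = -‖p‖ ^ 2 / q + -‖g‖ ^ 2 := by
    have hg : g = (√q : ℝ) * (c - c₀) := by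
      rw [hc, add_sub_cancel_left, ← mul_assoc, ← Complex.ofReal_mul, mul_inv_cancel₀ hsq0]
      simp
    rw [hg, norm_mul, mul_pow, Complex.norm_real, Real.norm_eq_abs, sq_abs, hsq]
    simp only [Complex.sq_norm, Complex.normSq_apply, hc₀, Complex.sub_re, Complex.sub_im,
      Complex.mul_re, Complex.mul_im, Complex.ofReal_re, Complex.ofReal_im]
    field_simp
    rw [hqdef]
    ring
  have hexp : Real.exp (-‖c‖ ^ 2) * Real.exp (-‖p - s * c‖ ^ 2)
      = Real.exp (-‖p‖ ^ 2 / q) * Real.exp (-‖g‖ ^ 2) := by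
    rw [← Real.exp_add, ← Real.exp_add, key]
  have hexp' := congrArg (fun t : ℝ => (t : ℂ)) hexp
  push_cast at hexp' ⊢
  calc _ = (q : ℂ)⁻¹ * (Real.pi : ℂ)⁻¹ * F c
        * (Complex.exp (-(‖c‖ : ℂ) ^ 2) * Complex.exp (-(‖p - s * c‖ : ℂ) ^ 2)) := by ring
    _ = _ := by rw [hexp']; ring

/-! ### Moments of pairs of tilted Gaussian entries -/

/-- The Gaussian tilt `exp (-|p - s c|²)`. -/
noncomputable def gaussianTilt (p : ℂ) (s : ℝ) (c : ℂ) : ℝ := Real.exp (-‖p - s * c‖ ^ 2)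

/-- The total mass of the standard complex normal law tilted by `gaussianTilt p s`. -/
noncomputable def tiltMass (p : ℂ) (s : ℝ) : ℝ :=
  Real.exp (-‖p‖ ^ 2 / (1 + s ^ 2)) / (1 + s ^ 2)

/-- The mean of the standard complex normal law tilted by `gaussianTilt p s`. -/
noncomputable def tiltMean (p : ℂ) (s : ℝ) : ℂ := (s / (1 + s ^ 2) : ℝ) * p

theorem integral_mul_gaussianTilt (p : ℂ) (s : ℝ) (F : ℂ → ℂ) :
    ∫ c, F c * (gaussianTilt p s c : ℂ) ∂stdComplexNormal
      = (tiltMass p s : ℂ) *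
        ∫ g, F (tiltMean p s + ((√(1 + s ^ 2))⁻¹ : ℝ) * g) ∂stdComplexNormal :=
  integral_mul_exp_stdComplexNormal p s F

theorem continuous_gaussianTilt (p : ℂ) (s : ℝ) : Continuous (gaussianTilt p s) := by
  unfold gaussianTilt; fun_prop

theorem norm_gaussianTilt_le (p : ℂ) (s : ℝ) (c : ℂ) : ‖(gaussianTilt p s c : ℂ)‖ ≤ 1 := by
  rw [Complex.norm_real, Real.norm_eq_abs, gaussianTilt, abs_of_pos (Real.exp_pos _),
    Real.exp_le_one_iff]
  simp

@[simp] theorem gaussianTilt_zero_zero (c : ℂ) : gaussianTilt 0 0 c = 1 := by simp [gaussianTilt]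

@[simp] theorem tiltMass_zero_zero : tiltMass 0 0 = 1 := by simp [tiltMass]

/-- The law of a pair of independent standard complex normal variables. -/
noncomputable def gaussianPair : Measure (ℂ × ℂ) := stdComplexNormal.prod stdComplexNormal

instance : IsProbabilityMeasure gaussianPair := by unfold gaussianPair; infer_instance

theorem memLp_affine_gaussianPair (d : ℂ) (α β : ℂ) :
    MemLp (fun q : ℂ × ℂ => d + α * q.1 + β * q.2) 2 gaussianPair := by
  have h1 : MemLp (fun q : ℂ × ℂ => q.1) 2 gaussianPair :=
    memLp_id_stdComplexNormal.comp_fst stdComplexNormal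
  have h2 : MemLp (fun q : ℂ × ℂ => q.2) 2 gaussianPair :=
    memLp_id_stdComplexNormal.comp_snd stdComplexNormal
  exact ((memLp_const d).add (h1.const_mul α)).add (h2.const_mul β)

theorem integrable_affine_gaussianPair (d α β : ℂ) :
    Integrable (fun q : ℂ × ℂ => d + α * q.1 + β * q.2) gaussianPair :=
  (memLp_affine_gaussianPair d α β).integrable one_le_two

theorem integrable_conj_affine_gaussianPair (d α β : ℂ) :
    Integrable (fun q : ℂ × ℂ => conj (d + α * q.1 + β * q.2)) gaussianPair :=
  (memLp_affine_gaussianPair d α β).star.integrable one_le_two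

theorem integrable_affine_mul_conj_gaussianPair (d α β : ℂ) :
    Integrable (fun q : ℂ × ℂ => (d + α * q.1 + β * q.2) * conj (d + α * q.1 + β * q.2))
      gaussianPair :=
  (memLp_affine_gaussianPair d α β).integrable_mul (memLp_affine_gaussianPair d α β).star

theorem integral_affine_stdComplexNormal (d α : ℂ) :
    ∫ g, (d + α * g) ∂stdComplexNormal = d := by
  have hi : Integrable (fun z : ℂ => z) stdComplexNormal :=
    memLp_id_stdComplexNormal.integrable one_le_two
  rw [integral_add (integrable_const _) (hi.const_mul _), integral_const_mul,
    integral_id_stdComplexNormal]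
  simp

theorem integrable_affine_mul_conj_stdComplexNormal (d α : ℂ) :
    Integrable (fun g : ℂ => (d + α * g) * conj (d + α * g)) stdComplexNormal := by
  have hm : MemLp (fun g : ℂ => d + α * g) 2 stdComplexNormal :=
    (memLp_const d).add (memLp_id_stdComplexNormal.const_mul α)
  exact hm.integrable_mul hm.star

theorem integral_affine_mul_conj_stdComplexNormal (d α : ℂ) :
    ∫ g, (d + α * g) * conj (d + α * g) ∂stdComplexNormal = d * conj d + α * conj α := by
  have hi : Integrable (fun z : ℂ => z) stdComplexNormal :=
    memLp_id_stdComplexNormal.integrable one_le_two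
  have hi' : Integrable (fun z : ℂ => conj z) stdComplexNormal :=
    memLp_id_stdComplexNormal.star.integrable one_le_two
  have h : ∀ g : ℂ, (d + α * g) * conj (d + α * g)
      = d * conj d + (conj d * α * g + (d * conj α * conj g + α * conj α * (g * conj g))) := by
    intro g; simp only [map_add, map_mul]; ring
  have i1 : Integrable (fun g : ℂ => conj d * α * g) stdComplexNormal := hi.const_mul _
  have i2 : Integrable (fun g : ℂ => d * conj α * conj g) stdComplexNormal := hi'.const_mul _
  have i3 : Integrable (fun g : ℂ => α * conj α * (g * conj g)) stdComplexNormal :=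
    integrable_norm_sq_stdComplexNormal.const_mul _
  have i23 : Integrable (fun g : ℂ => d * conj α * conj g + α * conj α * (g * conj g))
    stdComplexNormal := i2.add i3
  have i123 : Integrable (fun g : ℂ => conj d * α * g
    + (d * conj α * conj g + α * conj α * (g * conj g))) stdComplexNormal := i1.add i23
  simp_rw [h]
  rw [integral_add (integrable_const _) i123, integral_add i1 i23, integral_add i2 i3,
    integral_const_mul (conj d * α), integral_const_mul (d * conj α),
    integral_const_mul (α * conj α), integral_id_stdComplexNormal,
    integral_conj_stdComplexNormal, integral_norm_sq_stdComplexNormal]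
  simp

section pairTilt

variable (p₁ p₂ : ℂ) (s₁ s₂ : ℝ)

/-- The product of the Gaussian tilts of the two components of a pair. -/
noncomputable def pairTilt (q : ℂ × ℂ) : ℂ := (gaussianTilt p₁ s₁ q.1 * gaussianTilt p₂ s₂ q.2 : ℝ)

theorem continuous_pairTilt : Continuous (pairTilt p₁ p₂ s₁ s₂) := by
  have h1 := continuous_gaussianTilt p₁ s₁
  have h2 := continuous_gaussianTilt p₂ s₂
  unfold pairTilt
  fun_prop

theorem norm_pairTilt_le (q : ℂ × ℂ) : ‖pairTilt p₁ p₂ s₁ s₂ q‖ ≤ 1 := by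
  rw [pairTilt, Complex.ofReal_mul, norm_mul]
  exact mul_le_one₀ (norm_gaussianTilt_le _ _ _) (norm_nonneg _) (norm_gaussianTilt_le _ _ _)

theorem integrable_mul_pairTilt {F : ℂ × ℂ → ℂ} (hF : Integrable F gaussianPair) :
    Integrable (fun q => F q * pairTilt p₁ p₂ s₁ s₂ q) gaussianPair :=
  hF.mul_bdd (c := 1) (continuous_pairTilt _ _ _ _).aestronglyMeasurable
    (Eventually.of_forall (norm_pairTilt_le p₁ p₂ s₁ s₂))

theorem integral_mul_pairTilt {F : ℂ × ℂ → ℂ} (hF : Integrable F gaussianPair) :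
    ∫ q, F q * pairTilt p₁ p₂ s₁ s₂ q ∂gaussianPair
      = (tiltMass p₁ s₁ * tiltMass p₂ s₂ : ℂ) * ∫ g, ∫ h,
        F (tiltMean p₁ s₁ + ((√(1 + s₁ ^ 2))⁻¹ : ℝ) * g,
          tiltMean p₂ s₂ + ((√(1 + s₂ ^ 2))⁻¹ : ℝ) * h) ∂stdComplexNormal ∂stdComplexNormal := by
  have h := integral_prod _ (integrable_mul_pairTilt p₁ p₂ s₁ s₂ hF)
  rw [gaussianPair, h]
  have e : ∀ c, ∫ b, F (c, b) * pairTilt p₁ p₂ s₁ s₂ (c, b) ∂stdComplexNormal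
      = ((tiltMass p₂ s₂ : ℂ) * ∫ h, F (c, tiltMean p₂ s₂ + ((√(1 + s₂ ^ 2))⁻¹ : ℝ) * h)
        ∂stdComplexNormal) * (gaussianTilt p₁ s₁ c : ℂ) := fun c => by
    rw [← integral_mul_gaussianTilt p₂ s₂ fun b => F (c, b), ← integral_mul_const]
    refine integral_congr_ae (Eventually.of_forall fun b => ?_)
    simp only [pairTilt]
    push_cast
    ring
  simp_rw [e]
  rw [integral_mul_gaussianTilt p₁ s₁ fun c => (tiltMass p₂ s₂ : ℂ) * ∫ h, F (c,
    tiltMean p₂ s₂ + ((√(1 + s₂ ^ 2))⁻¹ : ℝ) * h) ∂stdComplexNormal, integral_const_mul, mul_assoc]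

theorem integral_pairTilt :
    ∫ q, pairTilt p₁ p₂ s₁ s₂ q ∂gaussianPair = tiltMass p₁ s₁ * tiltMass p₂ s₂ := by
  have := integral_mul_pairTilt p₁ p₂ s₁ s₂ (F := fun _ => 1) (integrable_const _)
  simpa using this

theorem integral_affine_mul_pairTilt (d α β : ℂ) :
    ∫ q : ℂ × ℂ, (d + α * q.1 + β * q.2) * pairTilt p₁ p₂ s₁ s₂ q ∂gaussianPair
      = (tiltMass p₁ s₁ * tiltMass p₂ s₂ : ℂ)
        * (d + α * tiltMean p₁ s₁ + β * tiltMean p₂ s₂) := by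
  rw [integral_mul_pairTilt _ _ _ _ (integrable_affine_gaussianPair d α β)]
  congr 1
  have e : ∀ g h : ℂ, d + α * (tiltMean p₁ s₁ + ((√(1 + s₁ ^ 2))⁻¹ : ℝ) * g)
      + β * (tiltMean p₂ s₂ + ((√(1 + s₂ ^ 2))⁻¹ : ℝ) * h)
      = (d + α * tiltMean p₁ s₁ + β * tiltMean p₂ s₂ + (α * ((√(1 + s₁ ^ 2))⁻¹ : ℝ)) * g)
        + (β * ((√(1 + s₂ ^ 2))⁻¹ : ℝ)) * h := fun g h => by ring
  simp_rw [e, integral_affine_stdComplexNormal]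

theorem integral_affine_mul_conj_mul_pairTilt (d α β : ℂ) :
    ∫ q : ℂ × ℂ, (d + α * q.1 + β * q.2) * conj (d + α * q.1 + β * q.2)
        * pairTilt p₁ p₂ s₁ s₂ q ∂gaussianPair
      = (tiltMass p₁ s₁ * tiltMass p₂ s₂ : ℂ)
        * ((‖d + α * tiltMean p₁ s₁ + β * tiltMean p₂ s₂‖ ^ 2 + ‖α‖ ^ 2 / (1 + s₁ ^ 2)
          + ‖β‖ ^ 2 / (1 + s₂ ^ 2) : ℝ) : ℂ) := by
  rw [integral_mul_pairTilt _ _ _ _ (integrable_affine_mul_conj_gaussianPair d α β)]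
  congr 1
  have e : ∀ g h : ℂ, d + α * (tiltMean p₁ s₁ + ((√(1 + s₁ ^ 2))⁻¹ : ℝ) * g)
      + β * (tiltMean p₂ s₂ + ((√(1 + s₂ ^ 2))⁻¹ : ℝ) * h)
      = (d + α * tiltMean p₁ s₁ + β * tiltMean p₂ s₂ + (α * ((√(1 + s₁ ^ 2))⁻¹ : ℝ)) * g)
        + (β * ((√(1 + s₂ ^ 2))⁻¹ : ℝ)) * h := fun g h => by ring
  simp_rw [e]
  generalize d + α * tiltMean p₁ s₁ + β * tiltMean p₂ s₂ = D
  have hn : ∀ (x : ℂ) (s : ℝ), x * ((√(1 + s ^ 2))⁻¹ : ℝ) * conj (x * ((√(1 + s ^ 2))⁻¹ : ℝ))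
      = ((‖x‖ ^ 2 / (1 + s ^ 2) : ℝ) : ℂ) := fun x s => by
    rw [Complex.mul_conj, Complex.normSq_eq_norm_sq, norm_mul, mul_pow, Complex.norm_real,
      Real.norm_eq_abs, sq_abs, inv_pow, Real.sq_sqrt (by positivity), div_eq_mul_inv]
  simp_rw [integral_affine_mul_conj_stdComplexNormal, hn]
  rw [integral_add (integrable_affine_mul_conj_stdComplexNormal _ _) (integrable_const _),
    integral_affine_mul_conj_stdComplexNormal, hn, Complex.mul_conj, Complex.normSq_eq_norm_sq]
  simp

end pairTilt

/-! ### The Gaussian average of the eigenpair kernel -/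

/-- Every matrix entry receives its own auxiliary Gaussian, although only those of row `0` are used,
as the vector `b`. For `y = s e₀` this makes the entries of `z - C + y b` functions of independent
pairs. -/
theorem measurePreserving_pairs (m : ℕ) : MeasurePreserving
    (fun ω : Fin (m + 1) → Fin (m + 1) → ℂ × ℂ =>
      ((fun i k => (ω i k).1, fun k => (ω 0 k).2) :
        (Fin (m + 1) → Fin (m + 1) → ℂ) × (Fin (m + 1) → ℂ)))
    (Measure.pi fun _ => Measure.pi fun _ => gaussianPair)
    ((ginibreLaw (m + 1)).prod (complexGaussian (Fin (m + 1)))) := by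
  have h1 := measurePreserving_arrowProdEquivProdArrow ℂ ℂ (Fin (m + 1))
    (fun _ => stdComplexNormal) (fun _ => stdComplexNormal)
  have h2 := measurePreserving_pi
    (fun _ : Fin (m + 1) => Measure.pi fun _ : Fin (m + 1) => gaussianPair)
    (fun _ => (complexGaussian (Fin (m + 1))).prod (complexGaussian (Fin (m + 1)))) fun _ => h1
  have h3 := measurePreserving_arrowProdEquivProdArrow (Fin (m + 1) → ℂ) (Fin (m + 1) → ℂ)
    (Fin (m + 1)) (fun _ => complexGaussian (Fin (m + 1)))
    (fun _ => complexGaussian (Fin (m + 1)))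
  have : SFinite (Measure.pi fun _ : Fin (m + 1) => complexGaussian (Fin (m + 1))) :=
    (inferInstance : SFinite (ginibreLaw (m + 1)))
  have h4 := (MeasurePreserving.id (ginibreLaw (m + 1))).prod
    (measurePreserving_eval (fun _ : Fin (m + 1) => complexGaussian (Fin (m + 1))) 0)
  exact (h4.comp h3).comp h2

section average

variable {m : ℕ} (a z : ℂ) (s : ℝ)

/-- Constant terms of the entries of `z - C + y b`, `y = s e₀`. -/
def entryShift (z : ℂ) (i k : Fin (m + 1)) : ℂ := if i = k then z else 0

/-- Coefficients of `b` in the entries of `z - C + y b`, `y = s e₀`. -/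
def entrySlope (s : ℝ) (i : Fin (m + 1)) : ℝ := if i = 0 then s else 0

/-- The tilts induced by the exponential factor of the kernel on the entries. -/
noncomputable def entryTilt (a z : ℂ) (s : ℝ) (i k : Fin (m + 1)) : ℂ × ℂ → ℂ :=
  pairTilt (if k = 0 then if i = 0 then s * z else 0 else 0)
    (if k = 0 then if i = 0 then z - a else 0 else 0) (if k = 0 then s else 0)
    (if k = 0 then if i = 0 then s else 0 else 0)

/-- The squared diagonal means of the matrix whose determinant is averaged. -/
noncomputable def diagonalSq (a z : ℂ) (s : ℝ) (i : Fin (m + 1)) : ℝ :=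
  if i = 0 then ‖z - (s ^ 2 / (1 + s ^ 2) : ℝ) * a‖ ^ 2 else ‖z‖ ^ 2

/-- For `y = s e₀` the product `(z - C) y` involves only column `0` of `C`, and `b ⬝ᵥ y` only `b 0`.
The other entries are untilted. -/
theorem prod_entryTilt (ω : Fin (m + 1) → Fin (m + 1) → ℂ × ℂ) :
    ∏ i, ∏ k, entryTilt a z s i k (ω i k)
      = (Real.exp (-(∑ i, ‖((Matrix.scalar (Fin (m + 1)) z - Matrix.of fun i k => (ω i k).1) *ᵥ
          Pi.single 0 (s : ℂ)) i‖ ^ 2)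
        - ‖z - a - (fun k => (ω 0 k).2) ⬝ᵥ Pi.single 0 (s : ℂ)‖ ^ 2) : ℝ) := by
  have h1 : ∀ i, ∏ k, entryTilt a z s i k (ω i k) = entryTilt a z s i 0 (ω i 0) := fun i => by
    rw [Fin.prod_univ_succ]
    simp [entryTilt, Fin.succ_ne_zero, pairTilt]
  simp_rw [h1]
  rw [Fin.prod_univ_succ, Fin.sum_univ_succ]
  simp only [entryTilt, if_true, Fin.succ_ne_zero, if_false, pairTilt, gaussianTilt_zero_zero,
    mul_one, Matrix.mulVec_single, dotProduct_single, Pi.smul_apply, Matrix.col_apply,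
    Matrix.sub_apply, Matrix.of_apply, Matrix.scalar_apply, Matrix.diagonal_apply]
  rw [← Complex.ofReal_prod, ← Complex.ofReal_mul]
  congr 1
  simp only [gaussianTilt, ← Real.exp_add, ← Real.exp_sum]
  congr 1
  simp only [Finset.sum_neg_distrib, MulOpposite.smul_eq_mul_unop, MulOpposite.unop_op, zero_sub,
    norm_neg, neg_mul]
  have e1 : (s : ℂ) * z - s * (ω 0 0).1 = (z - (ω 0 0).1) * s := by ring
  have e2 : (s : ℂ) * (ω 0 0).2 = (ω 0 0).2 * s := by ring
  have e3 : ∀ i : Fin m, (s : ℂ) * (ω i.succ 0).1 = (ω i.succ 0).1 * s := fun i => by ring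
  simp only [e1, e2, e3]
  ring

theorem matrix_of_entries (ω : Fin (m + 1) → Fin (m + 1) → ℂ × ℂ) :
    (Matrix.of fun i k => entryShift z i k + (-1) * (ω i k).1 + entrySlope s i * (ω i k).2)
      = Matrix.of fun i k => entryShift z i k + (-1) * (ω i k).1 + entrySlope s i * (ω 0 k).2 := by
  ext i k
  by_cases h : i = 0
  · subst h; rfl
  · simp [entrySlope, h]

theorem scalar_sub_add_vecMulVec_eq (ω : Fin (m + 1) → Fin (m + 1) → ℂ × ℂ) :
    Matrix.scalar (Fin (m + 1)) z - (Matrix.of fun i k => (ω i k).1)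
        + Matrix.vecMulVec (Pi.single 0 (s : ℂ)) (fun k => (ω 0 k).2)
      = Matrix.of fun i k => entryShift z i k + (-1) * (ω i k).1 + entrySlope s i * (ω i k).2 := by
  rw [matrix_of_entries]
  ext i k
  simp only [Matrix.add_apply, Matrix.sub_apply, Matrix.scalar_apply, Matrix.diagonal_apply,
    Matrix.of_apply, Matrix.vecMulVec_apply, Pi.single_apply, entryShift, entrySlope]
  split_ifs <;> push_cast <;> ring

theorem eigenpairKernel_single (ω : Fin (m + 1) → Fin (m + 1) → ℂ × ℂ) :
    ((eigenpairKernel a z (Pi.single 0 (s : ℂ)) (Matrix.of fun i k => (ω i k).1)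
        (fun k => (ω 0 k).2) : ℝ) : ℂ)
      = ((Real.pi⁻¹ ^ (m + 2) : ℝ) : ℂ) * ((Matrix.of fun i k =>
          entryShift z i k + (-1) * (ω i k).1 + entrySlope s i * (ω i k).2).det
        * conj (Matrix.of fun i k =>
          entryShift z i k + (-1) * (ω i k).1 + entrySlope s i * (ω i k).2).det
        * ∏ i, ∏ k, entryTilt a z s i k (ω i k)) := by
  rw [prod_entryTilt, Complex.mul_conj, Complex.normSq_eq_norm_sq, eigenpairKernel,
    scalar_sub_add_vecMulVec_eq, ← Complex.ofReal_mul, ← Complex.ofReal_mul]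
  congr 1
  ring

/-- The value of the Gaussian average of the eigenpair kernel at `y = s e₀`. -/
noncomputable def averagedKernel (m : ℕ) (a z : ℂ) (s : ℝ) : ℝ :=
  Real.pi⁻¹ ^ (m + 2) * ((1 + s ^ 2)⁻¹ ^ (m + 2)
    * Real.exp (-(s ^ 2 * ‖z‖ ^ 2 + ‖z - a‖ ^ 2) / (1 + s ^ 2))
    * ∑ σ : Equiv.Perm (Fin (m + 1)), ∏ i, (1 + if σ i = i then diagonalSq a z s i else 0))

theorem integrable_and_integral_eigenpairKernel_single :
    Integrable (fun ω : Fin (m + 1) → Fin (m + 1) → ℂ × ℂ =>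
      ((eigenpairKernel a z (Pi.single 0 (s : ℂ)) (Matrix.of fun i k => (ω i k).1)
        (fun k => (ω 0 k).2) : ℝ) : ℂ)) (Measure.pi fun _ => Measure.pi fun _ => gaussianPair) ∧
    ∫ ω : Fin (m + 1) → Fin (m + 1) → ℂ × ℂ,
      ((eigenpairKernel a z (Pi.single 0 (s : ℂ)) (Matrix.of fun i k => (ω i k).1)
        (fun k => (ω 0 k).2) : ℝ) : ℂ) ∂(Measure.pi fun _ => Measure.pi fun _ => gaussianPair)
      = (averagedKernel m a z s : ℂ) := by
  have hq : (0 : ℝ) < 1 + s ^ 2 := by positivity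
  set e : Fin (m + 1) → Fin (m + 1) → ℂ × ℂ → ℂ := fun i k q =>
    entryShift z i k + (-1) * q.1 + entrySlope s i * q.2 with he
  set w : Fin (m + 1) → Fin (m + 1) → ℂ × ℂ → ℂ := fun i k => entryTilt a z s i k with hw
  have h0 : ∀ i k, Integrable (w i k) gaussianPair := fun i k => by
    have := integrable_mul_pairTilt (if k = 0 then if i = 0 then s * z else 0 else 0)
      (if k = 0 then if i = 0 then z - a else 0 else 0) (if k = 0 then s else 0)
      (if k = 0 then if i = 0 then s else 0 else 0) (integrable_const (1 : ℂ))
    simp only [one_mul] at this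
    exact this
  have h1 : ∀ i k, Integrable (fun x => e i k x * w i k x) gaussianPair := fun i k =>
    integrable_mul_pairTilt _ _ _ _ (integrable_affine_gaussianPair _ _ _)
  have h1' : ∀ i k, Integrable (fun x => conj (e i k x) * w i k x) gaussianPair := fun i k =>
    integrable_mul_pairTilt _ _ _ _ (integrable_conj_affine_gaussianPair _ _ _)
  have h2 : ∀ i k, Integrable (fun x => e i k x * conj (e i k x) * w i k x) gaussianPair :=
    fun i k => integrable_mul_pairTilt _ _ _ _ (integrable_affine_mul_conj_gaussianPair _ _ _)
  have hz : ∀ i k, i ≠ k → ∫ x, e i k x * w i k x ∂gaussianPair = 0 := fun i k hik => by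
    simp only [he, hw, entryTilt]
    rw [integral_affine_mul_pairTilt]
    -- Tilts with nonzero centre occur only at the corner, which is diagonal; every other tilted
    -- entry keeps mean zero.
    have : ¬ (k = 0 ∧ i = 0) := fun h => hik (h.2.trans h.1.symm)
    by_cases hk : k = 0 <;> by_cases hi : i = 0 <;>
      simp_all [entryShift, tiltMean]
  have hz' : ∀ i k, i ≠ k → ∫ x, conj (e i k x) * w i k x ∂gaussianPair = 0 := fun i k hik => by
    have hc : ∀ x, conj (e i k x) * w i k x = conj (e i k x * w i k x) := fun x => by
      rw [map_mul]
      congr 1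
      simp only [hw, entryTilt, pairTilt, Complex.conj_ofReal]
    simp_rw [hc]
    rw [integral_conj, hz i k hik, map_zero]
  -- The entry `(i, k)` has tilted variance `r i / r k`: the term `s b k` raises row `0` to `1 +
  -- s²`, the tilt divides column `0` by the same factor, and the two effects cancel at the corner.
  -- Along a permutation the ratios multiply to `1`.
  set r : Fin (m + 1) → ℝ := fun i => if i = 0 then 1 + s ^ 2 else 1 with hr
  have hr0 : ∀ i, r i ≠ 0 := fun i => by simp only [hr]; split_ifs <;> positivity
  set M : Fin (m + 1) → Fin (m + 1) → ℂ := fun i k =>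
    if k = 0 then ((if i = 0 then tiltMass (s * z) s * tiltMass (z - a) s else (1 + s ^ 2)⁻¹ : ℝ) : ℂ)
      else 1 with hM
  have hmass : ∀ i k, ∫ x, w i k x ∂gaussianPair = M i k := fun i k => by
    simp only [hw, hM, entryTilt]
    rw [integral_pairTilt]
    by_cases hk : k = 0 <;> by_cases hi : i = 0 <;> simp [hk, hi, tiltMass]
  set V : Fin (m + 1) → Fin (m + 1) → ℂ := fun i k =>
    ((r i / r k * (1 + if k = i then diagonalSq a z s i else 0) : ℝ) : ℂ) with hVdef
  have hV : ∀ i k, ∫ x, e i k x * conj (e i k x) * w i k x ∂gaussianPair = M i k * V i k :=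
    fun i k => by
    rw [← hmass i k]
    simp only [hw, he, entryTilt]
    rw [integral_affine_mul_conj_mul_pairTilt, integral_pairTilt]
    congr 1
    simp only [hVdef]
    congr 1
    by_cases hk : k = 0
    · by_cases hi : i = 0
      · subst hk hi
        -- The two tilts shift the corner mean by `-s² z / (1 + s²)` and `s² (z - a) / (1 + s²)`;
        -- only the term in `a` survives.
        have : z + -1 * tiltMean (s * z) s + (s : ℂ) * tiltMean (z - a) s
            = z - (s ^ 2 / (1 + s ^ 2) : ℝ) * a := by
          simp only [tiltMean]; push_cast; ring
        simp only [entryShift, entrySlope, if_true, diagonalSq, this, hr]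
        rw [norm_neg, norm_one, Complex.norm_real, Real.norm_eq_abs, sq_abs]
        field_simp
        ring
      · have : k ≠ i := fun h => hi (h ▸ hk)
        subst hk
        simp [entryShift, entrySlope, hi, this, hr, tiltMean]
    · by_cases hi : i = 0
      · have : i ≠ k := fun h => hk (h ▸ hi)
        subst hi
        simp [entryShift, entrySlope, hk, this, hr, tiltMean]
      · by_cases hik : i = k
        · subst hik
          simp [entryShift, entrySlope, hi, hr, tiltMean, diagonalSq]
          ring
        · have : k ≠ i := fun h => hik h.symm
          simp [entryShift, entrySlope, hk, hi, hik, this, hr, tiltMean]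
  have hform : ∀ ω : Fin (m + 1) → Fin (m + 1) → ℂ × ℂ,
      ((eigenpairKernel a z (Pi.single 0 (s : ℂ)) (Matrix.of fun i k => (ω i k).1)
        (fun k => (ω 0 k).2) : ℝ) : ℂ) = ((Real.pi⁻¹ ^ (m + 2) : ℝ) : ℂ) *
          ((Matrix.of fun i k => e i k (ω i k)).det * conj (Matrix.of fun i k => e i k (ω i k)).det
            * ∏ i, ∏ k, w i k (ω i k)) := fun ω => eigenpairKernel_single a z s ω
  simp_rw [hform]
  refine ⟨(integrable_det_mul_conj_det h0 h1 h1' h2).const_mul _, ?_⟩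
  rw [integral_const_mul, integral_det_mul_conj_det h0 h1 h1' h2 hz hz' hmass hV]
  have hMprod : ∏ i, ∏ k, M i k = (((1 + s ^ 2)⁻¹ ^ (m + 2)
      * Real.exp (-(s ^ 2 * ‖z‖ ^ 2 + ‖z - a‖ ^ 2) / (1 + s ^ 2)) : ℝ) : ℂ) := by
    have : ∀ i, ∏ k, M i k = M i 0 := fun i => by
      rw [Fin.prod_univ_succ]; simp [hM, Fin.succ_ne_zero]
    simp_rw [this]
    rw [Fin.prod_univ_succ]
    simp only [hM, if_true, Fin.succ_ne_zero, if_false, Finset.prod_const, Finset.card_univ,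
      Fintype.card_fin]
    rw [← Complex.ofReal_pow, ← Complex.ofReal_mul]
    congr 1
    rw [tiltMass, tiltMass, norm_mul, mul_pow, Complex.norm_real, Real.norm_eq_abs, sq_abs,
      neg_add, add_div, Real.exp_add, pow_succ, pow_succ]
    simp only [div_eq_mul_inv]
    ring
  have hVprod : ∀ σ : Equiv.Perm (Fin (m + 1)), ∏ i, V i (σ i)
      = ((∏ i, (1 + if σ i = i then diagonalSq a z s i else 0) : ℝ) : ℂ) := fun σ => by
    simp only [hVdef]
    rw [← Complex.ofReal_prod]
    congr 1
    rw [Finset.prod_mul_distrib, Finset.prod_div_distrib, Equiv.prod_comp σ r,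
      div_self (Finset.prod_ne_zero_iff.2 fun i _ => hr0 i), one_mul]
  rw [hMprod, Finset.sum_congr rfl fun σ _ => hVprod σ, averagedKernel, ← Complex.ofReal_sum,
    ← Complex.ofReal_mul, ← Complex.ofReal_mul]

theorem lintegral_eigenpairKernel_single :
    ∫⁻ C, ∫⁻ b, ENNReal.ofReal (eigenpairKernel a z (Pi.single 0 (s : ℂ)) (Matrix.of C) b)
        ∂complexGaussian (Fin (m + 1)) ∂ginibreLaw (m + 1)
      = ENNReal.ofReal (averagedKernel m a z s) := by
  have hKm : Measurable fun q : (Fin (m + 1) → Fin (m + 1) → ℂ) × (Fin (m + 1) → ℂ) =>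
      ENNReal.ofReal (eigenpairKernel a z (Pi.single 0 (s : ℂ)) (Matrix.of q.1) q.2) :=
    ((continuous_eigenpairKernel a).comp (by fun_prop : Continuous
      fun q : (Fin (m + 1) → Fin (m + 1) → ℂ) × (Fin (m + 1) → ℂ) =>
        (z, (Pi.single 0 (s : ℂ) : Fin (m + 1) → ℂ), q.1, q.2))).measurable.ennreal_ofReal
  obtain ⟨hint, hval⟩ := integrable_and_integral_eigenpairKernel_single (m := m) a z s
  rw [integral_complex_ofReal] at hval
  rw [← Complex.ofReal_injective hval, ofReal_integral_eq_lintegral_ofReal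
    (by simpa using hint.re) (Eventually.of_forall fun ω => eigenpairKernel_nonneg _ _ _ _ _)]
  exact (lintegral_prod _ hKm.aemeasurable).symm.trans
    ((measurePreserving_pairs m).lintegral_comp hKm).symm

end average

/-! ### Permutations weighted by their fixed points -/

theorem card_perm_fixing {ι : Type*} [Fintype ι] [DecidableEq ι] (S : Finset ι) :
    (Finset.univ.filter fun σ : Equiv.Perm ι => ∀ i ∈ S, σ i = i).card =
      (Fintype.card ι - S.card).factorial := by
  have h := Fintype.card_congr (Equiv.Perm.subtypeEquivSubtypePerm (fun i => i ∉ S))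
  rw [Fintype.card_perm, Fintype.card_subtype_compl, Fintype.card_coe] at h
  rw [h, Fintype.card_subtype]
  simp

/-- Expand the product over subsets `S` of the fixed points and count the permutations fixing `S`
pointwise. -/
theorem sum_perm_prod_one_add {ι : Type*} [Fintype ι] [DecidableEq ι] (D : ι → ℝ) :
    ∑ σ : Equiv.Perm ι, ∏ i, (1 + if σ i = i then D i else 0) =
      ∑ S : Finset ι, (∏ i ∈ S, D i) * ((Fintype.card ι - S.card).factorial : ℝ) := by
  have h (σ : Equiv.Perm ι) : ∏ i, (1 + if σ i = i then D i else 0) =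
      ∑ S : Finset ι, if ∀ i ∈ S, σ i = i then ∏ i ∈ S, D i else 0 := by
    rw [Finset.prod_one_add, Finset.powerset_univ]
    refine Finset.sum_congr rfl fun S _ => ?_
    rw [Finset.prod_ite_zero]
    congr
  simp_rw [h]
  rw [Finset.sum_comm]
  refine Finset.sum_congr rfl fun S _ => ?_
  rw [← Finset.sum_filter, Finset.sum_const, card_perm_fixing, nsmul_eq_mul, mul_comm]

/-- The partial sum `∑_{j < n} u ^ j / j!` of the exponential series. -/
noncomputable def truncExp (n : ℕ) (u : ℝ) : ℝ := ∑ j ∈ Finset.range n, u ^ j / (j.factorial : ℝ)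

theorem truncExp_succ (n : ℕ) (u : ℝ) :
    truncExp (n + 1) u = truncExp n u + u ^ n / (n.factorial : ℝ) :=
  Finset.sum_range_succ _ _

theorem truncExp_nonneg (n : ℕ) {u : ℝ} (hu : 0 ≤ u) : 0 ≤ truncExp n u :=
  Finset.sum_nonneg fun _ _ => by positivity

theorem continuous_truncExp (n : ℕ) : Continuous (truncExp n) := by
  unfold truncExp; fun_prop

theorem sum_range_mul_pow_div_factorial (m : ℕ) (u : ℝ) :
    ∑ k ∈ Finset.range (m + 1), ((m : ℝ) + 1 - k) * (u ^ k / (k.factorial : ℝ)) =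
      (m + 1) * truncExp (m + 2) u - u * truncExp (m + 1) u := by
  have h1 : u * truncExp (m + 1) u =
      ∑ k ∈ Finset.range (m + 2), (k : ℝ) * (u ^ k / (k.factorial : ℝ)) := by
    rw [Finset.sum_range_succ' _ (m + 1), truncExp, Finset.mul_sum]
    simp only [Nat.cast_zero, zero_mul, add_zero]
    refine Finset.sum_congr rfl fun k _ => ?_
    rw [Nat.factorial_succ]
    push_cast
    field_simp
    ring
  rw [h1, truncExp, Finset.mul_sum, ← Finset.sum_sub_distrib, Finset.sum_range_succ _ (m + 1)]
  push_cast
  rw [sub_self, add_zero]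
  exact Finset.sum_congr rfl fun k _ => by ring

/-- The subsets are split by whether they contain `0`, the one index with a different weight. Those
of size `k` in the rest number `m.choose k`, and the factorials collapse to exponential
coefficients. -/
theorem sum_perm_prod_one_add_fin (m : ℕ) (δ u : ℝ) :
    ∑ σ : Equiv.Perm (Fin (m + 1)),
      ∏ i, (1 + if σ i = i then (if i = 0 then δ else u) else 0) =
      ((m + 1).factorial : ℝ) * truncExp (m + 2) u +
        (δ - u) * ((m.factorial : ℝ) * truncExp (m + 1) u) := by
  rw [sum_perm_prod_one_add (fun i : Fin (m + 1) => if i = 0 then δ else u), Fintype.card_fin,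
    ← Finset.powerset_univ, Fin.univ_succ, Finset.cons_eq_insert,
    Finset.sum_powerset_insert (by simp)]
  have hz (t : Finset (Fin (m + 1)))
      (ht : t ∈ (Finset.univ.map ⟨Fin.succ, Fin.succ_injective m⟩).powerset) : (0 : Fin (m + 1)) ∉ t := by
    intro h0
    have := Finset.mem_powerset.1 ht h0
    simp at this
  have h1 (t : Finset (Fin (m + 1)))
      (ht : t ∈ (Finset.univ.map ⟨Fin.succ, Fin.succ_injective m⟩).powerset) :
      ∏ i ∈ t, (if i = 0 then δ else u) = u ^ t.card := by
    rw [Finset.prod_congr rfl (g := fun _ => u), Finset.prod_const]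
    intro i hi
    rw [if_neg]
    rintro rfl
    exact hz t ht hi
  have hA := Finset.sum_powerset_apply_card (fun k => u ^ k * ((m + 1 - k).factorial : ℝ))
    (x := Finset.univ.map ⟨Fin.succ, Fin.succ_injective m⟩)
  have hB := Finset.sum_powerset_apply_card (fun k => δ * (u ^ k * ((m - k).factorial : ℝ)))
    (x := Finset.univ.map ⟨Fin.succ, Fin.succ_injective m⟩)
  have hB' := (Finset.sum_congr rfl fun t ht => by
    rw [Finset.prod_insert (hz t ht), h1 t ht, Finset.card_insert_of_notMem (hz t ht),
      Nat.add_sub_add_right, if_pos rfl, mul_assoc] :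
    ∑ t ∈ (Finset.univ.map ⟨Fin.succ, Fin.succ_injective m⟩).powerset,
      (∏ i ∈ insert (0 : Fin (m + 1)) t, if i = 0 then δ else u) *
        ((m + 1 - (insert 0 t).card).factorial : ℝ) =
    ∑ t ∈ (Finset.univ.map ⟨Fin.succ, Fin.succ_injective m⟩).powerset,
      δ * (u ^ t.card * ((m - t.card).factorial : ℝ))).trans hB
  rw [Finset.sum_congr rfl (g := fun t => u ^ t.card * ((m + 1 - t.card).factorial : ℝ))
    (fun t ht => by rw [h1 t ht]), hA, hB']
  simp only [Finset.card_map, Finset.card_univ, Fintype.card_fin, nsmul_eq_mul]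
  have hc (k : ℕ) (hk : k ∈ Finset.range (m + 1)) :
      (m.choose k : ℝ) * ((m - k).factorial : ℝ) = (m.factorial : ℝ) / (k.factorial : ℝ) := by
    have hk' : k ≤ m := Nat.lt_succ_iff.1 (Finset.mem_range.1 hk)
    rw [eq_div_iff (by positivity)]
    have := Nat.choose_mul_factorial_mul_factorial hk'
    rw [← this]
    push_cast
    ring
  have e1 : ∑ k ∈ Finset.range (m + 1), (m.choose k : ℝ) * (u ^ k * ((m + 1 - k).factorial : ℝ)) =
      (m.factorial : ℝ) * ((m + 1) * truncExp (m + 2) u - u * truncExp (m + 1) u) := by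
    rw [← sum_range_mul_pow_div_factorial, Finset.mul_sum]
    refine Finset.sum_congr rfl fun k hk => ?_
    have hk' : k ≤ m := Nat.lt_succ_iff.1 (Finset.mem_range.1 hk)
    have e : ((m + 1 - k).factorial : ℝ) = ((m : ℝ) + 1 - k) * ((m - k).factorial : ℝ) := by
      rw [Nat.succ_sub hk', Nat.factorial_succ]
      push_cast [Nat.cast_sub hk']
      ring
    calc _ = u ^ k * ((m : ℝ) + 1 - k) * ((m.choose k : ℝ) * ((m - k).factorial : ℝ)) := by
          rw [e]; ring
      _ = _ := by rw [hc k hk]; ring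
  have e2 : ∑ k ∈ Finset.range (m + 1), (m.choose k : ℝ) * (δ * (u ^ k * ((m - k).factorial : ℝ))) =
      δ * ((m.factorial : ℝ) * truncExp (m + 1) u) := by
    rw [truncExp, Finset.mul_sum, Finset.mul_sum]
    refine Finset.sum_congr rfl fun k hk => ?_
    calc _ = δ * u ^ k * ((m.choose k : ℝ) * ((m - k).factorial : ℝ)) := by ring
      _ = _ := by rw [hc k hk]; ring
  rw [e1, e2, Nat.factorial_succ]
  push_cast
  ring

/-! ### Radial integrals over `ℂⁿ` -/

theorem lintegral_fun_norm_addHaar {E : Type*} [NormedAddCommGroup E] [NormedSpace ℝ E]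
    [Nontrivial E] [FiniteDimensional ℝ E] [MeasurableSpace E] [BorelSpace E] (μ : Measure E)
    [μ.IsAddHaarMeasure] {f : ℝ → ℝ≥0∞} (hf : Measurable f) :
    ∫⁻ x, f ‖x‖ ∂μ = μ.toSphere Set.univ *
      ∫⁻ r in Set.Ioi (0 : ℝ), ENNReal.ofReal (r ^ (Module.finrank ℝ E - 1)) * f r := by
  calc ∫⁻ x, f ‖x‖ ∂μ = ∫⁻ x : ({(0)}ᶜ : Set E), f ‖x.1‖ ∂(μ.comap (↑)) := by
        rw [lintegral_subtype_comap (measurableSet_singleton _).compl fun x => f ‖x‖,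
          restrict_compl_singleton]
    _ = ∫⁻ x, f x.2 ∂μ.toSphere.prod (.volumeIoiPow (Module.finrank ℝ E - 1)) := by
        simpa using μ.measurePreserving_homeomorphUnitSphereProd.lintegral_comp_emb
          (Homeomorph.measurableEmbedding _) (f ∘ Subtype.val ∘ Prod.snd)
    _ = μ.toSphere Set.univ *
        ∫⁻ x : Set.Ioi (0 : ℝ), f x ∂.volumeIoiPow (Module.finrank ℝ E - 1) := by
        have := lintegral_prod_mul (μ := μ.toSphere)
          (ν := .volumeIoiPow (Module.finrank ℝ E - 1)) (f := 1)
          (g := fun x : Set.Ioi (0 : ℝ) => f x) (by fun_prop) (by fun_prop)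
        simpa using this
    _ = _ := by
        rw [Measure.volumeIoiPow, lintegral_withDensity_eq_lintegral_mul _ (by fun_prop)
          (by fun_prop)]
        exact congrArg _ (lintegral_subtype_comap measurableSet_Ioi
          fun r => ENNReal.ofReal (r ^ (Module.finrank ℝ E - 1)) * f r)

/-- Polar coordinates in the Euclidean norm. The constant stays unspecified here, so no sphere
volume has to be computed; `lintegral_radial` finds it by testing on a Gaussian. -/
theorem exists_lintegral_radial (m : ℕ) : ∃ c : ℝ≥0∞, ∀ f : ℝ → ℝ≥0∞, Measurable f →
    ∫⁻ y : Fin (m + 1) → ℂ, f √(∑ i, ‖y i‖ ^ 2) =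
      c * ∫⁻ s in Set.Ioi (0 : ℝ), ENNReal.ofReal (s ^ (2 * m + 1)) * f s := by
  let L := (PiLp.continuousLinearEquiv 2 ℝ fun _ : Fin (m + 1) => ℂ).symm
  have := L.isAddHaarMeasure_map volume
  have hd : Module.finrank ℝ (PiLp 2 fun _ : Fin (m + 1) => ℂ) - 1 = 2 * m + 1 := by
    rw [L.symm.toLinearEquiv.finrank_eq, finrank_real_of_complex]
    simp
    omega
  refine ⟨(Measure.map L volume).toSphere Set.univ, fun f hf => ?_⟩
  rw [← hd, ← lintegral_fun_norm_addHaar _ hf,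
    lintegral_map (f := fun x => f ‖x‖) (hf.comp measurable_norm) L.continuous.measurable]
  refine lintegral_congr fun y => ?_
  rw [EuclideanSpace.norm_eq]
  rfl

theorem lintegral_pow_mul_exp_neg_sq (m : ℕ) :
    ∫⁻ s in Set.Ioi (0 : ℝ), ENNReal.ofReal (s ^ (2 * m + 1)) * ENNReal.ofReal (Real.exp (-s ^ 2))
      = ENNReal.ofReal ((m.factorial : ℝ) / 2) := by
  have hq : (-1 : ℝ) < (2 * m + 1 : ℕ) := by
    have : (0 : ℝ) ≤ (2 * m + 1 : ℕ) := by positivity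
    linarith
  have h := integral_rpow_mul_exp_neg_rpow (p := (2 : ℕ)) (q := (2 * m + 1 : ℕ)) (by norm_num) hq
  have hi : IntegrableOn (fun s : ℝ => s ^ (2 * m + 1) * Real.exp (-s ^ 2)) (Set.Ioi 0) := by
    have := integrableOn_rpow_mul_exp_neg_rpow (p := (2 : ℕ)) (s := (2 * m + 1 : ℕ)) hq (by norm_num)
    simpa only [Real.rpow_natCast] using this
  simp only [Real.rpow_natCast] at h
  have e : ((2 * m + 1 : ℕ) + 1 : ℝ) / (2 : ℕ) = m + 1 := by push_cast; ring
  rw [e, Real.Gamma_nat_eq_factorial] at h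
  rw [show (m.factorial : ℝ) / 2 = 1 / (2 : ℕ) * m.factorial by push_cast; ring, ← h,
    ofReal_integral_eq_lintegral_ofReal hi]
  · refine setLIntegral_congr_fun measurableSet_Ioi fun s hs => ?_
    rw [ENNReal.ofReal_mul (pow_nonneg (le_of_lt hs) _)]
  · exact (ae_restrict_iff' measurableSet_Ioi).2 (Eventually.of_forall fun s hs =>
      mul_nonneg (pow_nonneg (le_of_lt hs) _) (Real.exp_nonneg _))

theorem lintegral_radial (m : ℕ) {f : ℝ → ℝ≥0∞} (hf : Measurable f) :
    ∫⁻ y : Fin (m + 1) → ℂ, f √(∑ i, ‖y i‖ ^ 2) =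
      ENNReal.ofReal (2 * Real.pi ^ (m + 1) / m.factorial) *
        ∫⁻ s in Set.Ioi (0 : ℝ), ENNReal.ofReal (s ^ (2 * m + 1)) * f s := by
  obtain ⟨c, hc⟩ := exists_lintegral_radial m
  have hpi := Real.pi_pos
  have h := hc (fun s => ENNReal.ofReal (Real.exp (-s ^ 2))) (by fun_prop)
  rw [lintegral_pow_mul_exp_neg_sq] at h
  have h1 : ∫⁻ y : Fin (m + 1) → ℂ, ENNReal.ofReal (Real.exp (-√(∑ i, ‖y i‖ ^ 2) ^ 2)) =
      ENNReal.ofReal (Real.pi ^ (m + 1)) := by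
    have h2 := lintegral_complexGaussian (ι := Fin (m + 1)) (f := fun _ => 1) measurable_const
    simp only [mul_one, lintegral_const, measure_univ, Fintype.card_fin] at h2
    have h3 : ∀ y : Fin (m + 1) → ℂ, ENNReal.ofReal (Real.exp (-√(∑ i, ‖y i‖ ^ 2) ^ 2)) =
        ENNReal.ofReal (Real.pi ^ (m + 1)) *
          ENNReal.ofReal (Real.pi⁻¹ ^ (m + 1) * Real.exp (-∑ i, ‖y i‖ ^ 2)) := fun y => by
      rw [← ENNReal.ofReal_mul (by positivity), Real.sq_sqrt (by positivity), inv_pow,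
        mul_inv_cancel_left₀ (by positivity)]
    rw [lintegral_congr h3, lintegral_const_mul' _ _ ENNReal.ofReal_ne_top, ← h2, mul_one]
  rw [h1] at h
  have hc' : c = ENNReal.ofReal (2 * Real.pi ^ (m + 1) / m.factorial) := by
    rw [show 2 * Real.pi ^ (m + 1) / m.factorial = Real.pi ^ (m + 1) / (m.factorial / 2) by
      field_simp, ENNReal.ofReal_div_of_pos (by positivity), h, ENNReal.mul_div_cancel_right]
    · simp [Nat.factorial_pos]
    · exact ENNReal.ofReal_ne_top
  rw [hc f hf, hc']

/-- The substitution `x = 1 / (1 + s²)`. -/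
theorem lintegral_comp_inv_one_add_sq (m : ℕ) (g : ℝ → ℝ≥0∞) :
    ∫⁻ s in Set.Ioi (0 : ℝ), ENNReal.ofReal (s ^ (2 * m + 1)) *
        (ENNReal.ofReal ((1 + s ^ 2)⁻¹ ^ (m + 2)) * g (1 + s ^ 2)⁻¹) =
      ENNReal.ofReal 2⁻¹ * ∫⁻ x in Set.Ioo (0 : ℝ) 1, ENNReal.ofReal ((1 - x) ^ m) * g x := by
  have himg : (fun s : ℝ => (1 + s ^ 2)⁻¹) '' Set.Ioi 0 = Set.Ioo 0 1 := by
    ext x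
    constructor
    · rintro ⟨s, hs, rfl⟩
      have hs : 0 < s := hs
      exact ⟨by positivity, inv_lt_one_of_one_lt₀ (by nlinarith [pow_pos hs 2])⟩
    · rintro ⟨h0, h1⟩
      have h2 : 1 < x⁻¹ := (one_lt_inv₀ h0).2 h1
      refine ⟨√(x⁻¹ - 1), Real.sqrt_pos.2 (by linarith), ?_⟩
      simp only
      rw [Real.sq_sqrt (by linarith), add_sub_cancel, inv_inv]
  have hinj : Set.InjOn (fun s : ℝ => (1 + s ^ 2)⁻¹) (Set.Ioi 0) := by
    intro s hs t ht h
    have h : s ^ 2 = t ^ 2 := by simpa using h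
    exact (pow_left_inj₀ (le_of_lt hs) (le_of_lt ht) two_ne_zero).1 h
  have hderiv : ∀ s ∈ Set.Ioi (0 : ℝ), HasDerivWithinAt (fun s : ℝ => (1 + s ^ 2)⁻¹)
      (-(2 * s) / (1 + s ^ 2) ^ 2) (Set.Ioi 0) s := fun s _ => by
    have h1 : HasDerivAt (fun s : ℝ => 1 + s ^ 2) (2 * s) s := by
      simpa using (hasDerivAt_pow 2 s).const_add 1
    exact (h1.fun_inv (by positivity)).hasDerivWithinAt
  rw [← himg, lintegral_image_eq_lintegral_abs_deriv_mul measurableSet_Ioi hderiv hinj,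
    ← lintegral_const_mul' _ _ ENNReal.ofReal_ne_top]
  refine setLIntegral_congr_fun measurableSet_Ioi fun s hs => ?_
  have hs : 0 < s := hs
  have h1 : 0 ≤ 1 - (1 + s ^ 2)⁻¹ := by
    have : (1 + s ^ 2)⁻¹ ≤ 1 := inv_le_one_of_one_le₀ (by nlinarith)
    linarith
  rw [← mul_assoc, ← mul_assoc, ← mul_assoc, ← ENNReal.ofReal_mul (by positivity),
    ← ENNReal.ofReal_mul (by positivity), ← ENNReal.ofReal_mul (by positivity)]
  congr 2
  rw [abs_div, abs_neg, abs_of_pos (by positivity : 0 < 2 * s),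
    abs_of_pos (by positivity : 0 < (1 + s ^ 2) ^ 2),
    show 1 - (1 + s ^ 2)⁻¹ = s ^ 2 * (1 + s ^ 2)⁻¹ by field_simp; ring, mul_pow, ← pow_mul,
    div_eq_mul_inv, ← inv_pow]
  ring

/-! ### Rotation to the first coordinate axis -/

/-- Extend the direction of `y` to an orthonormal basis whose zeroth vector it is. For `y = 0` any
unit vector serves. -/
theorem exists_unitary_mulVec_eq_single {m : ℕ} (y : Fin (m + 1) → ℂ) :
    ∃ U : Matrix (Fin (m + 1)) (Fin (m + 1)) ℂ, star U * U = 1 ∧ U * star U = 1 ∧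
      U *ᵥ y = Pi.single 0 ((√(∑ i, ‖y i‖ ^ 2) : ℝ) : ℂ) := by
  set Y : EuclideanSpace ℂ (Fin (m + 1)) := WithLp.toLp 2 y with hY
  have hYn : ‖Y‖ = √(∑ i, ‖y i‖ ^ 2) := EuclideanSpace.norm_eq Y
  obtain ⟨v, hv1, hv⟩ : ∃ v : EuclideanSpace ℂ (Fin (m + 1)), ‖v‖ = 1 ∧ Y = (‖Y‖ : ℂ) • v := by
    by_cases h0 : Y = 0
    · exact ⟨EuclideanSpace.single 0 1, by simp, by simp [h0]⟩
    · have hn : (‖Y‖ : ℂ) ≠ 0 := by simpa using h0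
      exact ⟨(‖Y‖ : ℂ)⁻¹ • Y, by simp [norm_smul, h0], by rw [smul_inv_smul₀ hn]⟩
  have hon : Orthonormal ℂ (({0} : Set (Fin (m + 1))).domRestrict fun _ => v) :=
    ⟨fun _ => hv1, fun i j hij => absurd (Subsingleton.elim i j) hij⟩
  obtain ⟨b, hb⟩ := hon.exists_orthonormalBasis_extension_of_card_eq (by simp)
  have hinner (x x' : EuclideanSpace ℂ (Fin (m + 1))) :
      ∑ k, star (x k) * x' k = inner ℂ x x' := by
    rw [PiLp.inner_apply]
    exact Finset.sum_congr rfl fun k _ => by rw [RCLike.inner_apply, mul_comm]; rfl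
  have hb0 : b 0 = v := hb 0 rfl
  set U : Matrix (Fin (m + 1)) (Fin (m + 1)) ℂ := Matrix.of fun i j => star (b i j) with hU
  have hUU : U * star U = 1 := by
    ext i j
    rw [Matrix.mul_apply, Matrix.one_apply]
    have := hinner (b i) (b j)
    rw [orthonormal_iff_ite.1 b.orthonormal i j] at this
    rw [← this]
    simp [hU, Matrix.star_apply]
  refine ⟨U, mul_eq_one_comm.1 hUU, hUU, ?_⟩
  ext i
  have : (U *ᵥ y) i = inner ℂ (b i) Y := hinner (b i) Y
  rw [this, hv, inner_smul_right, ← hb0, orthonormal_iff_ite.1 b.orthonormal i 0, hYn,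
    Pi.single_apply]
  split_ifs <;> simp

theorem eigenpairKernel_unitary {n : ℕ} {U : Matrix (Fin n) (Fin n) ℂ} (hU : star U * U = 1)
    (hU' : U * star U = 1) (a z : ℂ) (y : Fin n → ℂ) (C : Matrix (Fin n) (Fin n) ℂ)
    (b : Fin n → ℂ) :
    eigenpairKernel a z (U *ᵥ y) (U * C * star U) (b ᵥ* star U) = eigenpairKernel a z y C b := by
  have hs : Matrix.scalar (Fin n) z - U * C * star U =
      U * (Matrix.scalar (Fin n) z - C) * star U := by
    rw [mul_sub, sub_mul, ← (Matrix.scalar_commute z (fun _ => Commute.all _ _) U).eq,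
      mul_assoc (Matrix.scalar (Fin n) z), hU', mul_one]
  have h1 : (Matrix.scalar (Fin n) z - U * C * star U) *ᵥ (U *ᵥ y) =
      U *ᵥ ((Matrix.scalar (Fin n) z - C) *ᵥ y) := by
    rw [hs, Matrix.mulVec_mulVec, Matrix.mulVec_mulVec, mul_assoc, hU, mul_one]
  have h2 : (b ᵥ* star U) ⬝ᵥ (U *ᵥ y) = b ⬝ᵥ y := by
    rw [Matrix.dotProduct_mulVec, Matrix.vecMul_vecMul, hU, Matrix.vecMul_one]
  have h3 : Matrix.scalar (Fin n) z - U * C * star U + Matrix.vecMulVec (U *ᵥ y) (b ᵥ* star U) =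
      U * (Matrix.scalar (Fin n) z - C + Matrix.vecMulVec y b) * star U := by
    rw [hs, mul_add, add_mul, Matrix.mul_vecMulVec, Matrix.vecMulVec_mul]
  have h4 : (U * (Matrix.scalar (Fin n) z - C + Matrix.vecMulVec y b) * star U).det =
      (Matrix.scalar (Fin n) z - C + Matrix.vecMulVec y b).det := by
    rw [Matrix.det_mul_right_comm, hU', Matrix.one_mul]
  rw [eigenpairKernel, eigenpairKernel, h1, h2, h3, h4, sum_norm_sq_mulVec_of_unitary hU]

/-- The kernel is invariant when a unitary `U` acts on `y`, `C` and `b` together, and the laws of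
`C` and `b` are invariant as well, so `y` may be rotated to the first axis. -/
theorem lintegral_eigenpairKernel {m : ℕ} (a z : ℂ) (y : Fin (m + 1) → ℂ) :
    ∫⁻ C, ∫⁻ b, ENNReal.ofReal (eigenpairKernel a z y (Matrix.of C) b)
        ∂complexGaussian (Fin (m + 1)) ∂ginibreLaw (m + 1)
      = ENNReal.ofReal (averagedKernel m a z √(∑ i, ‖y i‖ ^ 2)) := by
  obtain ⟨U, hU, hU', hy⟩ := exists_unitary_mulVec_eq_single y
  have hm : Measurable fun q : (Fin (m + 1) → Fin (m + 1) → ℂ) × (Fin (m + 1) → ℂ) =>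
      ENNReal.ofReal (eigenpairKernel a z (U *ᵥ y) (Matrix.of q.1) q.2) :=
    ((continuous_eigenpairKernel a).comp (by fun_prop : Continuous
      fun q : (Fin (m + 1) → Fin (m + 1) → ℂ) × (Fin (m + 1) → ℂ) =>
        (z, U *ᵥ y, q.1, q.2))).measurable.ennreal_ofReal
  rw [← lintegral_eigenpairKernel_single, ← hy,
    ← (measurePreserving_conj hU).lintegral_comp hm.lintegral_prod_right']
  refine lintegral_congr fun C => ?_
  have h := (measurePreserving_vecMul (U := star U) (by rwa [star_star])).lintegral_comp
    (hm.comp (measurable_prodMk_left (x := fun i j => (U * Matrix.of C * star U) i j)))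
  refine Eq.trans (lintegral_congr fun b => ?_) h
  rw [← eigenpairKernel_unitary hU hU' a z y (Matrix.of C) b]
  rfl

theorem charpoly_conj {n : ℕ} {U : Matrix (Fin n) (Fin n) ℂ} (hU : star U * U = 1)
    (X : Matrix (Fin n) (Fin n) ℂ) : (U * X * star U).charpoly = X.charpoly := by
  rw [Matrix.charpoly_mul_comm, ← mul_assoc, hU, one_mul]

/-- Linear statistics of `G + a r r*` have the same law as those of `G + a e₀ e₀*`. -/
theorem exists_measurePreserving_rankOneNormal {n : ℕ} (a : ℂ) {r : Fin (n + 1) → ℂ}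
    (hr : star r ⬝ᵥ r = 1) :
    ∃ φ : (Fin (n + 1) → Fin (n + 1) → ℂ) → (Fin (n + 1) → Fin (n + 1) → ℂ),
      MeasurePreserving φ (ginibreLaw (n + 1)) (ginibreLaw (n + 1)) ∧
      ∀ (f : ℂ → ℝ) G, eigenvalueSum (Matrix.of (φ G) + borderedMatrix a 0 0 0) f =
        eigenvalueSum (Matrix.of G + rankOneNormal a r) f := by
  obtain ⟨U, hU, hU', hy⟩ := exists_unitary_mulVec_eq_single r
  rw [← sum_norm_sq_eq_dotProduct, ← Complex.ofReal_one, Complex.ofReal_inj] at hr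
  rw [hr, Real.sqrt_one, Complex.ofReal_one] at hy
  refine ⟨_, measurePreserving_conj hU, fun f G => ?_⟩
  have h : Matrix.of (fun i j => (U * Matrix.of G * star U) i j) + borderedMatrix a 0 0 0 =
      U * (Matrix.of G + rankOneNormal a r) * star U := by
    have h2 : borderedMatrix a 0 0 0 = U * rankOneNormal a r * star U := by
      have h3 : star r ᵥ* star U = star (U *ᵥ r) := by
        rw [Matrix.star_mulVec, Matrix.star_eq_conjTranspose]
      rw [rankOneNormal, Matrix.mul_smul, Matrix.smul_mul, Matrix.mul_vecMulVec,
        Matrix.vecMulVec_mul, h3, hy]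
      ext i j
      refine Fin.cases ?_ (fun i => ?_) i <;> refine Fin.cases ?_ (fun j => ?_) j <;>
        simp [borderedMatrix, Matrix.vecMulVec_apply]
    rw [h2, mul_add, add_mul]
    rfl
  rw [eigenvalueSum, eigenvalueSum, h, charpoly_conj hU]

/-! ### The mean eigenvalue density in closed form -/

theorem norm_sub_ofReal_mul_sq (a z : ℂ) (t : ℝ) :
    ‖z - (t : ℂ) * a‖ ^ 2 = ‖z‖ ^ 2 + t * (outlierDelta a z - (1 - t) * ‖a‖ ^ 2) := by
  rw [outlierDelta, Complex.sq_norm, Complex.sq_norm, Complex.sq_norm]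
  simp [Complex.normSq_apply]
  ring

theorem norm_sub_sq_eq_add_outlierDelta (a z : ℂ) : ‖z - a‖ ^ 2 = ‖z‖ ^ 2 + outlierDelta a z := by
  simpa using norm_sub_ofReal_mul_sq a z 1

theorem continuous_outlierDelta (a : ℂ) : Continuous (outlierDelta a) := by
  unfold outlierDelta; fun_prop

/-- The polynomial factor of the density integrand. -/
noncomputable def densityFactor (m : ℕ) (a z : ℂ) (x : ℝ) : ℝ :=
  (m + 1) * truncExp (m + 2) (‖z‖ ^ 2) +
    (1 - x) * (outlierDelta a z - ‖a‖ ^ 2 * x) * truncExp (m + 1) (‖z‖ ^ 2)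

theorem sum_perm_eq_densityFactor (m : ℕ) (a z : ℂ) (x : ℝ) :
    ∑ σ : Equiv.Perm (Fin (m + 1)), ∏ i, (1 + if σ i = i then
      (if i = 0 then ‖z - ((1 - x : ℝ) : ℂ) * a‖ ^ 2 else ‖z‖ ^ 2) else 0) =
      m.factorial * densityFactor m a z x := by
  rw [sum_perm_prod_one_add_fin, norm_sub_ofReal_mul_sq, densityFactor, Nat.factorial_succ]
  push_cast
  ring

/-- The sign is not visible in the formula; it comes from the sum over permutations. -/
theorem densityFactor_nonneg (m : ℕ) (a z : ℂ) (x : ℝ) : 0 ≤ densityFactor m a z x := by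
  refine nonneg_of_mul_nonneg_right (a := (m.factorial : ℝ)) ?_ (by positivity)
  rw [← sum_perm_eq_densityFactor]
  exact Finset.sum_nonneg fun σ _ => Finset.prod_nonneg fun i _ => by split_ifs <;> positivity

theorem averagedKernel_eq (m : ℕ) (a z : ℂ) (s : ℝ) :
    averagedKernel m a z s = (1 + s ^ 2)⁻¹ ^ (m + 2) * (Real.pi⁻¹ ^ (m + 2) *
      (Real.exp (-‖z‖ ^ 2 - outlierDelta a z * (1 + s ^ 2)⁻¹) *
        (m.factorial * densityFactor m a z (1 + s ^ 2)⁻¹))) := by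
  have hs : 1 + s ^ 2 ≠ 0 := by positivity
  have h1 : -(s ^ 2 * ‖z‖ ^ 2 + ‖z - a‖ ^ 2) / (1 + s ^ 2) =
      -‖z‖ ^ 2 - outlierDelta a z * (1 + s ^ 2)⁻¹ := by
    rw [norm_sub_sq_eq_add_outlierDelta]
    field_simp
    ring
  have h2 : s ^ 2 / (1 + s ^ 2) = 1 - (1 + s ^ 2)⁻¹ := by field_simp; ring
  rw [averagedKernel, h1, ← sum_perm_eq_densityFactor]
  simp only [diagonalSq, h2]
  ring

/-- The integrand of the closed form of the density of the `(m + 2) × (m + 2)` ensemble. -/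
noncomputable def densityIntegrand (m : ℕ) (a z : ℂ) (x : ℝ) : ℝ :=
  (1 - x) ^ m * (Real.exp (-(outlierDelta a z * x)) * densityFactor m a z x)

theorem continuous_densityIntegrand (m : ℕ) (a : ℂ) :
    Continuous fun q : ℂ × ℝ => densityIntegrand m a q.1 q.2 := by
  have h1 : Continuous fun q : ℂ × ℝ => outlierDelta a q.1 :=
    (continuous_outlierDelta a).comp continuous_fst
  have h2 (k : ℕ) : Continuous fun q : ℂ × ℝ => truncExp k (‖q.1‖ ^ 2) :=
    (continuous_truncExp k).comp (by fun_prop)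
  unfold densityIntegrand densityFactor
  fun_prop

/-- The mean eigenvalue density of `G₀ + a r r*`, `r` a unit vector. -/
noncomputable def meanDensity : ℕ → ℂ → ℂ → ℝ
  | 0, _, _ => 0
  | 1, a, z => Real.pi⁻¹ * Real.exp (-‖z - a‖ ^ 2)
  | m + 2, a, z => Real.pi⁻¹ * (Real.exp (-‖z‖ ^ 2) * ∫ x in (0 : ℝ)..1, densityIntegrand m a z x)

theorem continuous_meanDensity (N : ℕ) (a : ℂ) : Continuous (meanDensity N a) := by
  match N with
  | 0 => exact continuous_const
  | 1 => unfold meanDensity; fun_prop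
  | m + 2 =>
    unfold meanDensity
    have := intervalIntegral.continuous_parametric_intervalIntegral_of_continuous'
      (μ := volume) (f := densityIntegrand m a) (continuous_densityIntegrand m a) 0 1
    fun_prop

theorem meanDensity_nonneg (N : ℕ) (a z : ℂ) : 0 ≤ meanDensity N a z := by
  have := Real.pi_pos
  match N with
  | 0 => exact le_rfl
  | 1 => unfold meanDensity; positivity
  | m + 2 =>
    refine mul_nonneg (by positivity) (mul_nonneg (by positivity)
      (intervalIntegral.integral_nonneg zero_le_one fun x hx => ?_))
    exact mul_nonneg (pow_nonneg (by linarith [hx.2]) _)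
      (mul_nonneg (Real.exp_nonneg _) (densityFactor_nonneg _ _ _ _))

/-- Polar coordinates followed by `x = 1 / (1 + s²)`. The factor `(1 + s²)⁻¹ ^ (m + 2)` of the
kernel is the one this substitution absorbs, and the powers of `π` and `m!` cancel except for one
`π⁻¹`. -/
theorem lintegral_averagedKernel (m : ℕ) (a z : ℂ) :
    ∫⁻ y : Fin (m + 1) → ℂ, ENNReal.ofReal (averagedKernel m a z √(∑ i, ‖y i‖ ^ 2)) =
      ENNReal.ofReal (meanDensity (m + 2) a z) := by
  have hpi := Real.pi_pos
  set K : ℝ → ℝ := fun x => Real.pi⁻¹ ^ (m + 2) *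
      (Real.exp (-‖z‖ ^ 2 - outlierDelta a z * x) * (m.factorial * densityFactor m a z x)) with hK
  have hK0 : ∀ x, 0 ≤ K x := fun x => by
    have := densityFactor_nonneg m a z x
    positivity
  have hKc : Continuous K := by unfold K densityFactor; fun_prop
  have hav : ∀ s, ENNReal.ofReal (averagedKernel m a z s) =
      ENNReal.ofReal ((1 + s ^ 2)⁻¹ ^ (m + 2)) * ENNReal.ofReal (K (1 + s ^ 2)⁻¹) := fun s => by
    rw [averagedKernel_eq, ENNReal.ofReal_mul (by positivity)]
  have hm : Measurable fun s => ENNReal.ofReal (averagedKernel m a z s) := by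
    simp_rw [hav]
    have := hKc.measurable
    fun_prop
  rw [lintegral_radial m hm]
  simp_rw [hav]
  rw [lintegral_comp_inv_one_add_sq m fun x => ENNReal.ofReal (K x), meanDensity,
    intervalIntegral.integral_of_le zero_le_one, integral_Ioc_eq_integral_Ioo,
    ← mul_assoc, ← ENNReal.ofReal_mul (by positivity),
    ← mul_assoc, ENNReal.ofReal_mul (p := Real.pi⁻¹ * Real.exp (-‖z‖ ^ 2)) (by positivity),
    ofReal_integral_eq_lintegral_ofReal,
    ← lintegral_const_mul' _ _ ENNReal.ofReal_ne_top,
    ← lintegral_const_mul' _ _ ENNReal.ofReal_ne_top]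
  · refine setLIntegral_congr_fun measurableSet_Ioo fun x hx => ?_
    have hx1 : 0 ≤ 1 - x := by linarith [hx.2]
    rw [← ENNReal.ofReal_mul (by positivity), ← ENNReal.ofReal_mul (by positivity),
      ← ENNReal.ofReal_mul (by positivity), densityIntegrand]
    congr 1
    simp only [hK, inv_pow]
    rw [sub_eq_add_neg (-‖z‖ ^ 2), Real.exp_add]
    field_simp
    ring
  · have : Continuous (densityIntegrand m a z) :=
      (continuous_densityIntegrand m a).comp (by fun_prop : Continuous fun x : ℝ => (z, x))
    exact (this.integrableOn_Icc (a := 0) (b := 1)).mono_set Set.Ioo_subset_Icc_self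
  · refine (ae_restrict_iff' measurableSet_Ioo).2 (Eventually.of_forall fun x hx => ?_)
    exact mul_nonneg (pow_nonneg (by linarith [hx.2]) _)
      (mul_nonneg (Real.exp_nonneg _) (densityFactor_nonneg _ _ _ _))

theorem lintegral_eigenvalueSum_rankOneNormal {N : ℕ} (hN : 1 ≤ N) (a : ℂ) {r : Fin N → ℂ}
    (hr : star r ⬝ᵥ r = 1) {f : ℂ → ℝ} (hf : Continuous f) (hf0 : ∀ z, 0 ≤ f z) :
    ∫⁻ G, ENNReal.ofReal (eigenvalueSum (Matrix.of G + rankOneNormal a r) f) ∂ginibreLaw N =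
      ∫⁻ z, ENNReal.ofReal (f z * meanDensity N a z) := by
  obtain ⟨n, rfl⟩ : ∃ n, N = n + 1 := ⟨N - 1, by omega⟩
  obtain ⟨φ, hφ, hφ'⟩ := exists_measurePreserving_rankOneNormal a hr
  have hmeas : Measurable fun G : Fin (n + 1) → Fin (n + 1) → ℂ =>
      ENNReal.ofReal (eigenvalueSum (Matrix.of G + borderedMatrix a 0 0 0) f) := by
    have h1 : Continuous fun G : Fin (n + 1) → Fin (n + 1) → ℂ =>
      Matrix.of G + borderedMatrix a 0 0 0 := by
      refine continuous_matrix fun i j => ?_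
      simp only [Matrix.add_apply, Matrix.of_apply]
      fun_prop
    exact ((continuous_eigenvalueSum hf).comp h1).measurable.ennreal_ofReal
  simp_rw [← hφ']
  rw [hφ.lintegral_comp hmeas, lintegral_eigenvalueSum_eq a hf hf0]
  refine lintegral_congr fun z => ?_
  rw [ENNReal.ofReal_mul (hf0 z)]
  congr 1
  -- For `N = 1` there is no block and no `y`, and the kernel is already the Gaussian density.
  match n with
  | 0 => simp [eigenpairKernel, meanDensity, Matrix.det_isEmpty, volume_pi]
  | m + 1 => rw [lintegral_congr fun y => lintegral_eigenpairKernel a z y, lintegral_averagedKernel]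

/-! ### Existence and uniqueness -/

theorem integrable_and_integral_eigenvalueSum_of_nonneg {N : ℕ} (hN : 1 ≤ N) (a : ℂ)
    {r : Fin N → ℂ} (hr : star r ⬝ᵥ r = 1) {f : ℂ → ℝ} (hf : Continuous f)
    (hfc : HasCompactSupport f) (hf0 : ∀ z, 0 ≤ f z) :
    Integrable (fun G => eigenvalueSum (Matrix.of G + rankOneNormal a r) f) (ginibreLaw N) ∧
      ∫ G, eigenvalueSum (Matrix.of G + rankOneNormal a r) f ∂(ginibreLaw N) =
        ∫ z, f z * meanDensity N a z := by
  have h := lintegral_eigenvalueSum_rankOneNormal hN a hr hf hf0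
  have h1 : Continuous fun G : Fin N → Fin N → ℂ => Matrix.of G + rankOneNormal a r := by
    refine continuous_matrix fun i j => ?_
    simp only [Matrix.add_apply, Matrix.of_apply]
    fun_prop
  have h2 : Continuous fun G : Fin N → Fin N → ℂ =>
    eigenvalueSum (Matrix.of G + rankOneNormal a r) f := (continuous_eigenvalueSum hf).comp h1
  have h0 : 0 ≤ᵐ[ginibreLaw N] fun G => eigenvalueSum (Matrix.of G + rankOneNormal a r) f :=
    Eventually.of_forall fun G => eigenvalueSum_nonneg hf0 _
  have h3 : Integrable fun z => f z * meanDensity N a z :=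
    (hf.mul (continuous_meanDensity N a)).integrable_of_hasCompactSupport hfc.mul_right
  have h30 : 0 ≤ᵐ[volume] fun z => f z * meanDensity N a z :=
    Eventually.of_forall fun z => mul_nonneg (hf0 z) (meanDensity_nonneg N a z)
  constructor
  · refine ⟨h2.aestronglyMeasurable, ?_⟩
    rw [hasFiniteIntegral_iff_ofReal h0, h]
    exact (hasFiniteIntegral_iff_ofReal h30).1 h3.2
  · rw [integral_eq_lintegral_of_nonneg_ae h0 h2.aestronglyMeasurable, h,
      integral_eq_lintegral_of_nonneg_ae h30 h3.aestronglyMeasurable]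

theorem isMeanEigenvalueDensity_meanDensity {N : ℕ} (hN : 1 ≤ N) (a : ℂ) {r : Fin N → ℂ}
    (hr : star r ⬝ᵥ r = 1) : IsMeanEigenvalueDensity (rankOneNormal a r) (meanDensity N a) := by
  refine ⟨continuous_meanDensity N a, fun f hf hfc => ?_⟩
  have hp := integrable_and_integral_eigenvalueSum_of_nonneg hN a hr (f := fun z => max (f z) 0)
    (by fun_prop) (hfc.comp_left (g := fun t : ℝ => max t 0) (by simp)) fun z => le_max_right _ _
  have hm := integrable_and_integral_eigenvalueSum_of_nonneg hN a hr (f := fun z => max (-f z) 0)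
    (by fun_prop) (hfc.comp_left (g := fun t : ℝ => max (-t) 0) (by simp)) fun z => le_max_right _ _
  have hsub (t : ℝ) : t = max t 0 - max (-t) 0 := by
    rcases le_total t 0 with h | h <;> simp [h]
  have h1 (G : Fin N → Fin N → ℂ) : eigenvalueSum (Matrix.of G + rankOneNormal a r) f =
      eigenvalueSum (Matrix.of G + rankOneNormal a r) (fun z => max (f z) 0) -
        eigenvalueSum (Matrix.of G + rankOneNormal a r) (fun z => max (-f z) 0) := by
    rw [eigenvalueSum, eigenvalueSum, eigenvalueSum, ← Multiset.sum_map_sub]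
    exact congrArg _ (Multiset.map_congr rfl fun z _ => hsub (f z))
  have hi (g : ℂ → ℝ) (hg : Continuous g) (hgc : HasCompactSupport g) :
      Integrable fun z => g z * meanDensity N a z :=
    (hg.mul (continuous_meanDensity N a)).integrable_of_hasCompactSupport hgc.mul_right
  simp_rw [h1]
  refine ⟨hp.1.sub hm.1, ?_⟩
  rw [integral_sub hp.1 hm.1, hp.2, hm.2, ← integral_sub
    (hi (fun z => max (f z) 0) (by fun_prop) (hfc.comp_left (g := fun t : ℝ => max t 0) (by simp)))
    (hi (fun z => max (-f z) 0) (by fun_prop)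
      (hfc.comp_left (g := fun t : ℝ => max (-t) 0) (by simp)))]
  refine integral_congr_ae (Eventually.of_forall fun z => ?_)
  simp only
  rw [← sub_mul, ← hsub]

/-- Testing against smooth compactly supported functions determines the density almost everywhere,
and continuity then determines it everywhere. -/
theorem IsMeanEigenvalueDensity.unique {N : ℕ} {A : Matrix (Fin N) (Fin N) ℂ} {p q : ℂ → ℝ}
    (hp : IsMeanEigenvalueDensity A p) (hq : IsMeanEigenvalueDensity A q) : p = q := by
  refine (hp.1.ae_eq_iff_eq volume hq.1).1 (ae_eq_of_integral_contDiff_smul_eq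
    hp.1.locallyIntegrable hq.1.locallyIntegrable fun g hg hgc => ?_)
  simp only [smul_eq_mul]
  rw [← (hp.2 g hg.continuous hgc).2, ← (hq.2 g hg.continuous hgc).2]

/-! ### Partial sums of the exponential series -/

theorem mul_exp_one_sub_lt_one {U : ℝ} (hU : U ≠ 1) : U * Real.exp (1 - U) < 1 := by
  have h := Real.add_one_lt_exp (sub_ne_zero.2 hU)
  rw [sub_add_cancel] at h
  calc U * Real.exp (1 - U) < Real.exp (U - 1) * Real.exp (1 - U) :=
        mul_lt_mul_of_pos_right h (Real.exp_pos _)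
    _ = 1 := by rw [← Real.exp_add]; simp

theorem truncExp_le_exp (k : ℕ) {u : ℝ} (hu : 0 ≤ u) : truncExp k u ≤ Real.exp u :=
  Real.sum_le_exp_of_nonneg hu k

theorem truncExp_mono {u : ℝ} (hu : 0 ≤ u) : Monotone fun k => truncExp k u :=
  monotone_nat_of_le_succ fun k => by
    rw [truncExp_succ]
    exact le_add_of_nonneg_right (by positivity)

theorem tendsto_truncExp (u : ℝ) : Tendsto (fun k => truncExp k u) atTop (𝓝 (Real.exp u)) := by
  rw [Real.exp_eq_exp_ℝ]
  exact (NormedSpace.expSeries_div_hasSum_exp u).tendsto_sum_nat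

/-- Chernoff bound for the lower Poisson tail: `t ^ k ≤ t ^ j` for `j < k`, term by term. The next
lemma is its counterpart for the upper tail. -/
theorem pow_mul_truncExp_le {t u : ℝ} (ht : 0 ≤ t) (ht1 : t ≤ 1) (hu : 0 ≤ u) (k : ℕ) :
    t ^ k * truncExp k u ≤ Real.exp (t * u) := by
  refine le_trans ?_ (truncExp_le_exp k (mul_nonneg ht hu))
  rw [truncExp, truncExp, Finset.mul_sum]
  refine Finset.sum_le_sum fun j hj => ?_
  rw [mul_pow, mul_div_assoc]
  exact mul_le_mul_of_nonneg_right
    (pow_le_pow_of_le_one ht ht1 (Finset.mem_range.1 hj).le) (by positivity)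

theorem pow_mul_exp_sub_truncExp_le {t u : ℝ} (ht : 1 ≤ t) (hu : 0 ≤ u) (k : ℕ) :
    t ^ k * (Real.exp u - truncExp k u) ≤ Real.exp (t * u) := by
  have hlim : Tendsto (fun n => t ^ k * (truncExp n u - truncExp k u)) atTop
      (𝓝 (t ^ k * (Real.exp u - truncExp k u))) :=
    ((tendsto_truncExp u).sub_const _).const_mul _
  refine le_of_tendsto hlim ((eventually_ge_atTop k).mono fun n hn => ?_)
  refine le_trans ?_ (truncExp_le_exp n (by positivity : 0 ≤ t * u))
  rw [truncExp, truncExp, truncExp, ← Finset.sum_range_add_sum_Ico _ hn, add_sub_cancel_left,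
    ← Finset.sum_range_add_sum_Ico _ hn, Finset.mul_sum]
  refine le_trans (Finset.sum_le_sum fun j hj => ?_)
    (le_add_of_nonneg_left (Finset.sum_nonneg fun j _ => by positivity))
  rw [mul_pow, mul_div_assoc]
  exact mul_le_mul_of_nonneg_right (pow_le_pow_right₀ ht (Finset.mem_Ico.1 hj).1) (by positivity)

theorem tendsto_exp_neg_mul_truncExp_one {U : ℝ} (hU0 : 0 ≤ U) (hU1 : U < 1) :
    Tendsto (fun m : ℕ => Real.exp (-((m + 2) * U)) * truncExp (m + 1) ((m + 2) * U)) atTop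
      (𝓝 1) := by
  -- Chernoff parameter `V⁻¹`, with `V` strictly between `U` and `1`. Taking `U` itself would fail
  -- at `U = 0`. The error decays like a power of `V * exp (1 - V) < 1`.
  set V : ℝ := (1 + U) / 2 with hV
  have hV0 : 0 < V := by positivity
  have hV1 : V < 1 := by rw [hV]; linarith
  have hUV : U ≤ V := by rw [hV]; linarith
  have hq0 : 0 ≤ V * Real.exp (1 - V) := by positivity
  have hlim : Tendsto (fun m : ℕ => 1 - V⁻¹ * (V * Real.exp (1 - V)) ^ (m + 2)) atTop (𝓝 1) := by
    have := (tendsto_pow_atTop_nhds_zero_of_lt_one hq0 (mul_exp_one_sub_lt_one hV1.ne)).comp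
      (tendsto_add_atTop_nat 2)
    simpa using (this.const_mul V⁻¹).const_sub 1
  refine tendsto_of_tendsto_of_tendsto_of_le_of_le hlim tendsto_const_nhds (fun m => ?_) fun m => ?_
  · have hu : 0 ≤ ((m : ℝ) + 2) * U := by positivity
    have h := pow_mul_exp_sub_truncExp_le ((one_le_inv₀ hV0).2 hV1.le) hu (m + 1)
    have h2 : Real.exp (V⁻¹ * (((m : ℝ) + 2) * U)) ≤
        Real.exp (1 - V) ^ (m + 2) * Real.exp (((m : ℝ) + 2) * U) := by
      rw [← Real.exp_nat_mul, ← Real.exp_add, Real.exp_le_exp]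
      push_cast
      have h3 : U * (V⁻¹ - 1) ≤ V * (V⁻¹ - 1) :=
        mul_le_mul_of_nonneg_right hUV (by linarith [(one_le_inv₀ hV0).2 hV1.le])
      rw [mul_sub V, mul_inv_cancel₀ hV0.ne', mul_one] at h3
      have h4 : (0 : ℝ) ≤ (m : ℝ) + 2 := by positivity
      nlinarith [mul_le_mul_of_nonneg_left h3 h4]
    have h5 := mul_le_mul_of_nonneg_left (h.trans h2)
      (by positivity : 0 ≤ V ^ (m + 1) * Real.exp (-(((m : ℝ) + 2) * U)))
    have h6 : V ^ (m + 1) * V⁻¹ ^ (m + 1) = 1 := by rw [← mul_pow, mul_inv_cancel₀ hV0.ne', one_pow]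
    have h7 : Real.exp (-(((m : ℝ) + 2) * U)) * Real.exp (((m : ℝ) + 2) * U) = 1 := by
      rw [← Real.exp_add]; simp
    have h8 : V⁻¹ * (V * Real.exp (1 - V)) ^ (m + 2) = V ^ (m + 1) * Real.exp (1 - V) ^ (m + 2) := by
      rw [mul_pow, ← mul_assoc, pow_succ V (m + 1)]
      field_simp
    simp only
    rw [h8]
    have e1 : V ^ (m + 1) * Real.exp (-(((m : ℝ) + 2) * U)) * (V⁻¹ ^ (m + 1) *
        (Real.exp (((m : ℝ) + 2) * U) - truncExp (m + 1) (((m : ℝ) + 2) * U))) =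
        (V ^ (m + 1) * V⁻¹ ^ (m + 1)) * (Real.exp (-(((m : ℝ) + 2) * U)) *
          Real.exp (((m : ℝ) + 2) * U) - Real.exp (-(((m : ℝ) + 2) * U)) *
          truncExp (m + 1) (((m : ℝ) + 2) * U)) := by ring
    have e2 : V ^ (m + 1) * Real.exp (-(((m : ℝ) + 2) * U)) * (Real.exp (1 - V) ^ (m + 2) *
        Real.exp (((m : ℝ) + 2) * U)) = V ^ (m + 1) * Real.exp (1 - V) ^ (m + 2) *
        (Real.exp (-(((m : ℝ) + 2) * U)) * Real.exp (((m : ℝ) + 2) * U)) := by ring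
    rw [e1, e2, h6, h7] at h5
    linarith
  · have hu : 0 ≤ ((m : ℝ) + 2) * U := by positivity
    have := mul_le_mul_of_nonneg_left (truncExp_le_exp (m + 1) hu)
      (Real.exp_nonneg (-(((m : ℝ) + 2) * U)))
    rwa [← Real.exp_add, neg_add_cancel, Real.exp_zero] at this

/-- Lower tail of a Poisson law of mean `(m + 2) δ`, by the Chernoff bound with `t = δ⁻¹`. The
length `m + 3` is the longest truncation needed; shorter ones follow by monotonicity. -/
theorem tendsto_exp_neg_mul_truncExp_zero {δ : ℝ} (hδ : 1 < δ) :
    Tendsto (fun m : ℕ => Real.exp (-((m + 2) * δ)) * truncExp (m + 3) ((m + 2) * δ)) atTop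
      (𝓝 0) := by
  have hδ0 : 0 < δ := one_pos.trans hδ
  have hlim : Tendsto (fun m : ℕ => δ * (δ * Real.exp (1 - δ)) ^ (m + 2)) atTop (𝓝 0) := by
    have := (tendsto_pow_atTop_nhds_zero_of_lt_one (by positivity)
      (mul_exp_one_sub_lt_one hδ.ne')).comp (tendsto_add_atTop_nat 2)
    simpa using this.const_mul δ
  refine squeeze_zero (fun m => mul_nonneg (Real.exp_nonneg _) (truncExp_nonneg _ (by positivity)))
    (fun m => ?_) hlim
  have hu : 0 ≤ ((m : ℝ) + 2) * δ := by positivity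
  have h := pow_mul_truncExp_le (inv_nonneg.2 hδ0.le) (inv_le_one_of_one_le₀ hδ.le) hu (m + 3)
  have h1 : δ⁻¹ * (((m : ℝ) + 2) * δ) = m + 2 := by field_simp
  have h2 : Real.exp (-(((m : ℝ) + 2) * δ)) * Real.exp (m + 2) = Real.exp (1 - δ) ^ (m + 2) := by
    rw [← Real.exp_nat_mul, ← Real.exp_add]
    push_cast
    ring_nf
  have h3 : δ ^ (m + 3) * δ⁻¹ ^ (m + 3) = 1 := by rw [← mul_pow, mul_inv_cancel₀ hδ0.ne', one_pow]
  have h4 := mul_le_mul_of_nonneg_left h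
    (by positivity : 0 ≤ δ ^ (m + 3) * Real.exp (-(((m : ℝ) + 2) * δ)))
  calc _ = δ ^ (m + 3) * Real.exp (-(((m : ℝ) + 2) * δ)) *
        (δ⁻¹ ^ (m + 3) * truncExp (m + 3) (((m : ℝ) + 2) * δ)) := by
        linear_combination (-(Real.exp (-(((m : ℝ) + 2) * δ)) *
          truncExp (m + 3) (((m : ℝ) + 2) * δ))) * h3
    _ ≤ _ := h4
    _ = _ := by
        rw [h1, mul_assoc, h2, mul_pow]
        ring

/-- Divide by the first omitted term and sum backwards from the largest index. Writing the result as
an infinite series costs nothing, since the descending factorials vanish, and prepares for dominated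
convergence. -/
theorem truncExp_mul_factorial_div_pow {u : ℝ} (hu : u ≠ 0) (m : ℕ) :
    truncExp (m + 1) u * ((m + 1).factorial / u ^ (m + 1)) =
      ∑' i : ℕ, ((m + 1).descFactorial (i + 1) : ℝ) / u ^ (i + 1) := by
  rw [tsum_eq_sum (s := Finset.range (m + 1)) fun i hi => by
      rw [Nat.descFactorial_of_lt (by simpa using hi)]; simp,
    truncExp, Finset.sum_mul, ← Finset.sum_range_reflect]
  refine Finset.sum_congr rfl fun i hi => ?_
  have hi' : i ≤ m := Nat.lt_succ_iff.1 (Finset.mem_range.1 hi)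
  obtain ⟨j, rfl⟩ := Nat.exists_eq_add_of_le' hi'
  have h : (j + i + 1 - 1 - i) = j := by omega
  have h2 := Nat.factorial_mul_descFactorial (n := j + i + 1) (k := i + 1) (by omega)
  have h3 : j + i + 1 - (i + 1) = j := by omega
  rw [h3] at h2
  rw [h, ← h2]
  push_cast
  have : (j.factorial : ℝ) ≠ 0 := by positivity
  field_simp
  ring

theorem tendsto_inv_natCast_add_two : Tendsto (fun m : ℕ => ((m : ℝ) + 2)⁻¹) atTop (𝓝 0) :=
  tendsto_inv_atTop_zero.comp (tendsto_atTop_add_const_right _ _ tendsto_natCast_atTop_atTop)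

theorem tendsto_add_one_div_add_two :
    Tendsto (fun m : ℕ => ((m : ℝ) + 1) / (m + 2)) atTop (𝓝 1) := by
  have h2 := tendsto_inv_natCast_add_two.const_sub 1
  rw [sub_zero] at h2
  refine h2.congr fun m => ?_
  field_simp
  ring

theorem tendsto_descFactorial_div_pow {U : ℝ} (hU : 0 < U) (k : ℕ) :
    Tendsto (fun m : ℕ => ((m + 1).descFactorial k : ℝ) / ((m + 2) * U) ^ k) atTop
      (𝓝 (U⁻¹ ^ k)) := by
  have h1 := (isEquivalent_iff_tendsto_one ((eventually_gt_atTop 0).mono fun n hn => by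
    have : (0 : ℝ) < n := by exact_mod_cast hn
    positivity)).1 (isEquivalent_descFactorial k)
  have h2 := (h1.comp (tendsto_add_atTop_nat 1)).mul
    ((tendsto_add_one_div_add_two.pow k).mul_const (U⁻¹ ^ k))
  simp only [one_pow, one_mul] at h2
  refine h2.congr fun m => ?_
  simp only [Function.comp_apply, Pi.div_apply]
  push_cast
  rw [div_pow, inv_pow, mul_pow]
  field_simp

/-- Termwise the series tends to the geometric series in `U⁻¹`, which also dominates it. -/
theorem tendsto_truncExp_mul_factorial_div_pow {U : ℝ} (hU : 1 < U) :
    Tendsto (fun m : ℕ => truncExp (m + 1) ((m + 2) * U) *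
      ((m + 1).factorial / ((m + 2) * U) ^ (m + 1))) atTop (𝓝 (U - 1)⁻¹) := by
  have hU0 : 0 < U := one_pos.trans hU
  have hU1 : U⁻¹ < 1 := inv_lt_one_of_one_lt₀ hU
  have hs : Summable fun i : ℕ => U⁻¹ ^ (i + 1) :=
    (summable_nat_add_iff 1).2 (summable_geometric_of_lt_one (by positivity) hU1)
  have hsum : ∑' i : ℕ, U⁻¹ ^ (i + 1) = (U - 1)⁻¹ := by
    simp_rw [pow_succ]
    rw [tsum_mul_right, tsum_geometric_of_lt_one (by positivity) hU1]
    have : U - 1 ≠ 0 := by linarith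
    have : 1 - U⁻¹ ≠ 0 := by linarith
    field_simp
  rw [← hsum]
  have := tendsto_tsum_of_dominated_convergence hs
    (fun i => tendsto_descFactorial_div_pow hU0 (i + 1)) (Eventually.of_forall fun m i => by
      rw [Real.norm_of_nonneg (by positivity), div_le_iff₀ (by positivity), mul_pow,
        mul_comm, mul_assoc, ← mul_pow, mul_inv_cancel₀ hU0.ne', one_pow, mul_one]
      calc ((m + 1).descFactorial (i + 1) : ℝ) ≤ ((m + 1 : ℕ) : ℝ) ^ (i + 1) := by
            exact_mod_cast Nat.descFactorial_le_pow _ _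
        _ ≤ _ := by gcongr; push_cast; linarith)
  refine this.congr fun m => ?_
  rw [truncExp_mul_factorial_div_pow (by positivity)]

/-! ### Exponential moments of `(1 - x) ^ k` -/

/-- The integral of `(1 - x) ^ k * exp (l * x)` over the unit interval. -/
noncomputable def expMoment (k : ℕ) (l : ℝ) : ℝ :=
  ∫ x in (0 : ℝ)..1, (1 - x) ^ k * Real.exp (l * x)

theorem expMoment_nonneg (k : ℕ) (l : ℝ) : 0 ≤ expMoment k l :=
  intervalIntegral.integral_nonneg zero_le_one fun x hx =>
    mul_nonneg (pow_nonneg (by linarith [hx.2]) _) (Real.exp_nonneg _)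

theorem expMoment_sub_succ (k : ℕ) (l : ℝ) : expMoment k l - expMoment (k + 1) l =
    ∫ x in (0 : ℝ)..1, x * ((1 - x) ^ k * Real.exp (l * x)) := by
  rw [expMoment, expMoment, ← intervalIntegral.integral_sub
    (Continuous.intervalIntegrable (by fun_prop) _ _)
    (Continuous.intervalIntegrable (by fun_prop) _ _)]
  exact intervalIntegral.integral_congr fun x _ => by ring

theorem expMoment_succ_le (k : ℕ) (l : ℝ) : expMoment (k + 1) l ≤ expMoment k l := by
  rw [← sub_nonneg, expMoment_sub_succ]
  exact intervalIntegral.integral_nonneg zero_le_one fun x hx =>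
    mul_nonneg hx.1 (mul_nonneg (pow_nonneg (by linarith [hx.2]) _) (Real.exp_nonneg _))

theorem expMoment_sub_succ_succ_le (k : ℕ) (l : ℝ) :
    expMoment (k + 1) l - expMoment (k + 2) l ≤ expMoment k l - expMoment (k + 1) l := by
  rw [expMoment_sub_succ, expMoment_sub_succ]
  refine intervalIntegral.integral_mono_on zero_le_one
    (Continuous.intervalIntegrable (by fun_prop) _ _)
    (Continuous.intervalIntegrable (by fun_prop) _ _) fun x hx => ?_
  have h1 : 0 ≤ 1 - x := by linarith [hx.2]
  have h2 : (1 - x) ^ (k + 1) ≤ (1 - x) ^ k :=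
    pow_le_pow_of_le_one h1 (by linarith [hx.1]) (Nat.le_succ k)
  have := hx.1
  gcongr

/-- Integrate the derivative of `(1 - x) ^ (k + 1) * exp (l * x)` over the unit interval. -/
theorem mul_expMoment_succ (k : ℕ) (l : ℝ) :
    l * expMoment (k + 1) l = (k + 1) * expMoment k l - 1 := by
  have hderiv : ∀ x ∈ Set.uIcc (0 : ℝ) 1, HasDerivAt
      (fun x : ℝ => (1 - x) ^ (k + 1) * Real.exp (l * x))
      (l * ((1 - x) ^ (k + 1) * Real.exp (l * x)) -
        (k + 1) * ((1 - x) ^ k * Real.exp (l * x))) x := fun x _ => by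
    have h1 : HasDerivAt (fun x : ℝ => (1 - x) ^ (k + 1)) (((k + 1 : ℕ) : ℝ) * (1 - x) ^ k * -1) x := by
      simpa using ((hasDerivAt_id x).const_sub 1).fun_pow (k + 1)
    have h2 : HasDerivAt (fun x : ℝ => Real.exp (l * x)) (Real.exp (l * x) * (l * 1)) x :=
      ((hasDerivAt_id' x).const_mul l).exp
    have h3 := h1.fun_mul h2
    push_cast at h3
    refine h3.congr_deriv ?_
    ring
  have h := intervalIntegral.integral_eq_sub_of_hasDerivAt hderiv
    (Continuous.intervalIntegrable (by fun_prop) _ _)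
  rw [intervalIntegral.integral_sub (Continuous.intervalIntegrable (by fun_prop) _ _)
    (Continuous.intervalIntegrable (by fun_prop) _ _), intervalIntegral.integral_const_mul,
    intervalIntegral.integral_const_mul] at h
  simp at h
  rw [expMoment, expMoment]
  linarith

theorem pow_mul_expMoment (k : ℕ) (l : ℝ) :
    l ^ (k + 1) * expMoment k l = k.factorial * (Real.exp l - truncExp (k + 1) l) := by
  induction k with
  | zero =>
    simp [expMoment, truncExp]
  | succ k ih =>
    rw [pow_succ, mul_assoc, mul_expMoment_succ, mul_sub, mul_left_comm, ih, truncExp_succ (k + 1),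
      Nat.factorial_succ]
    push_cast
    field_simp
    ring

/-- The integral is a combination of three consecutive moments. The recursion `(m + 1) J m + Δ J (m
+ 1) = 1` removes the leading ones and leaves terms of controlled size. -/
theorem integral_densityIntegrand (m : ℕ) (a z : ℂ) :
    ∫ x in (0 : ℝ)..1, densityIntegrand m a z x =
      truncExp (m + 1) (‖z‖ ^ 2) +
        (‖z‖ ^ 2) ^ (m + 1) / m.factorial * expMoment m (-outlierDelta a z) -
        ‖a‖ ^ 2 * truncExp (m + 1) (‖z‖ ^ 2) *
          (expMoment (m + 1) (-outlierDelta a z) - expMoment (m + 2) (-outlierDelta a z)) := by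
  set D := outlierDelta a z with hD
  set u := ‖z‖ ^ 2 with hu
  have h1 : ∫ x in (0 : ℝ)..1, densityIntegrand m a z x =
      (m + 1) * truncExp (m + 2) u * expMoment m (-D) +
        (D - ‖a‖ ^ 2) * truncExp (m + 1) u * expMoment (m + 1) (-D) +
        ‖a‖ ^ 2 * truncExp (m + 1) u * expMoment (m + 2) (-D) := by
    rw [expMoment, expMoment, expMoment, ← intervalIntegral.integral_const_mul,
      ← intervalIntegral.integral_const_mul, ← intervalIntegral.integral_const_mul,
      ← intervalIntegral.integral_add (Continuous.intervalIntegrable (by fun_prop) _ _)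
        (Continuous.intervalIntegrable (by fun_prop) _ _),
      ← intervalIntegral.integral_add (Continuous.intervalIntegrable (by fun_prop) _ _)
        (Continuous.intervalIntegrable (by fun_prop) _ _)]
    refine intervalIntegral.integral_congr fun x _ => ?_
    simp only [densityIntegrand, densityFactor, ← hD, ← hu, neg_mul]
    ring
  have h2 := mul_expMoment_succ m (-D)
  have h3 : ((m : ℝ) + 1) * truncExp (m + 2) u =
      (m + 1) * truncExp (m + 1) u + u ^ (m + 1) / m.factorial := by
    rw [truncExp_succ (m + 1), Nat.factorial_succ]
    push_cast
    field_simp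
  rw [h1, h3]
  linear_combination -truncExp (m + 1) u * h2

/-- Bound the recursion by `(k + 1) J k = 1 + l J (k + 1) ≤ 1 + L J k`, using that the moments
decrease in `k`. -/
theorem expMoment_le {k : ℕ} {l L : ℝ} (hl : l ≤ L) (hL0 : 0 ≤ L) (hL : L < k + 1) :
    expMoment k l ≤ 1 / (k + 1 - L) := by
  rw [le_div_iff₀ (by linarith)]
  have h1 := mul_expMoment_succ k l
  have h2 := mul_le_mul_of_nonneg_right hl (expMoment_nonneg (k + 1) l)
  have h3 := mul_le_mul_of_nonneg_left (expMoment_succ_le k l) hL0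
  linarith

/-- The same argument for differences: subtracting consecutive recursions gives `(k + 1) (J k - J (k
+ 1)) = J (k + 1) + l (J (k + 1) - J (k + 2))`, and the differences also decrease. -/
theorem expMoment_sub_succ_le {k : ℕ} {l L : ℝ} (hl : l ≤ L) (hL0 : 0 ≤ L) (hL : L < k + 1) :
    expMoment k l - expMoment (k + 1) l ≤ (1 / (k + 1 - L)) ^ 2 := by
  have h0 : 0 < k + 1 - L := by linarith
  have h1 := mul_expMoment_succ k l
  have h1' := mul_expMoment_succ (k + 1) l
  have h2 := mul_le_mul_of_nonneg_right hl (sub_nonneg.2 (expMoment_succ_le (k + 1) l))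
  have h3 := mul_le_mul_of_nonneg_left (expMoment_sub_succ_succ_le k l) hL0
  have h4 := expMoment_le hl hL0 hL
  have h5 := expMoment_succ_le k l
  push_cast at h1'
  rw [sq, ← div_eq_mul_one_div, le_div_iff₀ h0]
  linarith

/-! ### Asymptotics of the density -/

/-- `π` times the density of the `(m + 2) × (m + 2)` ensemble in macroscopic coordinates. -/
noncomputable def scaledDensity (U d A : ℝ) (m : ℕ) : ℝ :=
  Real.exp (-((m + 2) * U)) * (truncExp (m + 1) ((m + 2) * U) +
    ((m + 2) * U) ^ (m + 1) / m.factorial * expMoment m ((m + 2) * -d) -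
    (m + 2) * A * truncExp (m + 1) ((m + 2) * U) *
      (expMoment (m + 1) ((m + 2) * -d) - expMoment (m + 2) ((m + 2) * -d)))

theorem outlierDelta_mul_mul (s : ℝ) (α w : ℂ) :
    outlierDelta ((s : ℂ) * α) ((s : ℂ) * w) = s ^ 2 * outlierDelta α w := by
  rw [outlierDelta, outlierDelta, Complex.sq_norm, Complex.sq_norm]
  simp [Complex.normSq_apply]
  ring

theorem meanDensity_sqrt_mul (m : ℕ) (α w : ℂ) :
    meanDensity (m + 2) ((√((m + 2 : ℕ) : ℝ) : ℂ) * α) ((√((m + 2 : ℕ) : ℝ) : ℂ) * w) =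
      1 / Real.pi * scaledDensity (‖w‖ ^ 2) (outlierDelta α w) (‖α‖ ^ 2) m := by
  have hs : √((m + 2 : ℕ) : ℝ) ^ 2 = m + 2 := by rw [Real.sq_sqrt (by positivity)]; push_cast; rfl
  have hn (v : ℂ) : ‖(√((m + 2 : ℕ) : ℝ) : ℂ) * v‖ ^ 2 = (m + 2) * ‖v‖ ^ 2 := by
    rw [norm_mul, mul_pow, Complex.norm_real, Real.norm_of_nonneg (Real.sqrt_nonneg _), hs]
  rw [meanDensity, integral_densityIntegrand, hn, hn, outlierDelta_mul_mul, hs, scaledDensity,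
    one_div]
  simp only [mul_neg]

theorem exp_neg_mul_pow_div_factorial (k : ℕ) (u : ℝ) :
    Real.exp (-u) * (u ^ k / k.factorial) =
      Real.exp (-u) * truncExp (k + 1) u - Real.exp (-u) * truncExp k u := by
  rw [truncExp_succ]; ring

theorem exp_neg_mul_truncExp_le_one (k : ℕ) {u : ℝ} (hu : 0 ≤ u) :
    Real.exp (-u) * truncExp k u ≤ 1 := by
  calc _ ≤ Real.exp (-u) * Real.exp u :=
        mul_le_mul_of_nonneg_left (truncExp_le_exp k hu) (Real.exp_nonneg _)
    _ = 1 := by rw [← Real.exp_add]; simp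

/-- The hypothesis `-U ≤ d` places the exponent `l` below `u`, which lies below `m + 2` by a margin
proportional to `m + 2`; the moment bounds apply uniformly. -/
theorem abs_scaledDensity_sub_le {U d A : ℝ} (hU0 : 0 ≤ U) (hU1 : U < 1) (hd : -U ≤ d)
    (hA : 0 ≤ A) {m : ℕ} (hm : 2 ≤ (m + 2) * (1 - U)) :
    |scaledDensity U d A m - Real.exp (-((m + 2) * U)) * truncExp (m + 1) ((m + 2) * U)| ≤
      (1 - Real.exp (-((m + 2) * U)) * truncExp (m + 1) ((m + 2) * U)) * (2 / (1 - U)) +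
        A / (1 - U) ^ 2 * ((m : ℝ) + 2)⁻¹ := by
  have h1U : 0 < 1 - U := by linarith
  have hm0 : (0 : ℝ) < m + 2 := by positivity
  set u : ℝ := (m + 2) * U with hu
  set l : ℝ := (m + 2) * -d with hl
  have hu0 : 0 ≤ u := by positivity
  have hlu : l ≤ u := mul_le_mul_of_nonneg_left (by linarith) hm0.le
  have hum : u = (m + 2) - (m + 2) * (1 - U) := by rw [hu]; ring
  set Q := Real.exp (-u) * truncExp (m + 1) u with hQ
  have hQ0 : 0 ≤ Q := mul_nonneg (Real.exp_nonneg _) (truncExp_nonneg _ hu0)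
  have hQ1 : Q ≤ 1 := exp_neg_mul_truncExp_le_one _ hu0
  -- A single Poisson weight is at most the upper tail `1 - Q`.
  have hpois : Real.exp (-u) * (u ^ (m + 1) / (m + 1).factorial) ≤ 1 - Q := by
    rw [exp_neg_mul_pow_div_factorial]
    linarith [exp_neg_mul_truncExp_le_one (m + 2) hu0]
  have hM : ((m : ℝ) + 1) * expMoment m l ≤ 2 / (1 - U) := by
    have h1 : expMoment m l ≤ 1 / (m + 1 - u) := expMoment_le hlu hu0 (by linarith)
    have h2 : 1 / ((m : ℝ) + 1 - u) ≤ 1 / ((m + 2) * (1 - U) / 2) :=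
      one_div_le_one_div_of_le (by positivity) (by linarith)
    calc ((m : ℝ) + 1) * expMoment m l ≤ (m + 2) * (1 / ((m + 2) * (1 - U) / 2)) :=
          mul_le_mul (by linarith) (h1.trans h2) (expMoment_nonneg _ _) hm0.le
      _ = 2 / (1 - U) := by field_simp
  have hK : ((m : ℝ) + 2) * A * (expMoment (m + 1) l - expMoment (m + 2) l) ≤
      A / (1 - U) ^ 2 * ((m : ℝ) + 2)⁻¹ := by
    have h1 := expMoment_sub_succ_le (k := m + 1) hlu hu0 (by push_cast; linarith)
    rw [show (((m + 1 : ℕ) : ℝ) + 1 - u) = (m + 2) * (1 - U) by push_cast; rw [hu]; ring] at h1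
    calc _ ≤ ((m : ℝ) + 2) * A * (1 / ((m + 2) * (1 - U))) ^ 2 :=
          mul_le_mul_of_nonneg_left h1 (by positivity)
      _ = _ := by field_simp
  have hM0 := expMoment_nonneg m l
  have hK0 := sub_nonneg.2 (expMoment_succ_le (m + 1) l)
  have hp0 : 0 ≤ Real.exp (-u) * (u ^ (m + 1) / (m + 1).factorial) := by positivity
  have e : scaledDensity U d A m - Q =
      Real.exp (-u) * (u ^ (m + 1) / (m + 1).factorial) * ((m + 1) * expMoment m l) -
        Q * ((m + 2) * A * (expMoment (m + 1) l - expMoment (m + 2) l)) := by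
    have hf : (u ^ (m + 1) / (m.factorial : ℝ)) =
        u ^ (m + 1) / ((m + 1).factorial : ℝ) * (m + 1) := by
      rw [Nat.factorial_succ]; push_cast; field_simp
    rw [scaledDensity, ← hu, ← hl, hQ, hf]
    ring
  have h2 := mul_le_mul hpois hM (by positivity) (by linarith)
  have h3 : Q * ((m + 2) * A * (expMoment (m + 1) l - expMoment (m + 2) l)) ≤
      1 * (A / (1 - U) ^ 2 * ((m : ℝ) + 2)⁻¹) :=
    mul_le_mul hQ1 hK (by positivity) zero_le_one
  have h20 : 0 ≤ Real.exp (-u) * (u ^ (m + 1) / (m + 1).factorial) * ((m + 1) * expMoment m l) := by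
    positivity
  have h30 : 0 ≤ Q * ((m + 2) * A * (expMoment (m + 1) l - expMoment (m + 2) l)) := by positivity
  rw [e, abs_le]
  constructor <;> linarith

theorem tendsto_scaledDensity_one {U d A : ℝ} (hU0 : 0 ≤ U) (hU1 : U < 1) (hd : -U ≤ d)
    (hA : 0 ≤ A) : Tendsto (scaledDensity U d A) atTop (𝓝 1) := by
  have hQ := tendsto_exp_neg_mul_truncExp_one hU0 hU1
  have hb := ((hQ.const_sub 1).mul_const (2 / (1 - U))).add
    (tendsto_inv_natCast_add_two.const_mul (A / (1 - U) ^ 2))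
  rw [sub_self, zero_mul, mul_zero, add_zero] at hb
  have hm : ∀ᶠ m : ℕ in atTop, 2 ≤ ((m : ℝ) + 2) * (1 - U) :=
    ((tendsto_atTop_add_const_right _ (2 : ℝ) tendsto_natCast_atTop_atTop).atTop_mul_const
      (by linarith : 0 < 1 - U)).eventually_ge_atTop 2
  have hdiff := squeeze_zero_norm' (hm.mono fun m hm => by
    rw [Real.norm_eq_abs]; exact abs_scaledDensity_sub_le hU0 hU1 hd hA hm) hb
  simpa using hdiff.add hQ

/-- Exact rewriting by the closed form of the moments at `l = (m + 2) δ`. The truncated sums enter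
only through their ratio to the next term and through Poisson tails at `δ`, all with known limits.
-/
theorem mul_scaledDensity_eq {U δ A : ℝ} (hU : 0 < U) (hδ : 0 < δ) (m : ℕ) :
    Real.exp ((m + 2) * (U - δ)) * (δ / U) ^ (m + 2) * scaledDensity U (-δ) A m =
      δ / U * (Real.exp (-((m + 2) * δ)) * (((m + 2) * δ) ^ (m + 1) / (m + 1).factorial) *
        (truncExp (m + 1) ((m + 2) * U) * ((m + 1).factorial / ((m + 2) * U) ^ (m + 1))) +
        (1 - Real.exp (-((m + 2) * δ)) * truncExp (m + 1) ((m + 2) * δ)) -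
        A * (truncExp (m + 1) ((m + 2) * U) * ((m + 1).factorial / ((m + 2) * U) ^ (m + 1))) *
          ((1 - Real.exp (-((m + 2) * δ)) * truncExp (m + 2) ((m + 2) * δ)) * δ⁻¹ -
          (1 - Real.exp (-((m + 2) * δ)) * truncExp (m + 3) ((m + 2) * δ)) * δ⁻¹ ^ 2)) := by
  have hn : (0 : ℝ) < m + 2 := by positivity
  set n : ℝ := (m : ℝ) + 2 with hn'
  have hM (k : ℕ) : expMoment k (n * δ) = k.factorial * (Real.exp (n * δ) *
      (1 - Real.exp (-(n * δ)) * truncExp (k + 1) (n * δ))) / (n * δ) ^ (k + 1) := by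
    rw [eq_div_iff (by positivity), mul_comm, pow_mul_expMoment, mul_sub (Real.exp (n * δ)),
      ← mul_assoc (Real.exp (n * δ)), ← Real.exp_add, add_neg_cancel, Real.exp_zero, mul_one,
      one_mul]
  have hexp : Real.exp (n * (U - δ)) = Real.exp (n * U) * (Real.exp (n * δ))⁻¹ := by
    rw [← Real.exp_neg, ← Real.exp_add]; ring_nf
  have hf1 : ((m + 1).factorial : ℝ) = (n - 1) * m.factorial := by
    rw [Nat.factorial_succ, hn']; push_cast; ring
  have hf2 : ((m + 2).factorial : ℝ) = n * (m + 1).factorial := by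
    rw [Nat.factorial_succ, hn']; push_cast; ring
  have hn1 : n - 1 ≠ 0 := by
    have : (0 : ℝ) < m + 1 := by positivity
    linarith
  rw [scaledDensity, ← hn', neg_neg, hM, hM, hM, hexp, hf2, hf1, Real.exp_neg (n * U)]
  generalize 1 - Real.exp (-(n * δ)) * truncExp (m + 1) (n * δ) = P1
  generalize 1 - Real.exp (-(n * δ)) * truncExp (m + 1 + 1) (n * δ) = P2
  generalize 1 - Real.exp (-(n * δ)) * truncExp (m + 2 + 1) (n * δ) = P3
  rw [Real.exp_neg]
  have hX := (Real.exp_pos (n * δ)).ne'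
  have hY := (Real.exp_pos (n * U)).ne'
  generalize Real.exp (n * δ) = X at *
  generalize Real.exp (n * U) = Y at *
  -- With exponentials, truncations and the factorial treated as independent atoms, the identity is
  -- rational.
  generalize truncExp (m + 1) (n * U) = T
  have hg : (m.factorial : ℝ) ≠ 0 := by positivity
  generalize (m.factorial : ℝ) = g at *
  rw [div_pow, mul_pow, mul_pow, mul_pow, mul_pow]
  field_simp
  ring

theorem tendsto_mul_scaledDensity {U δ A : ℝ} (hU : 1 < U) (hδ : 1 < δ) :
    Tendsto (fun m : ℕ => Real.exp ((m + 2) * (U - δ)) * (δ / U) ^ (m + 2) *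
      scaledDensity U (-δ) A m) atTop (𝓝 (δ / U - A * (1 - δ⁻¹) / ((U - 1) * U))) := by
  have hδ0 : 0 < δ := one_pos.trans hδ
  have hU0 : 0 < U := one_pos.trans hU
  have hR := tendsto_truncExp_mul_factorial_div_pow hU
  have h3 := tendsto_exp_neg_mul_truncExp_zero hδ
  have hmono (k : ℕ) (m : ℕ) (hk : k ≤ m + 3) :
      Real.exp (-((m + 2) * δ)) * truncExp k ((m + 2) * δ) ≤
        Real.exp (-((m + 2) * δ)) * truncExp (m + 3) ((m + 2) * δ) :=
    mul_le_mul_of_nonneg_left (truncExp_mono (by positivity) hk) (Real.exp_nonneg _)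
  have h0 (k : ℕ) (m : ℕ) : 0 ≤ Real.exp (-((m + 2) * δ)) * truncExp k ((m + 2) * δ) :=
    mul_nonneg (Real.exp_nonneg _) (truncExp_nonneg _ (by positivity))
  have h1 := squeeze_zero (fun m => h0 (m + 1) m) (fun m => hmono (m + 1) m (by omega)) h3
  have h2 := squeeze_zero (fun m => h0 (m + 2) m) (fun m => hmono (m + 2) m (by omega)) h3
  have hp := h2.sub h1
  rw [sub_zero] at hp
  have hp' : Tendsto (fun m : ℕ => Real.exp (-((m + 2) * δ)) *
      (((m + 2) * δ) ^ (m + 1) / (m + 1).factorial)) atTop (𝓝 0) :=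
    hp.congr fun m => (exp_neg_mul_pow_div_factorial _ _).symm
  have := ((((hp'.mul hR).add (h1.const_sub 1)).sub ((hR.const_mul A).mul
    (((h2.const_sub 1).mul_const δ⁻¹).sub ((h3.const_sub 1).mul_const (δ⁻¹ ^ 2))))).const_mul (δ / U))
  have hU1 : U - 1 ≠ 0 := by linarith
  have e : δ / U - A * (1 - δ⁻¹) / ((U - 1) * U) = δ / U * (0 * (U - 1)⁻¹ + (1 - 0) -
      A * (U - 1)⁻¹ * ((1 - 0) * δ⁻¹ - (1 - 0) * δ⁻¹ ^ 2)) := by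
    field_simp
    ring
  rw [e]
  exact this.congr fun m => (mul_scaledDensity_eq hU0 hδ0 m).symm

/-! ### The rate function -/

theorem neg_norm_sq_le_outlierDelta (α w : ℂ) : -‖w‖ ^ 2 ≤ outlierDelta α w := by
  have := norm_sub_sq_eq_add_outlierDelta α w
  linarith [sq_nonneg ‖w - α‖]

/-- The argument of the logarithm is `-Δ / |w|²`, because `|w - α|² = |w|² + Δ`. -/
theorem outlierRate_eq {α w : ℂ} (hw : w ≠ 0) :
    outlierRate α w = ‖w‖ ^ 2 - -outlierDelta α w +
      Real.log (|outlierDelta α w| / ‖w‖ ^ 2) := by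
  have hw0 : 0 < ‖w‖ ^ 2 := by positivity
  have h : 1 - ‖w - α‖ ^ 2 / ‖w‖ ^ 2 = -(outlierDelta α w / ‖w‖ ^ 2) := by
    rw [norm_sub_sq_eq_add_outlierDelta]
    field_simp
    ring
  rw [outlierRate, h, abs_neg, abs_div, abs_of_pos hw0, norm_sub_sq_eq_add_outlierDelta]
  ring

theorem outlierRate_nonneg_and_eq_zero_iff {α w : ℂ} (hd : outlierDelta α w < -1) :
    0 ≤ outlierRate α w ∧ (outlierRate α w = 0 ↔ w = α) := by
  have hU := neg_norm_sq_le_outlierDelta α w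
  have hU0 : 0 < ‖w‖ ^ 2 := by linarith
  have hw : w ≠ 0 := by rintro rfl; simp at hU0
  have hiff : w = α ↔ ‖w‖ ^ 2 = -outlierDelta α w := by
    rw [← sub_eq_zero, ← norm_eq_zero, ← sq_eq_zero_iff, norm_sub_sq_eq_add_outlierDelta]
    constructor <;> intro h <;> linarith
  rw [hiff, outlierRate_eq hw, abs_of_neg (by linarith)]
  set δ := -outlierDelta α w with hδ
  have hδ1 : 1 < δ := by linarith
  set U := ‖w‖ ^ 2 with hUdef
  have hδU : δ ≤ U := by linarith
  have hlog : Real.log (δ / U) = -Real.log (U / δ) := by rw [← Real.log_inv, inv_div]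
  have hpos : 0 < U / δ := by positivity
  rcases eq_or_lt_of_le hδU with h | h
  · rw [← h, sub_self, div_self (by linarith), Real.log_one, add_zero]
    simp
  · have h1 : Real.log (U / δ) < U / δ - 1 :=
      Real.log_lt_sub_one_of_pos hpos ((one_lt_div (by linarith)).2 h).ne'
    -- Here `δ > 1` enters: `(U - δ) / δ ≤ U - δ`.
    have h2 : U / δ - 1 ≤ U - δ := by
      rw [div_sub_one (by linarith), div_le_iff₀ (by linarith)]
      nlinarith
    have h3 : 0 < U - δ + Real.log (δ / U) := by rw [hlog]; linarith
    exact ⟨h3.le, ⟨fun h' => absurd h' h3.ne', fun h' => absurd h' h.ne'⟩⟩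

theorem outlierDelta_self (α : ℂ) : outlierDelta α α = -‖α‖ ^ 2 := by
  have := norm_sub_sq_eq_add_outlierDelta α α
  rw [sub_self, norm_zero] at this
  linarith

theorem exp_mul_outlierRate {α w : ℂ} (hd : outlierDelta α w < -1) (m : ℕ) :
    Real.exp (((m + 2 : ℕ) : ℝ) * outlierRate α w) =
      Real.exp ((m + 2) * (‖w‖ ^ 2 - -outlierDelta α w)) *
        (-outlierDelta α w / ‖w‖ ^ 2) ^ (m + 2) := by
  have hU := neg_norm_sq_le_outlierDelta α w
  have hU0 : 0 < ‖w‖ ^ 2 := by linarith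
  have hw : w ≠ 0 := by rintro rfl; simp at hU0
  have hq : 0 < -outlierDelta α w / ‖w‖ ^ 2 := div_pos (by linarith) hU0
  rw [outlierRate_eq hw, abs_of_neg (by linarith), mul_add, Real.exp_add, ← Real.exp_log hq,
    ← Real.exp_nat_mul, Real.exp_log hq]
  push_cast
  rfl

/-! ### Limits of the density on the two regions and the main theorem -/

theorem tendsto_meanDensity_of_norm_lt_one (α : ℂ) {w : ℂ} (hw : ‖w‖ < 1) :
    Tendsto (fun N : ℕ => meanDensity N ((√(N : ℝ) : ℂ) * α) ((√(N : ℝ) : ℂ) * w)) atTop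
      (𝓝 (1 / Real.pi)) := by
  rw [← tendsto_add_atTop_iff_nat 2]
  simp_rw [meanDensity_sqrt_mul]
  have hU : ‖w‖ ^ 2 < 1 := by nlinarith [norm_nonneg w]
  simpa using (tendsto_scaledDensity_one (sq_nonneg ‖w‖) hU (neg_norm_sq_le_outlierDelta α w)
    (sq_nonneg ‖α‖)).const_mul (1 / Real.pi)

theorem tendsto_exp_mul_meanDensity {α w : ℂ} (hw : 1 < ‖w‖) (hd : outlierDelta α w < -1) :
    Tendsto (fun N : ℕ => Real.exp (N * outlierRate α w) *
      meanDensity N ((√(N : ℝ) : ℂ) * α) ((√(N : ℝ) : ℂ) * w)) atTop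
      (𝓝 (1 / Real.pi * outlierPrefactor α w)) := by
  rw [← tendsto_add_atTop_iff_nat 2]
  have hU : 1 < ‖w‖ ^ 2 := by nlinarith
  have h := (tendsto_mul_scaledDensity (A := ‖α‖ ^ 2) hU
    (by linarith : 1 < -outlierDelta α w)).const_mul (1 / Real.pi)
  rw [outlierPrefactor, abs_of_neg (by linarith : outlierDelta α w < 0)]
  refine h.congr fun m => ?_
  rw [meanDensity_sqrt_mul, exp_mul_outlierRate hd, neg_neg]
  ring

theorem mainTheorem7 (α : ℂ) (r : (N : ℕ) → Fin N → ℂ)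
    (hr : ∀ N : ℕ, 1 ≤ N → star (r N) ⬝ᵥ r N = 1) :
    -- for every `N ≥ 1` the mean eigenvalue density exists and is unique
    (∀ N : ℕ, 1 ≤ N → ∃! p : ℂ → ℝ,
      IsMeanEigenvalueDensity (rankOneNormal ((√(N : ℝ) : ℂ) * α) (r N)) p) ∧
    -- its asymptotics
    (∀ p : ℕ → ℂ → ℝ,
      (∀ N : ℕ, 1 ≤ N →
        IsMeanEigenvalueDensity (rankOneNormal ((√(N : ℝ) : ℂ) * α) (r N)) (p N)) →
      (∀ w : ℂ, ‖w‖ < 1 →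
        Tendsto (fun N : ℕ => p N ((√(N : ℝ) : ℂ) * w)) atTop (𝓝 (1 / Real.pi))) ∧
      (∀ w : ℂ, 1 < ‖w‖ → outlierDelta α w < -1 →
        Tendsto (fun N : ℕ => Real.exp (N * outlierRate α w) * p N ((√(N : ℝ) : ℂ) * w)) atTop
          (𝓝 (1 / Real.pi * outlierPrefactor α w)) ∧
        (outlierPrefactor α w ≠ 0 →
          (fun N : ℕ => p N ((√(N : ℝ) : ℂ) * w)) ~[atTop]
            (fun N : ℕ => 1 / Real.pi * Real.exp (-(N * outlierRate α w)) *
              outlierPrefactor α w)))) ∧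
    -- the rate function vanishes exactly at the outlier `α`, which is in the region iff `1 < ‖α‖`
    (∀ w : ℂ, 1 < ‖w‖ → outlierDelta α w < -1 →
      0 ≤ outlierRate α w ∧ (outlierRate α w = 0 ↔ w = α)) ∧
    ((1 < ‖α‖ ∧ outlierDelta α α < -1) ↔ 1 < ‖α‖) := by
  have hpi := Real.pi_pos
  refine ⟨fun N hN => ⟨_, isMeanEigenvalueDensity_meanDensity hN _ (hr N hN), fun q hq =>
    hq.unique (isMeanEigenvalueDensity_meanDensity hN _ (hr N hN))⟩, fun p hp => ?_,
    fun w _ hd => outlierRate_nonneg_and_eq_zero_iff hd, ⟨And.left, fun h => ⟨h, ?_⟩⟩⟩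
  · have hpN : ∀ᶠ N : ℕ in atTop, meanDensity N ((√(N : ℝ) : ℂ) * α) = p N :=
      (eventually_ge_atTop 1).mono fun N hN =>
        (isMeanEigenvalueDensity_meanDensity hN _ (hr N hN)).unique (hp N hN)
    refine ⟨fun w hw => (tendsto_meanDensity_of_norm_lt_one α hw).congr'
      (hpN.mono fun N h => by rw [h]), fun w hw hd => ?_⟩
    have hlim := (tendsto_exp_mul_meanDensity hw hd).congr' (hpN.mono fun N h => by rw [h])
    refine ⟨hlim, fun hB => ?_⟩
    have hc : 1 / Real.pi * outlierPrefactor α w ≠ 0 := mul_ne_zero (by positivity) hB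
    refine (isEquivalent_iff_tendsto_one (Eventually.of_forall fun N =>
      mul_ne_zero (by positivity) hB)).2 ?_
    have h1 := hlim.div_const (1 / Real.pi * outlierPrefactor α w)
    rw [div_self hc] at h1
    refine h1.congr fun N => ?_
    rw [Pi.div_apply, Real.exp_neg]
    field_simp
  · rw [outlierDelta_self]
    nlinarith
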